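/- Conventions. Let $(\widetilde M^{1,4},\tilde g)$ be a connected oriented smooth $5$-manifold with a Lorentzian metric of signature $(+,-,-,-,-)$, and let $(M^6,g)$ be a connected oriented smooth $6$-manifold with a negative definite metric (a Riemannian metric in the "mostly minus" convention). Let $\mathsf X=\widetilde M^{1,4}\times M^6$ with $h=\tilde g+g$ and $\mathrm{vol}_{\mathsf X}=\mathrm{vol}_{\widetilde M}\wedge\mathrm{vol}_M$. For $k$-forms put $\langle\omega,\phi\rangle=\frac1{k!}\omega_{i_1\dots i_k}\phi_{j_1\dots j_k}h^{i_1j_1}\cdots h^{i_kj_k}$ and $\|\omega\|^2=\langle\omega,\omega\rangle$ (similarly for $\tilde g$, $g$); a form $\omega$ is null if $\langle\omega,\omega\rangle=0$ everywhere. The Hodge stars $\star,\star_5,\star_6$ of $\mathsf X,\widetilde M,M$ are defined by $\alpha\wedge\star\beta=\langle\alpha,\beta\rangle\,\mathrm{vol}$. For a $4$-form $\mathsf F$ on $\mathsf X$, the triple $(\mathsf X,h,\mathsf F)$ is a bosonic supergravity background if $$d\mathsf F=0,\qquad d\star\mathsf F=\tfrac12\,\mathsf F\wedge\mathsf F,\qquad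 \mathrm{Ric}_h(X,Y)=-\tfrac12\langle X\lrcorner\mathsf F,Y\lrcorner\mathsf F\rangle_h+\tfrac16\,h(X,Y)\,\|\mathsf F\|_h^2 .$$ All forms and functions below are smooth, and forms on the factors are pulled back to $\mathsf X$ where necessary. (A) Let $\tilde\alpha\in\Omega^4(\widetilde M)$, $\tilde\beta\in\Omega^3(\widetilde M)$, $\varphi\in C^\infty(M)$, $\nu\in\Omega^1(M)$, none of them identically zero, with $\tilde\alpha$ and $\tilde\beta$ null, and let $\mathsf F=\varphi\tilde\alpha+\tilde\beta\wedge\nu$. Then $(\mathsf X,h,\mathsf F)$ is a bosonic supergravity background if and only if $(M^6,g)$ is Ricci-flat, there are constants $\kappa,\lambda\in\mathbb R$ with $$d\tilde\alpha=d\nu=0,\quad d\varphi=\kappa\nu,\quad d\tilde\beta=-\kappa\tilde\alpha,\quad d\star_5\tilde\beta=0,\quad d\star_5\tilde\alpha=-\lambda\star_5\tilde\beta,\quad d\star_6\nu=\lambda\star_6\varphi,$$ and, for all vector fields $\tilde X,\tilde Y$ on $\widetilde M$ and at all points of $\widetilde M\times M$, $$\mathrm{Ric}_{\tilde g}(\tilde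 X,\tilde Y)=-\tfrac12\langle\tilde X\lrcorner\tilde\alpha,\tilde Y\lrcorner\tilde\alpha\rangle_{\tilde g}\,\varphi^2-\tfrac12\langle\tilde X\lrcorner\tilde\beta,\tilde Y\lrcorner\tilde\beta\rangle_{\tilde g}\,\|\nu\|_g^2,\qquad \langle\tilde\beta,\tilde X\lrcorner\tilde\alpha\rangle_{\tilde g}=0 .$$ (B) Let $\tilde\beta\in\Omega^3(\widetilde M)$, $\tilde\varpi\in\Omega^1(\widetilde M)$, $\nu\in\Omega^1(M)$, $\epsilon\in\Omega^3(M)$, none of them identically zero, with $\tilde\beta$ and $\tilde\varpi$ null, and let $\mathsf F=\tilde\beta\wedge\nu+\tilde\varpi\wedge\epsilon$. Then $(\mathsf X,h,\mathsf F)$ is a bosonic supergravity background if and only if $(M^6,g)$ is Ricci-flat, $$d\tilde\beta=d\nu=d\tilde\varpi=d\epsilon=0,\quad d\star_6\nu=0,\quad d\star_5\tilde\beta=d\star_5\tilde\varpi=0,\quad \star_5\tilde\varpi\wedge d\star_6\epsilon=\tilde\beta\wedge\tilde\varpi\wedge\epsilon\wedge\nu,$$ and, for all vector fields $\tilde X,\tilde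 Y$ on $\widetilde M$ and at all points of $\widetilde M\times M$, $$\mathrm{Ric}_{\tilde g}(\tilde X,\tilde Y)=-\tfrac12\langle\tilde X\lrcorner\tilde\beta,\tilde Y\lrcorner\tilde\beta\rangle_{\tilde g}\,\|\nu\|_g^2-\tfrac12\,\tilde\varpi(\tilde X)\,\tilde\varpi(\tilde Y)\,\|\epsilon\|_g^2 .$$ -/

import Mathlib

set_option maxSynthPendingDepth 3

open scoped Manifold ContDiff Matrix

noncomputable section

namespace Sugra

/-! ### Linear algebra on one tangent space -/

section LinearAlgebra

variable {V : Type*} [AddCommGroup V] [Module ℝ V] [TopologicalSpace V]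

/-- The exterior product `a ∧ b` (sum over shuffles, so that `(dx ∧ dy)(∂x, ∂y) = 1`). -/
def wedge {k l : ℕ} (a : V [⋀^Fin k]→L[ℝ] ℝ) (b : V [⋀^Fin l]→L[ℝ] ℝ) :
    V [⋀^Fin (k + l)]→L[ℝ] ℝ :=
  { ((LinearMap.mul' ℝ ℝ).compAlternatingMap
      (a.toAlternatingMap.domCoprod b.toAlternatingMap)).domDomCongr finSumFinEquiv with
    cont := by
      change Continuous fun v : Fin (k + l) → V => LinearMap.mul' ℝ ℝ
        (a.toAlternatingMap.domCoprod b.toAlternatingMap fun i => v (finSumFinEquiv i))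
      simp only [AlternatingMap.domCoprod_apply, sum_apply, map_sum]
      refine continuous_finsetSum _ fun σ _ => ?_
      induction σ using Quotient.inductionOn' with | _ σ
      have ha := a.cont
      have hb := b.cont
      simp only [AlternatingMap.domCoprod.summand_mk'', smul_apply,
        MultilinearMap.domDomCongr_apply, MultilinearMap.domCoprod_apply, map_zsmul_unit,
        LinearMap.mul'_apply]
      refine Continuous.const_smul (Continuous.mul ?_ ?_) _
      · exact ha.comp (by fun_prop)
      · exact hb.comp (by fun_prop) }

/-- The interior product `v ⌟ a = a(v, ·, …, ·)`. -/
def interior {k : ℕ} (v : V) (a : V [⋀^Fin (k + 1)]→L[ℝ] ℝ) : V [⋀^Fin k]→L[ℝ] ℝ :=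
  { a.toAlternatingMap.curryLeft v with
    cont := by
      have ha := a.cont
      change Continuous fun w : Fin k → V => a (Matrix.vecCons v w)
      exact ha.comp (by unfold Matrix.vecCons; fun_prop) }

theorem append_update_right {V : Type*} {k m : ℕ} [DecidableEq (Fin m)] (w : Fin k → V)
    (v : Fin m → V) (i : Fin m) (z : V) : Fin.append w (Function.update v i z) =
      Function.update (Fin.append w v) (Fin.natAdd k i) z := by
  funext j
  refine Fin.addCases (fun j => ?_) (fun j => ?_) j
  · rw [Function.update_of_ne (by simp [Fin.ext_iff]; omega)]
    simp
  · by_cases hj : j = i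
    · subst hj
      simp
    · rw [Function.update_of_ne (by simpa using hj)]
      simp [Function.update_of_ne hj]

/-- The contraction `a(w₁, …, w_k, ·, …, ·)`, where `a` has degree `n = k + m`. -/
def contract {k m n : ℕ} (h : k + m = n) (w : Fin k → V) (a : V [⋀^Fin n]→L[ℝ] ℝ) :
    V [⋀^Fin m]→L[ℝ] ℝ where
  toFun v := a fun i => Fin.append w v (Fin.cast h.symm i)
  map_update_add' := by
    subst h
    intro _ v i x y
    have key : ∀ z, (fun j => Fin.append w (Function.update v i z) (Fin.cast rfl j)) =
        Function.update (Fin.append w v) (Fin.natAdd k i) z := by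
      intro z
      exact append_update_right w v i z
    simp only [key, a.map_update_add]
  map_update_smul' := by
    subst h
    intro _ v i c x
    have key : ∀ z, (fun j => Fin.append w (Function.update v i z) (Fin.cast rfl j)) =
        Function.update (Fin.append w v) (Fin.natAdd k i) z := by
      intro z
      exact append_update_right w v i z
    simp only [key, a.map_update_smul]
  map_eq_zero_of_eq' := by
    subst h
    intro v i j hv hij
    refine a.map_eq_zero_of_eq (i := Fin.natAdd k i) (j := Fin.natAdd k j) _ ?_ ?_
    · simpa using hv
    · simpa using hij
  cont := by
    subst h
    refine a.cont.comp (continuous_pi fun j => ?_)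
    refine Fin.addCases (fun j => ?_) (fun j => ?_) j
    · simpa using continuous_const
    · simpa using continuous_apply j

variable [FiniteDimensional ℝ V]

/-- The Gram matrix `g_{ij}` of a bilinear form in a basis of `V`. -/
def gram (g : V →L[ℝ] V →L[ℝ] ℝ) :
    Matrix (Fin (Module.finrank ℝ V)) (Fin (Module.finrank ℝ V)) ℝ :=
  Matrix.of fun i j => g (Module.finBasis ℝ V i) (Module.finBasis ℝ V j)

/-- `⟨a, b⟩_g = (1/k!) ∑ a_{i₁…i_k} b_{j₁…j_k} g^{i₁j₁} ⋯ g^{i_kj_k}`. -/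
def formInner {k : ℕ} (g : V →L[ℝ] V →L[ℝ] ℝ) (a b : V [⋀^Fin k]→L[ℝ] ℝ) : ℝ :=
  (k.factorial : ℝ)⁻¹ *
    ∑ i : Fin k → Fin (Module.finrank ℝ V), ∑ j : Fin k → Fin (Module.finrank ℝ V),
      a (fun r => Module.finBasis ℝ V (i r)) * b (fun r => Module.finBasis ℝ V (j r)) *
        ∏ r, (gram g)⁻¹ (i r) (j r)

/-- The Hodge star of a `k`-form `b` with respect to `g` and the volume form `vol`,
`(⋆b)(v₁, …, v_m) = (1/k!) ∑ b_{i₁…i_k} g^{i₁j₁} ⋯ g^{i_kj_k} vol(e_{j₁}, …, e_{j_k}, v₁, …, v_m)`,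
that is, the `m`-form determined by `a ∧ ⋆b = ⟨a, b⟩_g vol`. -/
def starAt {k m n : ℕ} (h : k + m = n) (g : V →L[ℝ] V →L[ℝ] ℝ) (vol : V [⋀^Fin n]→L[ℝ] ℝ)
    (b : V [⋀^Fin k]→L[ℝ] ℝ) : V [⋀^Fin m]→L[ℝ] ℝ :=
  (k.factorial : ℝ)⁻¹ •
    ∑ i : Fin k → Fin (Module.finrank ℝ V), ∑ j : Fin k → Fin (Module.finrank ℝ V),
      (b (fun r => Module.finBasis ℝ V (i r)) * ∏ r, (gram g)⁻¹ (i r) (j r)) •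
        contract h (fun r => Module.finBasis ℝ V (j r)) vol

end LinearAlgebra

/-! ### Tensor fields and forms on a manifold

Tensor fields are given by their value at each point; smoothness is a separate predicate. -/

section Manifold

variable {E : Type*} [NormedAddCommGroup E] [NormedSpace ℝ E]
  {H : Type*} [TopologicalSpace H] (I : ModelWithCorners ℝ E H)
  (M : Type*) [TopologicalSpace M] [ChartedSpace H M]

/-- Fields of (not yet smooth) exterior `k`-forms on `M`. -/
abbrev FormField (k : ℕ) := ∀ x : M, TangentSpace I x [⋀^Fin k]→L[ℝ] ℝ

/-- Fields of (not yet smooth, symmetric or nondegenerate) bilinear forms on `M`. -/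
abbrev BilinField := ∀ x : M, TangentSpace I x →L[ℝ] TangentSpace I x →L[ℝ] ℝ

instance tangentSpace_finiteDimensional [FiniteDimensional ℝ E] (x : M) :
    FiniteDimensional ℝ (TangentSpace I x) :=
  inferInstanceAs (FiniteDimensional ℝ E)

variable {I M}

/-- The differential at `y` of the inverse of the chart around `x₀`. -/
def chartSymmDeriv (x₀ : M) (y : E) : E →L[ℝ] TangentSpace I ((extChartAt I x₀).symm y) :=
  mfderiv 𝓘(ℝ, E) I (extChartAt I x₀).symm y

variable (I) in
/-- The differential at `x` of the chart around `x`. -/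
def chartDeriv (x : M) : TangentSpace I x →L[ℝ] E :=
  mfderiv I 𝓘(ℝ, E) (extChartAt I x) x

/-- A form in the coordinates of the chart around `x₀`. -/
def FormField.inChart {k : ℕ} (w : FormField I M k) (x₀ : M) (y : E) : E [⋀^Fin k]→L[ℝ] ℝ :=
  (w ((extChartAt I x₀).symm y)).compContinuousLinearMap (chartSymmDeriv x₀ y)

/-- A bilinear form field in the coordinates of the chart around `x₀`. -/
def BilinField.inChart (g : BilinField I M) (x₀ : M) (y : E) : E →L[ℝ] E →L[ℝ] ℝ :=
  (ContinuousLinearMap.precomp ℝ (chartSymmDeriv (I := I) x₀ y)).comp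
    ((g ((extChartAt I x₀).symm y)).comp (chartSymmDeriv x₀ y))

/-- Smoothness of a form: its coordinate expression in every chart is `C^∞`. -/
def FormField.Smooth {k : ℕ} (w : FormField I M k) : Prop :=
  ∀ x₀ : M, ContDiffOn ℝ ∞ (w.inChart x₀) (extChartAt I x₀).target

/-- Smoothness of a bilinear form field, in charts. -/
def BilinField.Smooth (g : BilinField I M) : Prop :=
  ∀ x₀ : M, ContDiffOn ℝ ∞ (g.inChart x₀) (extChartAt I x₀).target

/-- The exterior derivative. -/
def FormField.d {k : ℕ} (w : FormField I M k) : FormField I M (k + 1) := fun x =>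
  (extDeriv (w.inChart x) (extChartAt I x x)).compContinuousLinearMap (chartDeriv I x)

def FormField.wedge {k l : ℕ} (w : FormField I M k) (z : FormField I M l) :
    FormField I M (k + l) := fun x => Sugra.wedge (w x) (z x)

variable (I) in
/-- A function as a `0`-form. -/
def ofFunction (f : M → ℝ) : FormField I M 0 := fun x =>
  ContinuousAlternatingMap.constOfIsEmpty ℝ (TangentSpace I x) (Fin 0) (f x)

section Pullback

variable {E' : Type*} [NormedAddCommGroup E'] [NormedSpace ℝ E']
  {H' : Type*} [TopologicalSpace H'] {I' : ModelWithCorners ℝ E' H'}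
  {M' : Type*} [TopologicalSpace M'] [ChartedSpace H' M']

/-- The pullback of a form along `f`. -/
def FormField.pullback {k : ℕ} (w : FormField I' M' k) (f : M → M') : FormField I M k := fun x =>
  (w (f x)).compContinuousLinearMap (mfderiv I I' f x)

/-- The pullback of a bilinear form field along `f`. -/
def BilinField.pullback (g : BilinField I' M') (f : M → M') : BilinField I M := fun x =>
  (ContinuousLinearMap.precomp ℝ (mfderiv I I' f x)).comp ((g (f x)).comp (mfderiv I I' f x))

/-- The product metric `g₁ + g₂` on `M × M'`. -/
def prodMetric (g₁ : BilinField I M) (g₂ : BilinField I' M') :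
    BilinField (I.prod I') (M × M') :=
  fun p => g₁.pullback (I := I.prod I') Prod.fst p + g₂.pullback (I := I.prod I') Prod.snd p

/-- The pullback to `M × M'` of a form on the first factor. -/
def FormField.left {k : ℕ} (w : FormField I M k) :
    FormField (I.prod I') (M × M') k :=
  w.pullback Prod.fst

/-- The pullback to `M × M'` of a form on the second factor. -/
def FormField.right {k : ℕ} (w : FormField I' M' k) :
    FormField (I.prod I') (M × M') k :=
  w.pullback Prod.snd

end Pullback

/-! ### Curvature -/

/-- The Christoffel map `Γ_y(u, v)` of a field `G` of nondegenerate symmetric bilinear forms on `E`,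
determined by `G_y(Γ_y(u, v), w) = ½ (∂_u G(v, w) + ∂_v G(u, w) - ∂_w G(u, v))`. -/
def christoffel (G : E → E →L[ℝ] E →L[ℝ] ℝ) (y : E) : E →L[ℝ] E →L[ℝ] E :=
  (ContinuousLinearMap.compL ℝ E (E →L[ℝ] ℝ) E (G y).inverse).comp
    ((2 : ℝ)⁻¹ • (fderiv ℝ G y + (fderiv ℝ G y).flip -
      (ContinuousLinearMap.flipₗᵢ ℝ E E ℝ).toContinuousLinearEquiv.toContinuousLinearMap.comp
        (fderiv ℝ G y).flip))

/-- For fixed `v, w`, the endomorphism `u ↦ R(u, v)w` where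
`R(u, v)w = ∂_u Γ(v, w) - ∂_v Γ(u, w) + Γ(u, Γ(v, w)) - Γ(v, Γ(u, w))`. -/
def curvature (G : E → E →L[ℝ] E →L[ℝ] ℝ) (y v w : E) : E →L[ℝ] E :=
  ((fderiv ℝ (christoffel G) y).flip v).flip w - (fderiv ℝ (christoffel G) y v).flip w
    + (christoffel G y).flip (christoffel G y v w)
    - (christoffel G y v).comp ((christoffel G y).flip w)

/-- The Ricci tensor `Ric(v, w) = tr(u ↦ R(u, v)w)` of the Levi-Civita connection of `g`, computed
at each point in the chart around it. -/
def ricci (g : BilinField I M) (x : M) (v w : TangentSpace I x) : ℝ :=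
  LinearMap.trace ℝ E
    (curvature (g.inChart x) (extChartAt I x x) (chartDeriv I x v) (chartDeriv I x w) : E →ₗ[ℝ] E)

def IsRicciFlat (g : BilinField I M) : Prop :=
  ∀ (x : M) (v w : TangentSpace I x), ricci g x v w = 0

/-! ### Metrics in the "mostly minus" convention -/

/-- A smooth metric of signature `(+, -, …, -)`. -/
structure IsLorentzian (g : BilinField I M) : Prop where
  smooth : g.Smooth
  symm : ∀ (x : M) (v w : TangentSpace I x), g x v w = g x w v
  signature : ∀ x : M, ∃ t : TangentSpace I x, 0 < g x t t ∧
    ∀ v : TangentSpace I x, v ≠ 0 → g x t v = 0 → g x v v < 0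

/-- A smooth negative definite metric; in the "mostly minus" convention this is a
Riemannian metric. -/
structure IsNegRiemannian (g : BilinField I M) : Prop where
  smooth : g.Smooth
  symm : ∀ (x : M) (v w : TangentSpace I x), g x v w = g x w v
  neg : ∀ (x : M) (v : TangentSpace I x), v ≠ 0 → g x v v < 0

/-- `vol` is the volume form of `g` for an orientation of the `n`-dimensional manifold `M`: a smooth
`n`-form taking the values `±|det g(vᵢ, vⱼ)|^{1/2}`. The choice of such a form is the choice of an
orientation of `M`. -/
structure IsVolumeForm {n : ℕ} (g : BilinField I M) (vol : FormField I M n) : Prop where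
  smooth : vol.Smooth
  sq_eq : ∀ (x : M) (v : Fin n → TangentSpace I x),
    vol x v ^ 2 = |(Matrix.of fun i j => g x (v i) (v j)).det|

variable [FiniteDimensional ℝ E]

/-- The Hodge star on `(M, g)` with volume form `vol`. -/
def hodge {n : ℕ} (g : BilinField I M) (vol : FormField I M n) {k m : ℕ} (h : k + m = n)
    (w : FormField I M k) : FormField I M m :=
  fun x => starAt h (g x) (vol x) (w x)

/-- A form `w` is null if `⟨w, w⟩_g = 0`. -/
def IsNull {k : ℕ} (g : BilinField I M) (w : FormField I M k) : Prop :=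
  ∀ x : M, formInner (g x) (w x) (w x) = 0

/-- The eleven-dimensional bosonic supergravity equations ("mostly minus" convention):
`dF = 0`, `d ⋆ F = ½ F ∧ F`, `Ric(X, Y) = -½ ⟨X ⌟ F, Y ⌟ F⟩ + (1/6) h(X, Y) ‖F‖²`. -/
structure IsBackground (h : BilinField I M) (vol : FormField I M 11) (F : FormField I M 4) :
    Prop where
  closed : F.d = 0
  maxwell : (hodge h vol (show 4 + 7 = 11 from rfl) F).d = (2⁻¹ : ℝ) • F.wedge F
  einstein : ∀ (x : M) (X Y : TangentSpace I x),
    ricci h x X Y = -(1 / 2) * formInner (h x) (interior X (F x)) (interior Y (F x))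
      + (1 / 6) * h x X Y * formInner (h x) (F x) (F x)

end Manifold

end Sugra

end

noncomputable section

namespace Sugra

set_option linter.unusedSectionVars false

section WedgeFormula

variable {V : Type*} [AddCommGroup V] [Module ℝ V] [TopologicalSpace V]

theorem wedge_apply_sum {k l : ℕ} (a : V [⋀^Fin k]→L[ℝ] ℝ) (b : V [⋀^Fin l]→L[ℝ] ℝ)
    (v : Fin (k + l) → V) :
    (k.factorial * l.factorial : ℝ) * wedge a b v =
      ∑ σ : Equiv.Perm (Fin k ⊕ Fin l), ((Equiv.Perm.sign σ : ℤ) : ℝ) *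
        (a (fun i => v (finSumFinEquiv (σ (Sum.inl i)))) *
          b (fun j => v (finSumFinEquiv (σ (Sum.inr j))))) := by
  have h := congrArg (LinearMap.mul' ℝ ℝ) (DFunLike.congr_fun
    (MultilinearMap.domCoprod_alternization_eq a.toAlternatingMap b.toAlternatingMap)
      (fun i => v (finSumFinEquiv i)))
  have h2 : wedge a b v = LinearMap.mul' ℝ ℝ
      (a.toAlternatingMap.domCoprod b.toAlternatingMap fun i => v (finSumFinEquiv i)) := rfl
  rw [AlternatingMap.smul_apply, map_nsmul, ← h2, nsmul_eq_mul, Fintype.card_fin,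
    Fintype.card_fin, Nat.cast_mul] at h
  rw [← h, MultilinearMap.alternatization_apply, map_sum]
  refine Finset.sum_congr rfl fun σ _ => ?_
  rw [Units.smul_def, map_zsmul, zsmul_eq_mul]
  simp [MultilinearMap.domDomCongr_apply, MultilinearMap.domCoprod_apply, LinearMap.mul'_apply]

theorem wedge_apply {k l : ℕ} (a : V [⋀^Fin k]→L[ℝ] ℝ) (b : V [⋀^Fin l]→L[ℝ] ℝ)
    (v : Fin (k + l) → V) :
    (k.factorial * l.factorial : ℝ) * wedge a b v =
      ∑ σ : Equiv.Perm (Fin (k + l)), ((Equiv.Perm.sign σ : ℤ) : ℝ) *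
        (a (fun i => v (σ (Fin.castAdd l i))) * b (fun j => v (σ (Fin.natAdd k j)))) := by
  rw [wedge_apply_sum]
  refine Fintype.sum_equiv (finSumFinEquiv.permCongr) _ _ fun σ => ?_
  simp [Equiv.Perm.sign_permCongr, Equiv.permCongr_apply]

end WedgeFormula

section WedgeTo

variable {V : Type*} [AddCommGroup V] [Module ℝ V] [TopologicalSpace V]
variable {V' : Type*} [AddCommGroup V'] [Module ℝ V'] [TopologicalSpace V']

/-- The exterior product of a `k`-form and an `l`-form, as a form of degree `n = k + l`. -/
def wedgeTo {k l n : ℕ} (h : k + l = n) (a : V [⋀^Fin k]→L[ℝ] ℝ) (b : V [⋀^Fin l]→L[ℝ] ℝ) :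
    V [⋀^Fin n]→L[ℝ] ℝ :=
  h ▸ wedge a b

/-- The concatenation of two tuples, as a tuple of length `n = k + l`. -/
def app {X : Type*} {k l n : ℕ} (h : k + l = n) (u : Fin k → X) (v : Fin l → X) : Fin n → X :=
  fun i => Fin.append u v (Fin.cast h.symm i)

theorem comp_app {X Y : Type*} (f : X → Y) {k l n : ℕ} (h : k + l = n) (u : Fin k → X)
    (v : Fin l → X) (i : Fin n) : f (app h u v i) = app h (f ∘ u) (f ∘ v) i := by
  subst h
  refine Fin.addCases (fun i => ?_) (fun i => ?_) i <;> simp [app]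

theorem app_vecCons {X : Type*} {k l n : ℕ} (h : k + l = n) (h' : (k + 1) + l = n + 1) (x : X)
    (u : Fin k → X) (v : Fin l → X) :
    app h' (Matrix.vecCons x u) v = Matrix.vecCons x (app h u v) := by
  subst h
  funext i
  simp only [app, Matrix.vecCons, Fin.append_cons]
  rfl

theorem app_assoc {X : Type*} {k l m p q n : ℕ} (h : k + l = p) (h' : p + m = n) (h1 : l + m = q)
    (h2 : k + q = n) (u : Fin k → X) (v : Fin l → X) (w : Fin m → X) :
    app h' (app h u v) w = app h2 u (app h1 v w) := by
  subst h h1 h2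
  funext i
  have := congrFun (Fin.append_assoc u v w) (Fin.cast (Nat.add_assoc k l m).symm i)
  simp only [Function.comp_apply, Fin.cast_cast, Fin.cast_eq_self] at this
  exact this

theorem app_zero_left {X : Type*} {l : ℕ} (h : 0 + l = l) (u : Fin 0 → X) (v : Fin l → X) :
    app h u v = v := by
  funext i
  simp only [app]
  have : Fin.cast h.symm i = Fin.natAdd 0 i := by ext; simp
  rw [this, Fin.append_right]

theorem app_zero_right {X : Type*} {l : ℕ} (h : l + 0 = l) (u : Fin l → X) (v : Fin 0 → X) :
    app h u v = u := by
  funext i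
  simp only [app]
  have : Fin.cast h.symm i = Fin.castAdd 0 i := by ext; simp
  rw [this, Fin.append_left]

/-- Moving one vector past `k` others. -/
theorem map_vecCons_app {k l n : ℕ} (f : V [⋀^Fin (n + 1)]→L[ℝ] ℝ) (h : k + l = n)
    (h' : k + (l + 1) = n + 1) (x : V) (u : Fin k → V) (v : Fin l → V) :
    f (Matrix.vecCons x (app h u v)) = (-1) ^ k * f (app h' u (Matrix.vecCons x v)) := by
  subst h
  have key := f.toAlternatingMap.map_insertNth ⟨k, by omega⟩ x (app rfl u v)
  have ht : app h' u (Matrix.vecCons x v) =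
      (⟨k, by omega⟩ : Fin (k + l + 1)).insertNth x (app rfl u v) := by
    refine (Fin.eq_insertNth_iff).2 ⟨?_, ?_⟩
    · have : Fin.cast h'.symm ⟨k, by omega⟩ = Fin.natAdd k (0 : Fin (l + 1)) := by ext; simp
      simp only [app, this, Fin.append_right, Matrix.cons_val_zero]
    · funext i
      simp only [Fin.removeNth, app]
      refine Fin.addCases (fun j => ?_) (fun j => ?_) i
      · rw [Fin.succAbove_of_castSucc_lt _ _ (by simp [Fin.lt_def])]
        have : Fin.cast h'.symm (Fin.castSucc (Fin.castAdd l j)) = Fin.castAdd (l + 1) j := by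
          ext; simp
        rw [this]
        simp
      · rw [Fin.succAbove_of_le_castSucc _ _ (by simp [Fin.le_def])]
        have : Fin.cast h'.symm (Fin.succ (Fin.natAdd k j)) = Fin.natAdd k j.succ := by
          ext; simp; omega
        rw [this]
        simp
  rw [ht]
  erw [key]
  simp only [zsmul_eq_mul]
  push_cast
  rw [← mul_assoc, ← mul_pow]
  norm_num

theorem interior_apply {k : ℕ} (x : V) (a : V [⋀^Fin (k + 1)]→L[ℝ] ℝ) (v : Fin k → V) :
    interior x a v = a (Matrix.vecCons x v) := rfl

theorem interior_add {k : ℕ} (x y : V) (a : V [⋀^Fin (k + 1)]→L[ℝ] ℝ) :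
    interior (x + y) a = interior x a + interior y a := by
  ext v
  simp only [interior_apply, ContinuousAlternatingMap.vecCons_add, ContinuousAlternatingMap.add_apply]

theorem interior_smul {k : ℕ} (c : ℝ) (x : V) (a : V [⋀^Fin (k + 1)]→L[ℝ] ℝ) :
    interior (c • x) a = c • interior x a := by
  ext v
  simp only [interior_apply, ContinuousAlternatingMap.vecCons_smul,
    ContinuousAlternatingMap.smul_apply]

/-- Exchanging two blocks of vectors. -/
theorem map_app_comm {k l n : ℕ} (f : V [⋀^Fin n]→L[ℝ] ℝ) (h : k + l = n) (h' : l + k = n)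
    (u : Fin k → V) (v : Fin l → V) :
    f (app h u v) = (-1) ^ (k * l) * f (app h' v u) := by
  induction k generalizing n with
  | zero =>
    obtain rfl : l = n := by omega
    rw [app_zero_left, app_zero_right]
    simp
  | succ k ih =>
    obtain ⟨m, rfl⟩ : ∃ m, n = m + 1 := ⟨k + l, by omega⟩
    have hu : u = Matrix.vecCons (u 0) (Fin.tail u) := (Fin.cons_self_tail u).symm
    have h1 : k + l = m := by omega
    have h2 : l + k = m := by omega
    rw [hu, app_vecCons h1 h, ← interior_apply, ih (interior (u 0) f) h1 h2, interior_apply,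
      map_vecCons_app f h2 h', ← mul_assoc, ← pow_add]
    congr 2
    ring

theorem wedgeTo_apply {k l n : ℕ} (h : k + l = n) (a : V [⋀^Fin k]→L[ℝ] ℝ)
    (b : V [⋀^Fin l]→L[ℝ] ℝ) (v : Fin n → V) :
    wedgeTo h a b v = wedge a b (fun i => v (Fin.cast h i)) := by
  subst h; rfl

theorem wedgeTo_comp {k l n : ℕ} (h : k + l = n) (a : V [⋀^Fin k]→L[ℝ] ℝ)
    (b : V [⋀^Fin l]→L[ℝ] ℝ) (f : V' →L[ℝ] V) :
    (wedgeTo h a b).compContinuousLinearMap f =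
      wedgeTo h (a.compContinuousLinearMap f) (b.compContinuousLinearMap f) := by
  subst h
  ext v
  have hk : (k.factorial * l.factorial : ℝ) ≠ 0 := by positivity
  refine mul_left_cancel₀ hk ?_
  erw [wedge_apply, wedge_apply]
  rfl

theorem wedge_add_left {k l : ℕ} (a a' : V [⋀^Fin k]→L[ℝ] ℝ)
    (b : V [⋀^Fin l]→L[ℝ] ℝ) : wedge (a + a') b = wedge a b + wedge a' b := by
  ext v
  have hk : (k.factorial * l.factorial : ℝ) ≠ 0 := by positivity
  refine mul_left_cancel₀ hk ?_
  simp only [ContinuousAlternatingMap.add_apply, mul_add, wedge_apply, add_mul,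
    Finset.sum_add_distrib]

theorem wedge_add_right {k l : ℕ} (a : V [⋀^Fin k]→L[ℝ] ℝ)
    (b b' : V [⋀^Fin l]→L[ℝ] ℝ) : wedge a (b + b') = wedge a b + wedge a b' := by
  ext v
  have hk : (k.factorial * l.factorial : ℝ) ≠ 0 := by positivity
  refine mul_left_cancel₀ hk ?_
  simp only [ContinuousAlternatingMap.add_apply, mul_add, wedge_apply,
    Finset.sum_add_distrib]

theorem wedge_smul_left {k l : ℕ} (c : ℝ) (a : V [⋀^Fin k]→L[ℝ] ℝ)
    (b : V [⋀^Fin l]→L[ℝ] ℝ) : wedge (c • a) b = c • wedge a b := by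
  ext v
  have hk : (k.factorial * l.factorial : ℝ) ≠ 0 := by positivity
  refine mul_left_cancel₀ hk ?_
  rw [ContinuousAlternatingMap.smul_apply, smul_eq_mul, mul_left_comm, wedge_apply, wedge_apply,
    Finset.mul_sum]
  refine Finset.sum_congr rfl fun σ _ => ?_
  rw [ContinuousAlternatingMap.smul_apply, smul_eq_mul]
  ring

theorem wedge_smul_right {k l : ℕ} (c : ℝ) (a : V [⋀^Fin k]→L[ℝ] ℝ)
    (b : V [⋀^Fin l]→L[ℝ] ℝ) : wedge a (c • b) = c • wedge a b := by
  ext v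
  have hk : (k.factorial * l.factorial : ℝ) ≠ 0 := by positivity
  refine mul_left_cancel₀ hk ?_
  rw [ContinuousAlternatingMap.smul_apply, smul_eq_mul, mul_left_comm, wedge_apply, wedge_apply,
    Finset.mul_sum]
  refine Finset.sum_congr rfl fun σ _ => ?_
  rw [ContinuousAlternatingMap.smul_apply, smul_eq_mul]
  ring

theorem wedgeTo_smul_left {k l n : ℕ} (h : k + l = n) (c : ℝ) (a : V [⋀^Fin k]→L[ℝ] ℝ)
    (b : V [⋀^Fin l]→L[ℝ] ℝ) : wedgeTo h (c • a) b = c • wedgeTo h a b := by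
  subst h; exact wedge_smul_left c a b

theorem wedgeTo_smul_right {k l n : ℕ} (h : k + l = n) (c : ℝ) (a : V [⋀^Fin k]→L[ℝ] ℝ)
    (b : V [⋀^Fin l]→L[ℝ] ℝ) : wedgeTo h a (c • b) = c • wedgeTo h a b := by
  subst h; exact wedge_smul_right c a b

/-- Graded commutativity. -/
theorem wedgeTo_comm {k l n : ℕ} (h : k + l = n) (h' : l + k = n) (a : V [⋀^Fin k]→L[ℝ] ℝ)
    (b : V [⋀^Fin l]→L[ℝ] ℝ) : wedgeTo h a b = (-1 : ℝ) ^ (k * l) • wedgeTo h' b a := by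
  subst h
  ext v
  have hv : v = app rfl (fun i => v (Fin.castAdd l i)) (fun j => v (Fin.natAdd k j)) := by
    funext i
    refine Fin.addCases (fun i => ?_) (fun i => ?_) i <;> simp [app]
  have hk : (k.factorial * l.factorial : ℝ) ≠ 0 := by positivity
  rw [ContinuousAlternatingMap.smul_apply, smul_eq_mul, hv, map_app_comm (wedgeTo h' b a) rfl h',
    ← mul_assoc, ← mul_pow, neg_one_mul, neg_neg, one_pow, one_mul, wedgeTo_apply, wedgeTo_apply]
  refine mul_left_cancel₀ hk ?_
  rw [wedge_apply_sum, mul_comm (k.factorial : ℝ), wedge_apply_sum]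
  refine Fintype.sum_equiv (Equiv.sumComm _ _).permCongr _ _ fun σ => ?_
  rw [Equiv.Perm.sign_permCongr, mul_comm (a _)]
  have key : ∀ s : Fin k ⊕ Fin l, app rfl (fun i => v (Fin.castAdd l i))
      (fun j => v (Fin.natAdd k j)) (Fin.cast rfl (finSumFinEquiv s)) =
      app h' (fun j => v (Fin.natAdd k j)) (fun i => v (Fin.castAdd l i))
        (Fin.cast h' (finSumFinEquiv (Equiv.sumComm _ _ s))) := by
    rintro (i | i) <;> simp [app]
  simp only [key, Equiv.permCongr_apply]
  simp

theorem sum_perm_absorb_left {V : Type*} {p m : ℕ} (F : (Fin p → V) → ℝ) (G : (Fin m → V) → ℝ)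
    (v : Fin (p + m) → V) :
    ∑ σ : Equiv.Perm (Fin (p + m)), ((Equiv.Perm.sign σ : ℤ) : ℝ) *
      ((∑ τ : Equiv.Perm (Fin p), ((Equiv.Perm.sign τ : ℤ) : ℝ) *
        F (fun i => v (σ (Fin.castAdd m (τ i))))) * G (fun j => v (σ (Fin.natAdd p j)))) =
    p.factorial * ∑ σ : Equiv.Perm (Fin (p + m)), ((Equiv.Perm.sign σ : ℤ) : ℝ) *
      (F (fun i => v (σ (Fin.castAdd m i))) * G (fun j => v (σ (Fin.natAdd p j)))) := by
  simp only [Finset.sum_mul, Finset.mul_sum]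
  rw [Finset.sum_comm]
  have hp : ∀ τ : Equiv.Perm (Fin p), ∑ σ : Equiv.Perm (Fin (p + m)),
      ((Equiv.Perm.sign σ : ℤ) : ℝ) * (((Equiv.Perm.sign τ : ℤ) : ℝ) *
        F (fun i => v (σ (Fin.castAdd m (τ i)))) * G (fun j => v (σ (Fin.natAdd p j)))) =
      ∑ σ : Equiv.Perm (Fin (p + m)), ((Equiv.Perm.sign σ : ℤ) : ℝ) *
      (F (fun i => v (σ (Fin.castAdd m i))) * G (fun j => v (σ (Fin.natAdd p j)))) := by
    intro τ
    set τ' : Equiv.Perm (Fin (p + m)) := finSumFinEquiv.permCongr (Equiv.sumCongr τ 1) with hτ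
    have h1 : ∀ i, τ' (Fin.castAdd m i) = Fin.castAdd m (τ i) := by
      intro i; simp [hτ, Equiv.permCongr_apply]
    have h2 : ∀ i, τ' (Fin.natAdd p i) = Fin.natAdd p i := by
      intro i; simp [hτ, Equiv.permCongr_apply]
    have h3 : Equiv.Perm.sign τ' = Equiv.Perm.sign τ := by
      rw [hτ, Equiv.Perm.sign_permCongr]
      exact (Equiv.Perm.sign_sumCongr τ 1).trans (by simp)
    refine Fintype.sum_equiv (Equiv.mulRight τ') _ _ fun σ => ?_
    simp only [Equiv.coe_mulRight, Equiv.Perm.mul_apply, h1, h2, Equiv.Perm.sign_mul, h3]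
    push_cast
    ring
  rw [Finset.sum_congr rfl fun τ _ => hp τ, Finset.sum_const, Finset.card_univ,
    Fintype.card_perm, Fintype.card_fin, nsmul_eq_mul, Finset.mul_sum]

theorem sum_perm_absorb_right {V : Type*} {p m : ℕ} (F : (Fin p → V) → ℝ) (G : (Fin m → V) → ℝ)
    (v : Fin (p + m) → V) :
    ∑ σ : Equiv.Perm (Fin (p + m)), ((Equiv.Perm.sign σ : ℤ) : ℝ) *
      (F (fun i => v (σ (Fin.castAdd m i))) * ∑ τ : Equiv.Perm (Fin m),
        ((Equiv.Perm.sign τ : ℤ) : ℝ) * G (fun j => v (σ (Fin.natAdd p (τ j))))) =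
    m.factorial * ∑ σ : Equiv.Perm (Fin (p + m)), ((Equiv.Perm.sign σ : ℤ) : ℝ) *
      (F (fun i => v (σ (Fin.castAdd m i))) * G (fun j => v (σ (Fin.natAdd p j)))) := by
  simp only [Finset.mul_sum]
  rw [Finset.sum_comm]
  have hp : ∀ τ : Equiv.Perm (Fin m), ∑ σ : Equiv.Perm (Fin (p + m)),
      ((Equiv.Perm.sign σ : ℤ) : ℝ) * (F (fun i => v (σ (Fin.castAdd m i))) *
        (((Equiv.Perm.sign τ : ℤ) : ℝ) * G (fun j => v (σ (Fin.natAdd p (τ j)))))) =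
      ∑ σ : Equiv.Perm (Fin (p + m)), ((Equiv.Perm.sign σ : ℤ) : ℝ) *
      (F (fun i => v (σ (Fin.castAdd m i))) * G (fun j => v (σ (Fin.natAdd p j)))) := by
    intro τ
    set τ' : Equiv.Perm (Fin (p + m)) := finSumFinEquiv.permCongr (Equiv.sumCongr 1 τ) with hτ
    have h1 : ∀ i, τ' (Fin.castAdd m i) = Fin.castAdd m i := by
      intro i; simp [hτ, Equiv.permCongr_apply]
    have h2 : ∀ i, τ' (Fin.natAdd p i) = Fin.natAdd p (τ i) := by
      intro i; simp [hτ, Equiv.permCongr_apply]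
    have h3 : Equiv.Perm.sign τ' = Equiv.Perm.sign τ := by
      rw [hτ, Equiv.Perm.sign_permCongr]
      exact (Equiv.Perm.sign_sumCongr 1 τ).trans (by simp)
    refine Fintype.sum_equiv (Equiv.mulRight τ') _ _ fun σ => ?_
    simp only [Equiv.coe_mulRight, Equiv.Perm.mul_apply, h1, h2, Equiv.Perm.sign_mul, h3]
    push_cast
    ring
  rw [Finset.sum_congr rfl fun τ _ => hp τ, Finset.sum_const, Finset.card_univ,
    Fintype.card_perm, Fintype.card_fin, nsmul_eq_mul, Finset.mul_sum]

/-- Associativity. -/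
theorem wedgeTo_assoc {k l m p q n : ℕ} (h1 : k + l = p) (h2 : p + m = n) (h3 : l + m = q)
    (h4 : k + q = n) (a : V [⋀^Fin k]→L[ℝ] ℝ) (b : V [⋀^Fin l]→L[ℝ] ℝ) (c : V [⋀^Fin m]→L[ℝ] ℝ) :
    wedgeTo h2 (wedgeTo h1 a b) c = wedgeTo h4 a (wedgeTo h3 b c) := by
  subst h1 h2 h3
  ext v
  rw [wedgeTo_apply h4]
  change wedge (wedge a b) c v = wedge a (wedge b c) _
  have e1 := wedge_apply (wedge a b) c v
  have e2 := wedge_apply a (wedge b c) (fun i => v (Fin.cast h4 i))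
  have f1 : ((k.factorial * l.factorial : ℕ) : ℝ) *
      (((k + l).factorial * m.factorial : ℝ) * wedge (wedge a b) c v) =
      (k + l).factorial * ∑ σ : Equiv.Perm (Fin (k + l + m)), ((Equiv.Perm.sign σ : ℤ) : ℝ) *
        ((a (fun i => v (σ (Fin.castAdd m (Fin.castAdd l i)))) *
          b (fun i => v (σ (Fin.castAdd m (Fin.natAdd k i))))) *
          c (fun i => v (σ (Fin.natAdd (k + l) i)))) := by
    rw [e1, ← sum_perm_absorb_left (fun u => a (fun i => u (Fin.castAdd l i)) *
      b (fun i => u (Fin.natAdd k i))) c v, Finset.mul_sum]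
    refine Finset.sum_congr rfl fun σ _ => ?_
    rw [← wedge_apply a b (fun i => v (σ (Fin.castAdd m i)))]
    push_cast
    ring
  have f2 : ((l.factorial * m.factorial : ℕ) : ℝ) *
      ((k.factorial * (l + m).factorial : ℝ) * wedge a (wedge b c) fun i => v (Fin.cast h4 i)) =
      (l + m).factorial * ∑ σ : Equiv.Perm (Fin (k + (l + m))), ((Equiv.Perm.sign σ : ℤ) : ℝ) *
        (a (fun i => v (Fin.cast h4 (σ (Fin.castAdd (l + m) i)))) *
          (b (fun i => v (Fin.cast h4 (σ (Fin.natAdd k (Fin.castAdd m i))))) *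
          c (fun i => v (Fin.cast h4 (σ (Fin.natAdd k (Fin.natAdd l i))))))) := by
    rw [e2, ← sum_perm_absorb_right a (fun u => b (fun i => u (Fin.castAdd m i)) *
      c (fun i => u (Fin.natAdd l i))) (fun i => v (Fin.cast h4 i)), Finset.mul_sum]
    refine Finset.sum_congr rfl fun σ _ => ?_
    rw [← wedge_apply b c (fun i => v (Fin.cast h4 (σ (Fin.natAdd k i))))]
    push_cast
    ring
  have f3 : ∑ σ : Equiv.Perm (Fin (k + l + m)), ((Equiv.Perm.sign σ : ℤ) : ℝ) *
        ((a (fun i => v (σ (Fin.castAdd m (Fin.castAdd l i)))) *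
          b (fun i => v (σ (Fin.castAdd m (Fin.natAdd k i))))) *
          c (fun i => v (σ (Fin.natAdd (k + l) i)))) =
      ∑ σ : Equiv.Perm (Fin (k + (l + m))), ((Equiv.Perm.sign σ : ℤ) : ℝ) *
        (a (fun i => v (Fin.cast h4 (σ (Fin.castAdd (l + m) i)))) *
          (b (fun i => v (Fin.cast h4 (σ (Fin.natAdd k (Fin.castAdd m i))))) *
          c (fun i => v (Fin.cast h4 (σ (Fin.natAdd k (Fin.natAdd l i))))))) := by
    refine Fintype.sum_equiv (finCongr h4.symm).permCongr _ _ fun σ => ?_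
    rw [Equiv.Perm.sign_permCongr, mul_assoc (a _)]
    have g1 : ∀ i : Fin k, Fin.cast h4 (Fin.castAdd (l + m) i) =
      Fin.castAdd m (Fin.castAdd l i) := fun i => by ext; simp
    have g2 : ∀ i : Fin l, Fin.cast h4 (Fin.natAdd k (Fin.castAdd m i)) =
      Fin.castAdd m (Fin.natAdd k i) := fun i => by ext; simp
    have g3 : ∀ i : Fin m, Fin.cast h4 (Fin.natAdd k (Fin.natAdd l i)) =
      Fin.natAdd (k + l) i := fun i => by ext; simp; omega
    simp only [Equiv.permCongr_apply, finCongr_apply, finCongr_symm, Fin.cast_cast, g1, g2, g3,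
      Fin.cast_eq_self]
  rw [f3] at f1
  have hk : ((k.factorial * l.factorial * m.factorial * (k + l).factorial *
    (l + m).factorial : ℕ) : ℝ) ≠ 0 := by positivity
  refine mul_left_cancel₀ hk ?_
  push_cast at f1 f2 ⊢
  linear_combination ((l + m).factorial : ℝ) * f1 - ((k + l).factorial : ℝ) * f2

end WedgeTo

section Box

variable {V : Type*} [AddCommGroup V] [Module ℝ V] [TopologicalSpace V]
variable {W : Type*} [AddCommGroup W] [Module ℝ W] [TopologicalSpace W]
variable {V' : Type*} [AddCommGroup V'] [Module ℝ V'] [TopologicalSpace V']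
variable {W' : Type*} [AddCommGroup W'] [Module ℝ W'] [TopologicalSpace W']

/-- The form `pr₁^* a ∧ pr₂^* b` on a product. -/
def box {k l n : ℕ} (h : k + l = n) (a : V [⋀^Fin k]→L[ℝ] ℝ) (b : W [⋀^Fin l]→L[ℝ] ℝ) :
    (V × W) [⋀^Fin n]→L[ℝ] ℝ :=
  wedgeTo h (a.compContinuousLinearMap (ContinuousLinearMap.fst ℝ V W))
    (b.compContinuousLinearMap (ContinuousLinearMap.snd ℝ V W))

/-- The tuple consisting of `k` vectors of the first factor and `l` vectors of the second. -/
def mix {k l n : ℕ} (h : k + l = n) (v : Fin k → V) (w : Fin l → W) : Fin n → V × W :=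
  app h (fun i => (v i, (0 : W))) (fun j => ((0 : V), w j))

theorem mix_vecCons {k l n : ℕ} (h : k + l = n) (h' : (k + 1) + l = n + 1) (x : V)
    (v : Fin k → V) (w : Fin l → W) :
    mix h' (Matrix.vecCons x v) w = Matrix.vecCons (x, 0) (mix h v w) := by
  rw [mix, mix, ← app_vecCons h h']
  congr 1
  funext i
  refine Fin.cases ?_ (fun i => ?_) i <;> simp

theorem map_vecCons_mix {k l n : ℕ} (f : (V × W) [⋀^Fin (n + 1)]→L[ℝ] ℝ) (h : k + l = n)
    (h' : k + (l + 1) = n + 1) (y : W) (v : Fin k → V) (w : Fin l → W) :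
    f (Matrix.vecCons (0, y) (mix h v w)) = (-1) ^ k * f (mix h' v (Matrix.vecCons y w)) := by
  rw [mix, mix, map_vecCons_app f h h']
  congr 3
  funext i
  refine Fin.cases ?_ (fun i => ?_) i <;> simp

/-- Forms on a product are determined by their values on mixed tuples. -/
theorem ext_mix_zero {n : ℕ} (f : (V × W) [⋀^Fin n]→L[ℝ] ℝ)
    (hf : ∀ (k l : ℕ) (h : k + l = n) (v : Fin k → V) (w : Fin l → W), f (mix h v w) = 0) :
    f = 0 := by
  induction n with
  | zero =>
    ext u
    rw [Subsingleton.elim u (mix (rfl : 0 + 0 = 0) 0 0), hf]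
    rfl
  | succ n ih =>
    have h1 : ∀ x : V, interior ((x, 0) : V × W) f = 0 := fun x => by
      refine ih _ fun k l h v w => ?_
      rw [interior_apply, ← mix_vecCons h (by omega), hf]
    have h2 : ∀ y : W, interior ((0, y) : V × W) f = 0 := fun y => by
      refine ih _ fun k l h v w => ?_
      rw [interior_apply, map_vecCons_mix f h (by omega), hf, mul_zero]
    ext u
    have hu : u = Matrix.vecCons (u 0) (Fin.tail u) := (Fin.cons_self_tail u).symm
    have h0 : u 0 = ((u 0).1, (0 : W)) + ((0 : V), (u 0).2) := by simp
    rw [hu, ← interior_apply, h0, interior_add, h1, h2]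
    simp

theorem ext_mix {n : ℕ} {f g : (V × W) [⋀^Fin n]→L[ℝ] ℝ}
    (hf : ∀ (k l : ℕ) (h : k + l = n) (v : Fin k → V) (w : Fin l → W),
      f (mix h v w) = g (mix h v w)) : f = g := by
  rw [← sub_eq_zero]
  refine ext_mix_zero _ fun k l h v w => ?_
  rw [ContinuousAlternatingMap.sub_apply, hf, sub_self]

theorem mix_finSumFinEquiv_inl {k l : ℕ} (v : Fin k → V) (w : Fin l → W) (i : Fin k) :
    mix rfl v w (finSumFinEquiv (Sum.inl i)) = (v i, 0) := by simp [mix, app]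

theorem mix_finSumFinEquiv_inr {k l : ℕ} (v : Fin k → V) (w : Fin l → W) (i : Fin l) :
    mix rfl v w (finSumFinEquiv (Sum.inr i)) = (0, w i) := by simp [mix, app]

theorem box_mix {k l n : ℕ} (h : k + l = n) (a : V [⋀^Fin k]→L[ℝ] ℝ) (b : W [⋀^Fin l]→L[ℝ] ℝ)
    (v : Fin k → V) (w : Fin l → W) : box h a b (mix h v w) = a v * b w := by
  subst h
  have hk : (k.factorial * l.factorial : ℝ) ≠ 0 := by positivity
  refine mul_left_cancel₀ hk ?_
  change _ * wedge _ _ _ = _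
  rw [wedge_apply_sum]
  rw [← Finset.sum_subset (Finset.subset_univ
    (Finset.univ.image (Equiv.Perm.sumCongrHom (Fin k) (Fin l))))]
  · rw [Finset.sum_image (fun x _ y _ hxy => Equiv.Perm.sumCongrHom_injective hxy)]
    have hterm : ∀ σ : Equiv.Perm (Fin k) × Equiv.Perm (Fin l),
        ((Equiv.Perm.sign (Equiv.Perm.sumCongrHom (Fin k) (Fin l) σ) : ℤ) : ℝ) *
        ((a.compContinuousLinearMap (ContinuousLinearMap.fst ℝ V W)) (fun i => mix rfl v w
          (finSumFinEquiv (Equiv.Perm.sumCongrHom (Fin k) (Fin l) σ (Sum.inl i)))) *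
        (b.compContinuousLinearMap (ContinuousLinearMap.snd ℝ V W)) (fun j => mix rfl v w
          (finSumFinEquiv (Equiv.Perm.sumCongrHom (Fin k) (Fin l) σ (Sum.inr j))))) =
        a v * b w := by
      rintro ⟨σ, τ⟩
      simp only [Equiv.Perm.sumCongrHom_apply, Equiv.Perm.sumCongr_apply, Sum.map_inl, Sum.map_inr,
        mix_finSumFinEquiv_inl, mix_finSumFinEquiv_inr,
        ContinuousAlternatingMap.compContinuousLinearMap_apply, Function.comp_def,
        ContinuousLinearMap.coe_fst', ContinuousLinearMap.coe_snd', Equiv.Perm.sign_sumCongr]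
      have h1 := a.toAlternatingMap.map_perm v σ
      have h2 := b.toAlternatingMap.map_perm w τ
      have h1' : a (fun i => v (σ i)) = ((Equiv.Perm.sign σ : ℤ) : ℝ) * a v := by
        rw [Units.smul_def, zsmul_eq_mul] at h1; exact h1
      have h2' : b (fun i => w (τ i)) = ((Equiv.Perm.sign τ : ℤ) : ℝ) * b w := by
        rw [Units.smul_def, zsmul_eq_mul] at h2; exact h2
      rw [h1', h2']
      have s1 : ((Equiv.Perm.sign σ : ℤ) : ℝ) * ((Equiv.Perm.sign σ : ℤ) : ℝ) = 1 := by
        exact_mod_cast Int.units_coe_mul_self _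
      have s2 : ((Equiv.Perm.sign τ : ℤ) : ℝ) * ((Equiv.Perm.sign τ : ℤ) : ℝ) = 1 := by
        exact_mod_cast Int.units_coe_mul_self _
      push_cast
      linear_combination (a v * b w * (((Equiv.Perm.sign τ : ℤ) : ℝ) *
        ((Equiv.Perm.sign τ : ℤ) : ℝ))) * s1 + a v * b w * s2
    rw [Finset.sum_congr rfl fun σ _ => hterm σ, Finset.sum_const, Finset.card_univ,
      Fintype.card_prod, Fintype.card_perm, Fintype.card_perm, Fintype.card_fin, Fintype.card_fin,
      nsmul_eq_mul]
    push_cast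
    ring
  · intro σ _ hσ
    have : ∃ i j, σ (Sum.inl i) = Sum.inr j := by
      by_contra! hne
      refine hσ (Finset.mem_image.2 ?_)
      obtain ⟨τ, hτ⟩ := Equiv.Perm.mem_sumCongrHom_range_of_perm_mapsTo_inl (σ := σ) (by
        rintro _ ⟨i, rfl⟩
        rcases hs : σ (Sum.inl i) with j | j
        · exact ⟨j, rfl⟩
        · exact absurd hs (hne i j))
      exact ⟨τ, Finset.mem_univ _, hτ⟩
    obtain ⟨i, j, hij⟩ := this
    rw [ContinuousAlternatingMap.compContinuousLinearMap_apply, a.map_coord_zero i]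
    · simp
    · simp only [Function.comp_apply, hij]
      rw [mix_finSumFinEquiv_inr]
      rfl

theorem box_mix_of_ne {k l k' l' n : ℕ} (h : k + l = n) (h' : k' + l' = n) (hk : k ≠ k')
    (a : V [⋀^Fin k]→L[ℝ] ℝ) (b : W [⋀^Fin l]→L[ℝ] ℝ)
    (v : Fin k' → V) (w : Fin l' → W) : box h a b (mix h' v w) = 0 := by
  subst h
  have hk0 : (k.factorial * l.factorial : ℝ) ≠ 0 := by positivity
  refine mul_left_cancel₀ hk0 ?_
  change _ * wedge _ _ _ = _
  rw [wedge_apply, mul_zero]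
  refine Finset.sum_eq_zero fun σ _ => ?_
  have hl : ∀ i : Fin (k + l), (i : ℕ) < k' → (mix h' v w i).2 = 0 := by
    intro i hi
    have : Fin.cast h'.symm i = Fin.castAdd l' ⟨i, hi⟩ := by ext; simp
    simp only [mix, app, this, Fin.append_left]
  have hr : ∀ i : Fin (k + l), k' ≤ (i : ℕ) → (mix h' v w i).1 = 0 := by
    intro i hi
    have : Fin.cast h'.symm i = Fin.natAdd k' ⟨i - k', by omega⟩ := by ext; simp; omega
    simp only [mix, app, this, Fin.append_right]
  rcases lt_or_gt_of_ne hk with hlt | hgt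
  · obtain ⟨j, hj⟩ : ∃ j : Fin l, (σ (Fin.natAdd k j) : ℕ) < k' := by
      by_contra! hne
      have := Fintype.card_le_of_injective
        (fun j : Fin l => (⟨σ (Fin.natAdd k j) - k', by have := hne j; omega⟩ : Fin l')) (by
          intro i j hij
          have h1 := hne i
          have h2 := hne j
          simp only [Fin.mk.injEq] at hij
          have h3 : σ (Fin.natAdd k i) = σ (Fin.natAdd k j) := by ext; omega
          simpa [Fin.ext_iff] using σ.injective h3)
      simp at this
      omega
    rw [ContinuousAlternatingMap.compContinuousLinearMap_apply b, b.map_coord_zero j (hl _ hj)]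
    simp
  · obtain ⟨j, hj⟩ : ∃ j : Fin k, k' ≤ (σ (Fin.castAdd l j) : ℕ) := by
      by_contra! hne
      have := Fintype.card_le_of_injective
        (fun j : Fin k => (⟨σ (Fin.castAdd l j), hne j⟩ : Fin k')) (by
          intro i j hij
          simp only [Fin.mk.injEq] at hij
          have h3 : σ (Fin.castAdd l i) = σ (Fin.castAdd l j) := by ext; omega
          simpa [Fin.ext_iff] using σ.injective h3)
      simp at this
      omega
    rw [ContinuousAlternatingMap.compContinuousLinearMap_apply a, a.map_coord_zero j (hr _ hj)]
    simp

theorem box_comp_prodMap {k l n : ℕ} (h : k + l = n) (a : V [⋀^Fin k]→L[ℝ] ℝ)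
    (b : W [⋀^Fin l]→L[ℝ] ℝ) (f : V' →L[ℝ] V) (g : W' →L[ℝ] W) :
    (box h a b).compContinuousLinearMap (f.prodMap g) =
      box h (a.compContinuousLinearMap f) (b.compContinuousLinearMap g) := by
  rw [box, wedgeTo_comp]
  rfl

theorem interior_inl_box {k l n : ℕ} (h : k + l = n) (h' : k + 1 + l = n + 1)
    (a : V [⋀^Fin (k + 1)]→L[ℝ] ℝ) (b : W [⋀^Fin l]→L[ℝ] ℝ) (x : V) :
    interior (x, 0) (box h' a b) = box h (interior x a) b := by
  refine ext_mix fun k' l' e v w => ?_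
  rw [interior_apply, ← mix_vecCons e (by omega)]
  by_cases hk : k = k'
  · subst hk
    obtain rfl : l = l' := by omega
    rw [box_mix, box_mix, interior_apply]
  · rw [box_mix_of_ne _ _ (by omega), box_mix_of_ne _ _ hk]

theorem interior_inr_box {k l n : ℕ} (h : k + l = n) (h' : k + (l + 1) = n + 1)
    (a : V [⋀^Fin k]→L[ℝ] ℝ) (b : W [⋀^Fin (l + 1)]→L[ℝ] ℝ) (y : W) :
    interior (0, y) (box h' a b) = (-1 : ℝ) ^ k • box h a (interior y b) := by
  refine ext_mix fun k' l' e v w => ?_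
  rw [interior_apply, map_vecCons_mix _ e (by omega), ContinuousAlternatingMap.smul_apply,
    smul_eq_mul]
  by_cases hk : k = k'
  · subst hk
    obtain rfl : l = l' := by omega
    rw [box_mix, box_mix, interior_apply]
  · rw [box_mix_of_ne _ _ hk, box_mix_of_ne _ _ hk, mul_zero, mul_zero]

theorem interior_inr_box_zero {n : ℕ} (h : n + 1 + 0 = n + 1) (a : V [⋀^Fin (n + 1)]→L[ℝ] ℝ)
    (b : W [⋀^Fin 0]→L[ℝ] ℝ) (y : W) : interior (0, y) (box h a b) = 0 := by
  refine ext_mix fun k' l' e v w => ?_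
  rw [interior_apply, map_vecCons_mix _ e (by omega), box_mix_of_ne _ _ (by omega), mul_zero]
  rfl

theorem wedgeTo_box_box {k l k' l' m m' p q n : ℕ} (h1 : k + l = m) (h2 : k' + l' = m')
    (h3 : m + m' = n) (h4 : k + k' = p) (h5 : l + l' = q) (h6 : p + q = n)
    (a : V [⋀^Fin k]→L[ℝ] ℝ) (b : W [⋀^Fin l]→L[ℝ] ℝ) (c : V [⋀^Fin k']→L[ℝ] ℝ)
    (d : W [⋀^Fin l']→L[ℝ] ℝ) :
    wedgeTo h3 (box h1 a b) (box h2 c d) =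
      (-1 : ℝ) ^ (l * k') • box h6 (wedgeTo h4 a c) (wedgeTo h5 b d) := by
  simp only [box]
  rw [wedgeTo_comp, wedgeTo_comp]
  set A := a.compContinuousLinearMap (ContinuousLinearMap.fst ℝ V W)
  set B := b.compContinuousLinearMap (ContinuousLinearMap.snd ℝ V W)
  set C := c.compContinuousLinearMap (ContinuousLinearMap.fst ℝ V W)
  set D := d.compContinuousLinearMap (ContinuousLinearMap.snd ℝ V W)
  rw [wedgeTo_assoc h1 h3 (rfl : l + m' = l + m') (by omega) A B,
    ← wedgeTo_assoc (rfl : l + k' = l + k') (by omega) h2 rfl B C D,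
    wedgeTo_comm rfl (by omega : k' + l = l + k') B C, wedgeTo_smul_left, wedgeTo_smul_right,
    wedgeTo_assoc _ _ h5 (by omega) C B D, ← wedgeTo_assoc h4 h6 _ _ A C]

end Box

section Contraction

variable {V : Type*} [AddCommGroup V] [Module ℝ V] [TopologicalSpace V]

/-- Families `e`, `e'` that are dual to each other with respect to `g`. -/
structure IsRecip {ι : Type*} [Fintype ι] (g : V →L[ℝ] V →L[ℝ] ℝ) (e e' : ι → V) : Prop where
  left : ∀ v, v = ∑ i, g v (e' i) • e i
  right : ∀ v, v = ∑ i, g (e i) v • e' i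

/-- The full contraction `∑ a(e_{i₁}, …, e_{i_k}) b(e'_{i₁}, …, e'_{i_k})`. -/
def contr {ι : Type*} [Fintype ι] {k : ℕ} (e e' : ι → V) (a b : V [⋀^Fin k]→L[ℝ] ℝ) : ℝ :=
  ∑ i : Fin k → ι, a (fun r => e (i r)) * b (fun r => e' (i r))

theorem IsRecip.sum_eq {ι κ : Type*} [Fintype ι] [Fintype κ] {g : V →L[ℝ] V →L[ℝ] ℝ}
    {e e' : ι → V} {f f' : κ → V} (he : IsRecip g e e') (hf : IsRecip g f f')
    (B : V →ₗ[ℝ] V →ₗ[ℝ] ℝ) : ∑ i, B (e i) (e' i) = ∑ j, B (f j) (f' j) := by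
  have h1 : ∀ j, B (f j) (f' j) = ∑ i, g (f j) (e' i) * B (e i) (f' j) := fun j => by
    conv_lhs => rw [he.left (f j)]
    simp
  have h2 : ∀ i, B (e i) (e' i) = ∑ j, g (f j) (e' i) * B (e i) (f' j) := fun i => by
    conv_lhs => rw [hf.right (e' i)]
    simp
  simp only [h1, h2]
  exact Finset.sum_comm

theorem contr_succ {ι : Type*} [Fintype ι] {k : ℕ} (e e' : ι → V)
    (a b : V [⋀^Fin (k + 1)]→L[ℝ] ℝ) :
    contr e e' a b = ∑ i, contr e e' (interior (e i) a) (interior (e' i) b) := by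
  simp only [contr]
  rw [← (Fin.consEquiv fun _ : Fin (k + 1) => ι).sum_comp, Fintype.sum_prod_type]
  refine Finset.sum_congr rfl fun i _ => Finset.sum_congr rfl fun I _ => ?_
  rw [interior_apply, interior_apply]
  congr 2 <;>
  · funext r
    refine Fin.cases ?_ (fun r => ?_) r <;> simp [Fin.consEquiv]

theorem contr_eq {ι κ : Type*} [Fintype ι] [Fintype κ] {k : ℕ} {g : V →L[ℝ] V →L[ℝ] ℝ}
    {e e' : ι → V} {f f' : κ → V} (he : IsRecip g e e') (hf : IsRecip g f f')
    (a b : V [⋀^Fin k]→L[ℝ] ℝ) : contr e e' a b = contr f f' a b := by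
  induction k with
  | zero =>
    simp only [contr, Finset.univ_unique, Finset.sum_singleton]
    congr 2 <;> exact Subsingleton.elim _ _
  | succ k ih =>
    rw [contr_succ, contr_succ]
    simp only [ih]
    let B : V →ₗ[ℝ] V →ₗ[ℝ] ℝ := LinearMap.mk₂ ℝ
      (fun x y => contr f f' (interior x a) (interior y b))
      (by intros; simp only [contr, interior_add, ContinuousAlternatingMap.add_apply, add_mul,
        Finset.sum_add_distrib])
      (by intros; simp only [contr, interior_smul, ContinuousAlternatingMap.smul_apply, smul_eq_mul,
        mul_assoc, Finset.mul_sum])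
      (by intros; simp only [contr, interior_add, ContinuousAlternatingMap.add_apply, mul_add,
        Finset.sum_add_distrib])
      (by intros; simp only [contr, interior_smul, ContinuousAlternatingMap.smul_apply, smul_eq_mul,
        mul_left_comm, Finset.mul_sum])
    exact he.sum_eq hf B

theorem contract_apply {k m n : ℕ} (h : k + m = n) (w : Fin k → V) (a : V [⋀^Fin n]→L[ℝ] ℝ)
    (v : Fin m → V) : contract h w a v = a (app h w v) := rfl

/-- The contraction of the last `m` arguments of a form with `v`. -/
def contractTail {k m n : ℕ} (h : k + m = n) (v : Fin m → V) (a : V [⋀^Fin n]→L[ℝ] ℝ) :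
    V [⋀^Fin k]→L[ℝ] ℝ :=
  (-1 : ℝ) ^ (k * m) • contract ((Nat.add_comm m k).trans h) v a

theorem contractTail_apply {k m n : ℕ} (h : k + m = n) (v : Fin m → V) (a : V [⋀^Fin n]→L[ℝ] ℝ)
    (u : Fin k → V) : contractTail h v a u = a (app h u v) := by
  rw [contractTail, ContinuousAlternatingMap.smul_apply, contract_apply, smul_eq_mul,
    map_app_comm a h]

/-- Exchanging the two middle blocks of four. -/
theorem map_app_middle {k l k' l' m m' p q n : ℕ} (f : V [⋀^Fin n]→L[ℝ] ℝ) (h1 : k + l = m)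
    (h2 : k' + l' = m') (h3 : m + m' = n) (h4 : k + k' = p) (h5 : l + l' = q) (h6 : p + q = n)
    (a : Fin k → V) (b : Fin l → V) (c : Fin k' → V) (d : Fin l' → V) :
    f (app h3 (app h1 a b) (app h2 c d)) =
      (-1) ^ (l * k') * f (app h6 (app h4 a c) (app h5 b d)) := by
  obtain ⟨r, hr⟩ : ∃ r, l + k' = r := ⟨_, rfl⟩
  obtain ⟨s, hs⟩ : ∃ s, r + l' = s := ⟨_, rfl⟩
  rw [app_assoc h1 h3 (by omega : l + m' = s) (by omega), ← contract_apply,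
    ← app_assoc hr hs, ← contractTail_apply hs, map_app_comm _ hr (by omega), contractTail_apply,
    app_assoc (by omega) hs h5 (by omega), contract_apply, ← app_assoc h4 h6]

theorem contr_wedge {ι : Type*} [Fintype ι] {k l : ℕ} (e e' : ι → V)
    (a : V [⋀^Fin k]→L[ℝ] ℝ) (b : V [⋀^Fin l]→L[ℝ] ℝ) (X : V [⋀^Fin (k + l)]→L[ℝ] ℝ) :
    (k.factorial * l.factorial : ℝ) * contr e e' (wedge a b) X = (k + l).factorial *
      ∑ i : Fin k → ι, ∑ j : Fin l → ι, a (fun r => e (i r)) * b (fun r => e (j r)) *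
        X (app rfl (fun r => e' (i r)) (fun r => e' (j r))) := by
  have h1 : ∀ σ : Equiv.Perm (Fin (k + l)), ∑ i : Fin (k + l) → ι,
      ((Equiv.Perm.sign σ : ℤ) : ℝ) * (a (fun r => e (i (σ (Fin.castAdd l r)))) *
        b (fun r => e (i (σ (Fin.natAdd k r))))) * X (fun r => e' (i r)) =
      ∑ i : Fin (k + l) → ι, a (fun r => e (i (Fin.castAdd l r))) *
        b (fun r => e (i (Fin.natAdd k r))) * X (fun r => e' (i r)) := by
    intro σ
    refine Fintype.sum_equiv (Equiv.arrowCongr σ.symm (Equiv.refl ι)) _ _ fun i => ?_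
    simp only [Equiv.arrowCongr_apply, Equiv.symm_symm, Function.comp_apply, Equiv.coe_refl, id]
    have h2 := X.toAlternatingMap.map_perm (fun r => e' (i r)) σ
    rw [Units.smul_def, zsmul_eq_mul] at h2
    have h2' : X (fun r => e' (i (σ r))) = ((Equiv.Perm.sign σ : ℤ) : ℝ) *
      X (fun r => e' (i r)) := h2
    rw [h2']
    ring
  have h3 : (k.factorial * l.factorial : ℝ) * contr e e' (wedge a b) X =
      ∑ σ : Equiv.Perm (Fin (k + l)), ∑ i : Fin (k + l) → ι,
      ((Equiv.Perm.sign σ : ℤ) : ℝ) * (a (fun r => e (i (σ (Fin.castAdd l r)))) *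
        b (fun r => e (i (σ (Fin.natAdd k r))))) * X (fun r => e' (i r)) := by
    rw [Finset.sum_comm, contr, Finset.mul_sum]
    refine Finset.sum_congr rfl fun i _ => ?_
    rw [← mul_assoc, wedge_apply, Finset.sum_mul]
  rw [h3, Finset.sum_congr rfl fun σ _ => h1 σ, Finset.sum_const, Finset.card_univ,
    Fintype.card_perm, Fintype.card_fin, nsmul_eq_mul, ← (Fin.appendEquiv k l).sum_comp,
    Fintype.sum_prod_type]
  congr 1
  refine Finset.sum_congr rfl fun i _ => Finset.sum_congr rfl fun j _ => ?_
  have h4 : (fun r => e' (Fin.appendEquiv k l (i, j) r)) =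
      app rfl (fun r => e' (i r)) (fun r => e' (j r)) :=
    funext fun r => comp_app e' rfl i j r
  rw [h4]
  simp [Fin.appendEquiv]

end Contraction

section Gram

variable {V : Type*} [AddCommGroup V] [Module ℝ V] [TopologicalSpace V]

/-- Symmetric nondegenerate bilinear forms. -/
structure IsNondeg (g : V →L[ℝ] V →L[ℝ] ℝ) : Prop where
  symm : ∀ v w, g v w = g w v
  nondeg : ∀ v, (∀ w, g w v = 0) → v = 0

theorem IsRecip.swap {ι : Type*} [Fintype ι] {g : V →L[ℝ] V →L[ℝ] ℝ} {e e' : ι → V}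
    (h : IsRecip g e e') (hg : ∀ v w, g v w = g w v) : IsRecip g e' e :=
  ⟨fun v => by simpa only [hg] using h.right v, fun v => by
    have := h.left v
    simpa only [hg v] using this⟩

variable [FiniteDimensional ℝ V]

/-- The family dual to the chosen basis of `V`. -/
def dualFamily (g : V →L[ℝ] V →L[ℝ] ℝ) (i : Fin (Module.finrank ℝ V)) : V :=
  ∑ j, (gram g)⁻¹ i j • Module.finBasis ℝ V j

theorem isUnit_det_gram {g : V →L[ℝ] V →L[ℝ] ℝ} (hg : IsNondeg g) : IsUnit (gram g).det := by
  rw [isUnit_iff_ne_zero]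
  intro h0
  obtain ⟨c, hc, h⟩ := Matrix.exists_mulVec_eq_zero_iff.2 h0
  have hz : ∑ j, c j • Module.finBasis ℝ V j = 0 := by
    refine hg.nondeg _ fun w => ?_
    have : ∀ i, g (Module.finBasis ℝ V i) (∑ j, c j • Module.finBasis ℝ V j) = 0 := fun i => by
      have := congrFun h i
      simp only [Matrix.mulVec, dotProduct, gram, Matrix.of_apply, Pi.zero_apply] at this
      simpa [mul_comm] using this
    generalize ∑ j, c j • Module.finBasis ℝ V j = z at this ⊢
    rw [← (Module.finBasis ℝ V).sum_repr w]
    simp only [map_sum, map_smul, sum_apply, smul_apply, this, smul_zero, Finset.sum_const_zero]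
  exact hc (funext fun i => Fintype.linearIndependent_iff.1
    (Module.finBasis ℝ V).linearIndependent c hz i)

theorem isRecip_finBasis {g : V →L[ℝ] V →L[ℝ] ℝ} (hg : IsNondeg g) :
    IsRecip g (Module.finBasis ℝ V) (dualFamily g) := by
  have key : ∀ i j, g (Module.finBasis ℝ V i) (dualFamily g j) = if j = i then 1 else 0 := by
    intro i j
    have := congrFun (congrFun (Matrix.nonsing_inv_mul _ (isUnit_det_gram hg)) j) i
    rw [Matrix.one_apply, Matrix.mul_apply] at this
    rw [dualFamily, map_sum, ← this]
    refine Finset.sum_congr rfl fun r _ => ?_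
    rw [map_smul, hg.symm, smul_eq_mul]
    rfl
  have hl : ∀ v, v = ∑ i, g v (dualFamily g i) • Module.finBasis ℝ V i := by
    intro v
    conv_lhs => rw [← (Module.finBasis ℝ V).sum_repr v]
    refine Finset.sum_congr rfl fun i _ => ?_
    congr 1
    conv_rhs => rw [← (Module.finBasis ℝ V).sum_repr v]
    simp only [map_sum, map_smul, sum_apply, smul_apply, smul_eq_mul, key, mul_ite, mul_one,
      mul_zero, Finset.sum_ite_eq, Finset.mem_univ, if_true]
  refine ⟨hl, fun v => ?_⟩
  rw [← sub_eq_zero]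
  refine hg.nondeg _ fun w => ?_
  have h1 : ∀ i, g (Module.finBasis ℝ V i)
      (v - ∑ i, g (Module.finBasis ℝ V i) v • dualFamily g i) = 0 := fun i => by
    simp [key]
  generalize v - ∑ i, g (Module.finBasis ℝ V i) v • dualFamily g i = z at h1 ⊢
  rw [hl w]
  simp only [map_sum, map_smul, sum_apply, smul_apply, h1, smul_zero, Finset.sum_const_zero]

theorem map_dualFamily {k : ℕ} (g : V →L[ℝ] V →L[ℝ] ℝ) (b : V [⋀^Fin k]→L[ℝ] ℝ)
    (i : Fin k → Fin (Module.finrank ℝ V)) : b (fun r => dualFamily g (i r)) =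
      ∑ j : Fin k → Fin (Module.finrank ℝ V), (∏ r, (gram g)⁻¹ (i r) (j r)) *
        b (fun r => Module.finBasis ℝ V (j r)) := by
  simp only [dualFamily]
  rw [ContinuousAlternatingMap.map_sum]
  refine Finset.sum_congr rfl fun j _ => ?_
  rw [ContinuousAlternatingMap.map_smul_univ, smul_eq_mul]

theorem formInner_eq {ι : Type*} [Fintype ι] {k : ℕ} {g : V →L[ℝ] V →L[ℝ] ℝ} (hg : IsNondeg g)
    {e e' : ι → V} (he : IsRecip g e e') (a b : V [⋀^Fin k]→L[ℝ] ℝ) :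
    formInner g a b = (k.factorial : ℝ)⁻¹ * contr e e' a b := by
  rw [contr_eq he (isRecip_finBasis hg), formInner, contr]
  congr 1
  refine Finset.sum_congr rfl fun i _ => ?_
  rw [map_dualFamily, Finset.mul_sum]
  refine Finset.sum_congr rfl fun j _ => ?_
  ring

theorem starAt_apply {ι : Type*} [Fintype ι] {k m n : ℕ} (h : k + m = n)
    {g : V →L[ℝ] V →L[ℝ] ℝ} (hg : IsNondeg g) {e e' : ι → V} (he : IsRecip g e e')
    (vol : V [⋀^Fin n]→L[ℝ] ℝ) (b : V [⋀^Fin k]→L[ℝ] ℝ) (v : Fin m → V) :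
    starAt h g vol b v = (k.factorial : ℝ)⁻¹ * contr e e' b (contractTail h v vol) := by
  rw [contr_eq he (isRecip_finBasis hg), starAt, contr, ContinuousAlternatingMap.smul_apply,
    ContinuousAlternatingMap.sum_apply, smul_eq_mul]
  congr 1
  refine Finset.sum_congr rfl fun i _ => ?_
  rw [map_dualFamily, Finset.mul_sum, ContinuousAlternatingMap.sum_apply]
  refine Finset.sum_congr rfl fun j _ => ?_
  rw [ContinuousAlternatingMap.smul_apply, contractTail_apply, contract_apply, smul_eq_mul]
  ring

theorem formInner_comm {k : ℕ} {g : V →L[ℝ] V →L[ℝ] ℝ} (hg : IsNondeg g)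
    (a b : V [⋀^Fin k]→L[ℝ] ℝ) : formInner g a b = formInner g b a := by
  rw [formInner_eq hg (isRecip_finBasis hg), formInner_eq hg ((isRecip_finBasis hg).swap hg.symm)]
  simp only [contr, mul_comm]

theorem formInner_add_left {k : ℕ} (g : V →L[ℝ] V →L[ℝ] ℝ) (a a' b : V [⋀^Fin k]→L[ℝ] ℝ) :
    formInner g (a + a') b = formInner g a b + formInner g a' b := by
  simp only [formInner, ContinuousAlternatingMap.add_apply, add_mul, Finset.sum_add_distrib,
    mul_add]

theorem formInner_add_right {k : ℕ} (g : V →L[ℝ] V →L[ℝ] ℝ) (a b b' : V [⋀^Fin k]→L[ℝ] ℝ) :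
    formInner g a (b + b') = formInner g a b + formInner g a b' := by
  simp only [formInner, ContinuousAlternatingMap.add_apply, add_mul, Finset.sum_add_distrib,
    mul_add]

theorem formInner_smul_left {k : ℕ} (g : V →L[ℝ] V →L[ℝ] ℝ) (c : ℝ)
    (a b : V [⋀^Fin k]→L[ℝ] ℝ) : formInner g (c • a) b = c * formInner g a b := by
  simp only [formInner, ContinuousAlternatingMap.smul_apply, smul_eq_mul, Finset.mul_sum]
  refine Finset.sum_congr rfl fun i _ => Finset.sum_congr rfl fun j _ => ?_
  ring

theorem formInner_smul_right {k : ℕ} (g : V →L[ℝ] V →L[ℝ] ℝ) (c : ℝ)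
    (a b : V [⋀^Fin k]→L[ℝ] ℝ) : formInner g a (c • b) = c * formInner g a b := by
  simp only [formInner, ContinuousAlternatingMap.smul_apply, smul_eq_mul, Finset.mul_sum]
  refine Finset.sum_congr rfl fun i _ => Finset.sum_congr rfl fun j _ => ?_
  ring

theorem formInner_zero_form (g : V →L[ℝ] V →L[ℝ] ℝ) (a b : V [⋀^Fin 0]→L[ℝ] ℝ) (v : Fin 0 → V) :
    formInner g a b = a v * b v := by
  simp only [formInner, Finset.univ_unique, Finset.sum_singleton, Nat.factorial_zero,
    Nat.cast_one, inv_one, one_mul, Finset.univ_eq_empty, Finset.prod_empty, mul_one]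
  congr 2 <;> exact Subsingleton.elim _ _

theorem eq_zero_of_finrank_lt {k : ℕ} (h : Module.finrank ℝ V < k) (a : V [⋀^Fin k]→L[ℝ] ℝ) :
    a = 0 := by
  ext v
  refine a.toAlternatingMap.map_linearDependent v fun hv => ?_
  have := hv.fintype_card_le_finrank
  simp at this
  omega

end Gram

section Transport

variable {V : Type*} [AddCommGroup V] [Module ℝ V] [TopologicalSpace V] [FiniteDimensional ℝ V]
variable {V' : Type*} [AddCommGroup V'] [Module ℝ V'] [TopologicalSpace V']
  [FiniteDimensional ℝ V']

theorem IsNondeg.comp {g : V →L[ℝ] V →L[ℝ] ℝ} (hg : IsNondeg g) (L : V' ≃L[ℝ] V)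
    {g' : V' →L[ℝ] V' →L[ℝ] ℝ} (h : ∀ x y, g' x y = g (L x) (L y)) : IsNondeg g' := by
  refine ⟨fun v w => by rw [h, h, hg.symm], fun v hv => ?_⟩
  have : L v = 0 := hg.nondeg _ fun w => by
    have := hv (L.symm w)
    rwa [h, L.apply_symm_apply] at this
  simpa using this

theorem starAt_comp {k m n : ℕ} (h : k + m = n) {g : V →L[ℝ] V →L[ℝ] ℝ} (hg : IsNondeg g)
    (vol : V [⋀^Fin n]→L[ℝ] ℝ) (b : V [⋀^Fin k]→L[ℝ] ℝ) (L : V' ≃L[ℝ] V)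
    {g' : V' →L[ℝ] V' →L[ℝ] ℝ} (hg' : ∀ x y, g' x y = g (L x) (L y)) :
    (starAt h g vol b).compContinuousLinearMap (L : V' →L[ℝ] V) =
      starAt h g' (vol.compContinuousLinearMap (L : V' →L[ℝ] V))
        (b.compContinuousLinearMap (L : V' →L[ℝ] V)) := by
  have he := isRecip_finBasis (hg.comp L hg')
  have hL : IsRecip g (fun i => L (Module.finBasis ℝ V' i)) (fun i => L (dualFamily g' i)) := by
    refine ⟨fun v => ?_, fun v => ?_⟩
    · conv_lhs => rw [← L.apply_symm_apply v, he.left (L.symm v)]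
      simp [hg']
    · conv_lhs => rw [← L.apply_symm_apply v, he.right (L.symm v)]
      simp [hg']
  ext v
  rw [ContinuousAlternatingMap.compContinuousLinearMap_apply, starAt_apply h hg hL,
    starAt_apply h (hg.comp L hg') he]
  congr 1
  refine Finset.sum_congr rfl fun i _ => ?_
  rw [contractTail_apply, contractTail_apply, ContinuousAlternatingMap.compContinuousLinearMap_apply,
    ContinuousAlternatingMap.compContinuousLinearMap_apply]
  congr 2
  funext r
  exact (comp_app L h _ v r).symm

end Transport

section Product

variable {V : Type*} [AddCommGroup V] [Module ℝ V] [TopologicalSpace V] [FiniteDimensional ℝ V]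
variable {W : Type*} [AddCommGroup W] [Module ℝ W] [TopologicalSpace W] [FiniteDimensional ℝ W]
variable {g : V →L[ℝ] V →L[ℝ] ℝ} {g' : W →L[ℝ] W →L[ℝ] ℝ} {G : (V × W) →L[ℝ] (V × W) →L[ℝ] ℝ}

theorem IsNondeg.prod (hg : IsNondeg g) (hg' : IsNondeg g')
    (hG : ∀ x y, G x y = g x.1 y.1 + g' x.2 y.2) : IsNondeg G := by
  refine ⟨fun v w => by rw [hG, hG, hg.symm, hg'.symm], fun v hv => Prod.ext ?_ ?_⟩
  · refine hg.nondeg _ fun w => ?_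
    simpa [hG] using hv (w, 0)
  · refine hg'.nondeg _ fun w => ?_
    simpa [hG] using hv (0, w)

theorem IsRecip.prod {ι κ : Type*} [Fintype ι] [Fintype κ] {e e' : ι → V} {f f' : κ → W}
    (he : IsRecip g e e') (hf : IsRecip g' f f') (hG : ∀ x y, G x y = g x.1 y.1 + g' x.2 y.2) :
    IsRecip G (Sum.elim (fun i => (e i, (0 : W))) (fun j => ((0 : V), f j)))
      (Sum.elim (fun i => (e' i, (0 : W))) (fun j => ((0 : V), f' j))) := by
  refine ⟨fun v => ?_, fun v => ?_⟩
  · refine Prod.ext ?_ ?_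
    · simpa [hG, Prod.fst_sum, Prod.snd_sum] using he.left v.1
    · simpa [hG, Prod.fst_sum, Prod.snd_sum] using hf.left v.2
  · refine Prod.ext ?_ ?_
    · simpa [hG, Prod.fst_sum, Prod.snd_sum] using he.right v.1
    · simpa [hG, Prod.fst_sum, Prod.snd_sum] using hf.right v.2

theorem sum_eq_sum_inl {ι κ : Type*} [Fintype ι] [Fintype κ] {k : ℕ}
    (F : (Fin k → ι ⊕ κ) → ℝ) (hF : ∀ i r j, i r = Sum.inr j → F i = 0) :
    ∑ i, F i = ∑ i : Fin k → ι, F (fun r => Sum.inl (i r)) := by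
  symm
  refine Fintype.sum_of_injective (fun i : Fin k → ι => fun r => (Sum.inl (i r) : ι ⊕ κ))
    (fun i j h => funext fun r => Sum.inl_injective (congrFun h r)) _ _ (fun i hi => ?_)
    (fun _ => rfl)
  by_contra hne
  refine hi ?_
  have : ∀ r, ∃ j, i r = Sum.inl j := fun r => by
    rcases h : i r with j | j
    · exact ⟨j, rfl⟩
    · exact absurd (hF i r j h) hne
  choose j hj using this
  exact ⟨j, funext fun r => (hj r).symm⟩

theorem sum_eq_sum_inr {ι κ : Type*} [Fintype ι] [Fintype κ] {k : ℕ}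
    (F : (Fin k → ι ⊕ κ) → ℝ) (hF : ∀ i r j, i r = Sum.inl j → F i = 0) :
    ∑ i, F i = ∑ i : Fin k → κ, F (fun r => Sum.inr (i r)) := by
  symm
  refine Fintype.sum_of_injective (fun i : Fin k → κ => fun r => (Sum.inr (i r) : ι ⊕ κ))
    (fun i j h => funext fun r => Sum.inr_injective (congrFun h r)) _ _ (fun i hi => ?_)
    (fun _ => rfl)
  by_contra hne
  refine hi ?_
  have : ∀ r, ∃ j, i r = Sum.inr j := fun r => by
    rcases h : i r with j | j
    · exact absurd (hF i r j h) hne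
    · exact ⟨j, rfl⟩
  choose j hj using this
  exact ⟨j, funext fun r => (hj r).symm⟩

theorem contr_box {ι κ : Type*} [Fintype ι] [Fintype κ] {k l n : ℕ} (h : k + l = n)
    (e e' : ι → V) (f f' : κ → W) (a : V [⋀^Fin k]→L[ℝ] ℝ) (b : W [⋀^Fin l]→L[ℝ] ℝ)
    (X : (V × W) [⋀^Fin n]→L[ℝ] ℝ) :
    (n.factorial : ℝ)⁻¹ * contr (Sum.elim (fun i => (e i, (0 : W))) (fun j => ((0 : V), f j)))
      (Sum.elim (fun i => (e' i, (0 : W))) (fun j => ((0 : V), f' j))) (box h a b) X =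
    (k.factorial : ℝ)⁻¹ * (l.factorial : ℝ)⁻¹ * ∑ i : Fin k → ι, ∑ j : Fin l → κ,
      a (fun r => e (i r)) * b (fun r => f (j r)) *
        X (mix h (fun r => e' (i r)) (fun r => f' (j r))) := by
  subst h
  have hc := contr_wedge (Sum.elim (fun i => (e i, (0 : W))) (fun j => ((0 : V), f j)))
    (Sum.elim (fun i => (e' i, (0 : W))) (fun j => ((0 : V), f' j)))
    (a.compContinuousLinearMap (ContinuousLinearMap.fst ℝ V W))
    (b.compContinuousLinearMap (ContinuousLinearMap.snd ℝ V W)) X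
  rw [sum_eq_sum_inl] at hc
  · have hk : (k.factorial * l.factorial : ℝ) ≠ 0 := by positivity
    have hn : ((k + l).factorial : ℝ) ≠ 0 := by positivity
    have hc' : (k.factorial * l.factorial : ℝ) * contr
      (Sum.elim (fun i => (e i, (0 : W))) (fun j => ((0 : V), f j)))
      (Sum.elim (fun i => (e' i, (0 : W))) (fun j => ((0 : V), f' j))) (box rfl a b) X =
      (k + l).factorial * ∑ i : Fin k → ι, ∑ j : Fin l → κ,
      a (fun r => e (i r)) * b (fun r => f (j r)) *
        X (mix rfl (fun r => e' (i r)) (fun r => f' (j r))) :=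
      hc.trans (congrArg _ (Finset.sum_congr rfl fun i _ => sum_eq_sum_inr _ fun j r s hj => by
        rw [ContinuousAlternatingMap.compContinuousLinearMap_apply b,
          b.map_coord_zero r (by simp [hj])]
        simp))
    field_simp
    linear_combination hc'
  · intro i r j hj
    refine Finset.sum_eq_zero fun s _ => ?_
    rw [ContinuousAlternatingMap.compContinuousLinearMap_apply a, a.map_coord_zero r (by simp [hj])]
    simp

theorem formInner_box_box (hg : IsNondeg g) (hg' : IsNondeg g')
    (hG : ∀ x y, G x y = g x.1 y.1 + g' x.2 y.2) {k l n : ℕ} (h : k + l = n)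
    (a c : V [⋀^Fin k]→L[ℝ] ℝ) (b d : W [⋀^Fin l]→L[ℝ] ℝ) :
    formInner G (box h a b) (box h c d) = formInner g a c * formInner g' b d := by
  have he := isRecip_finBasis hg
  have hf := isRecip_finBasis hg'
  rw [formInner_eq (hg.prod hg' hG) (he.prod hf hG), contr_box, formInner_eq hg he,
    formInner_eq hg' hf]
  simp only [box_mix, contr]
  rw [mul_mul_mul_comm, Fintype.sum_mul_sum]
  congr 1
  refine Finset.sum_congr rfl fun i _ => Finset.sum_congr rfl fun j _ => ?_
  ring

theorem formInner_box_box_of_ne (hg : IsNondeg g) (hg' : IsNondeg g')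
    (hG : ∀ x y, G x y = g x.1 y.1 + g' x.2 y.2) {k l k' l' n : ℕ} (h : k + l = n)
    (h' : k' + l' = n) (hk : k' ≠ k)
    (a : V [⋀^Fin k]→L[ℝ] ℝ) (b : W [⋀^Fin l]→L[ℝ] ℝ) (c : V [⋀^Fin k']→L[ℝ] ℝ)
    (d : W [⋀^Fin l']→L[ℝ] ℝ) :
    formInner G (box h a b) (box h' c d) = 0 := by
  have he := isRecip_finBasis hg
  have hf := isRecip_finBasis hg'
  rw [formInner_eq (hg.prod hg' hG) (he.prod hf hG), contr_box]
  simp only [box_mix_of_ne h' h hk, mul_zero, Finset.sum_const_zero]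

theorem starAt_box (hg : IsNondeg g) (hg' : IsNondeg g')
    (hG : ∀ x y, G x y = g x.1 y.1 + g' x.2 y.2) {k l k' l' p q m m' n : ℕ} (h1 : k + l = m)
    (h2 : k' + l' = m') (h3 : m + m' = n) (h4 : k + k' = p) (h5 : l + l' = q) (h6 : p + q = n)
    (vol : V [⋀^Fin p]→L[ℝ] ℝ) (vol' : W [⋀^Fin q]→L[ℝ] ℝ)
    (a : V [⋀^Fin k]→L[ℝ] ℝ) (b : W [⋀^Fin l]→L[ℝ] ℝ) :
    starAt h3 G (box h6 vol vol') (box h1 a b) =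
      (-1 : ℝ) ^ (l * k') • box h2 (starAt h4 g vol a) (starAt h5 g' vol' b) := by
  have he := isRecip_finBasis hg
  have hf := isRecip_finBasis hg'
  refine ext_mix fun r s hrs v w => ?_
  rw [starAt_apply h3 (hg.prod hg' hG) (he.prod hf hG), contr_box,
    ContinuousAlternatingMap.smul_apply, smul_eq_mul]
  have hmid : ∀ (t : Fin k → V) (u : Fin l → W), app h3 (mix h1 t u) (mix hrs v w) =
      app h3 (app h1 (fun i => (t i, (0 : W))) (fun j => ((0 : V), u j)))
        (app hrs (fun i => (v i, (0 : W))) (fun j => ((0 : V), w j))) := fun _ _ => rfl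
  have hmix : ∀ {x y : ℕ} (hx : k + r = x) (hy : l + s = y) (hxy : x + y = n) (t : Fin k → V)
      (u : Fin l → W), app hxy (app hx (fun i => (t i, (0 : W))) (fun i => (v i, (0 : W))))
      (app hy (fun j => ((0 : V), u j)) (fun j => ((0 : V), w j))) =
      mix hxy (app hx t v) (app hy u w) := by
    intro x y hx hy hxy t u
    rw [mix]
    congr 1
    · exact funext fun i => (comp_app (fun x : V => (x, (0 : W))) hx t v i).symm
    · exact funext fun i => (comp_app (fun y : W => ((0 : V), y)) hy u w i).symm
  by_cases hr : k' = r
  · subst hr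
    obtain rfl : l' = s := by omega
    rw [box_mix, starAt_apply h4 hg he, starAt_apply h5 hg' hf, mul_mul_mul_comm, contr, contr,
      Fintype.sum_mul_sum, mul_left_comm]
    congr 1
    rw [Finset.mul_sum]
    refine Finset.sum_congr rfl fun i _ => ?_
    rw [Finset.mul_sum]
    refine Finset.sum_congr rfl fun j _ => ?_
    rw [contractTail_apply, contractTail_apply, contractTail_apply, hmid,
      map_app_middle _ h1 hrs h3 h4 h5 h6, hmix, box_mix]
    ring
  · rw [box_mix_of_ne h2 hrs hr, mul_zero]
    refine mul_eq_zero_of_right _ (Finset.sum_eq_zero fun i _ => Finset.sum_eq_zero fun j _ => ?_)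
    rw [contractTail_apply, hmid, map_app_middle _ h1 hrs h3 (rfl : k + r = k + r)
      (rfl : l + s = l + s) (by omega), hmix, box_mix_of_ne h6 _ (by omega)]
    ring

end Product

section FiniteDim

variable {E : Type*} [NormedAddCommGroup E] [NormedSpace ℝ E] [FiniteDimensional ℝ E]
variable {X : Type*} [NormedAddCommGroup X] [NormedSpace ℝ X]

/-- The components of a form in the chosen basis. -/
def components (E : Type*) [NormedAddCommGroup E] [NormedSpace ℝ E] [FiniteDimensional ℝ E] (k : ℕ) :
    (E [⋀^Fin k]→L[ℝ] ℝ) →ₗ[ℝ] ((Fin k → Fin (Module.finrank ℝ E)) → ℝ) where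
  toFun a i := a fun r => Module.finBasis ℝ E (i r)
  map_add' _ _ := rfl
  map_smul' _ _ := rfl

theorem components_injective (k : ℕ) : Function.Injective (components E k) := by
  intro a b h
  refine ContinuousAlternatingMap.toAlternatingMap_injective
    (AlternatingMap.coe_multilinearMap_injective ?_)
  exact Module.Basis.ext_multilinear (fun _ => Module.finBasis ℝ E) fun i => congrFun h i

theorem differentiableAt_form {k : ℕ} {f : X → E [⋀^Fin k]→L[ℝ] ℝ} {x : X}
    (h : ∀ v, DifferentiableAt ℝ (fun y => f y v) x) : DifferentiableAt ℝ f x := by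
  obtain ⟨s, hs⟩ := (components E k).exists_leftInverse_of_injective
    (LinearMap.ker_eq_bot.2 (components_injective k))
  have h1 : DifferentiableAt ℝ (fun y => components E k (f y)) x :=
    differentiableAt_pi.2 fun i => h _
  have h2 : f = fun y => LinearMap.toContinuousLinearMap s (components E k (f y)) :=
    funext fun y => (LinearMap.congr_fun hs (f y)).symm
  rw [h2]
  exact (ContinuousLinearMap.differentiableAt _).comp x h1

theorem differentiableAt_form_apply {k : ℕ} {f : X → E [⋀^Fin k]→L[ℝ] ℝ} {x : X}
    (h : DifferentiableAt ℝ f x) (v : Fin k → E) : DifferentiableAt ℝ (fun y => f y v) x :=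
  (ContinuousAlternatingMap.apply ℝ E ℝ v).differentiableAt.comp x h

end FiniteDim

section ExtDerivBox

variable {E : Type*} [NormedAddCommGroup E] [NormedSpace ℝ E] [FiniteDimensional ℝ E]
variable {E' : Type*} [NormedAddCommGroup E'] [NormedSpace ℝ E'] [FiniteDimensional ℝ E']

theorem removeNth_app_left {X : Type*} {k l n : ℕ} (h : k + 1 + l = n + 1) (h' : k + l = n)
    (u : Fin (k + 1) → X) (v : Fin l → X) (i : Fin (k + 1)) :
    (Fin.cast h (Fin.castAdd l i)).removeNth (app h u v) = app h' (i.removeNth u) v := by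
  subst h'
  funext j
  simp only [Fin.removeNth, app]
  refine Fin.addCases (fun j => ?_) (fun j => ?_) j
  · have : Fin.cast h.symm ((Fin.cast h (Fin.castAdd l i)).succAbove (Fin.castAdd l j)) =
        Fin.castAdd l (i.succAbove j) := by
      ext
      simp only [Fin.succAbove, Fin.lt_def]
      simp
      split_ifs <;> simp
    rw [this]
    simp [Fin.removeNth]
  · have : Fin.cast h.symm ((Fin.cast h (Fin.castAdd l i)).succAbove (Fin.natAdd k j)) =
        Fin.natAdd (k + 1) j := by
      ext
      have := i.2
      simp only [Fin.succAbove, Fin.lt_def]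
      simp
      split_ifs <;> simp <;> omega
    rw [this]
    simp

theorem removeNth_app_right {X : Type*} {k l n : ℕ} (h : k + (l + 1) = n + 1) (h' : k + l = n)
    (u : Fin k → X) (v : Fin (l + 1) → X) (i : Fin (l + 1)) :
    (Fin.cast h (Fin.natAdd k i)).removeNth (app h u v) = app h' u (i.removeNth v) := by
  subst h'
  funext j
  simp only [Fin.removeNth, app]
  refine Fin.addCases (fun j => ?_) (fun j => ?_) j
  · have : Fin.cast h.symm ((Fin.cast h (Fin.natAdd k i)).succAbove (Fin.castAdd l j)) =
        Fin.castAdd (l + 1) j := by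
      ext
      have := j.2
      simp only [Fin.succAbove, Fin.lt_def]
      simp
      split_ifs <;> simp <;> omega
    rw [this]
    simp
  · have : Fin.cast h.symm ((Fin.cast h (Fin.natAdd k i)).succAbove (Fin.natAdd k j)) =
        Fin.natAdd k (i.succAbove j) := by
      ext
      simp only [Fin.succAbove, Fin.lt_def]
      simp
      split_ifs <;> simp <;> omega
    rw [this]
    simp [Fin.removeNth]

variable {k l n : ℕ} {A : E → E [⋀^Fin k]→L[ℝ] ℝ} {B : E' → E' [⋀^Fin l]→L[ℝ] ℝ} {y : E} {z : E'}

theorem differentiableAt_box (h : k + l = n) (hA : DifferentiableAt ℝ A y)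
    (hB : DifferentiableAt ℝ B z) :
    DifferentiableAt ℝ (fun p : E × E' => box h (A p.1) (B p.2)) (y, z) := by
  subst h
  refine differentiableAt_form fun v => ?_
  have hk : (k.factorial * l.factorial : ℝ) ≠ 0 := by positivity
  have key : (fun p : E × E' => box rfl (A p.1) (B p.2) v) = fun p : E × E' =>
      (k.factorial * l.factorial : ℝ)⁻¹ * ∑ σ : Equiv.Perm (Fin (k + l)),
        ((Equiv.Perm.sign σ : ℤ) : ℝ) * (A p.1 (fun i => (v (σ (Fin.castAdd l i))).1) *
          B p.2 (fun j => (v (σ (Fin.natAdd k j))).2)) := by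
    funext p
    rw [eq_inv_mul_iff_mul_eq₀ hk]
    exact wedge_apply _ _ v
  rw [key]
  have hA' : ∀ u, DifferentiableAt ℝ (fun p : E × E' => A p.1 u) (y, z) := fun u =>
    DifferentiableAt.comp (y, z) (f := Prod.fst) (g := fun y => A y u)
      (differentiableAt_form_apply hA u) differentiableAt_fst
  have hB' : ∀ u, DifferentiableAt ℝ (fun p : E × E' => B p.2 u) (y, z) := fun u =>
    DifferentiableAt.comp (y, z) (f := Prod.snd) (g := fun y => B y u)
      (differentiableAt_form_apply hB u) differentiableAt_snd
  refine DifferentiableAt.const_mul (DifferentiableAt.fun_sum fun σ _ => ?_) _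
  exact ((hA' _).mul (hB' _)).const_mul _

theorem fderiv_box_mix (h : k + l = n) (hA : DifferentiableAt ℝ A y)
    (hB : DifferentiableAt ℝ B z) (x : E) (w : E') (u : Fin k → E) (t : Fin l → E') :
    fderiv ℝ (fun p : E × E' => box h (A p.1) (B p.2) (mix h u t)) (y, z) (x, w) =
      fderiv ℝ (fun y => A y u) y x * B z t + A y u * fderiv ℝ (fun z => B z t) z w := by
  simp only [box_mix]
  have hA' : HasFDerivAt (fun p : E × E' => A p.1 u)
      ((fderiv ℝ (fun y => A y u) y).comp (ContinuousLinearMap.fst ℝ E E')) (y, z) :=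
    HasFDerivAt.comp (y, z) (f := Prod.fst) (g := fun y => A y u)
      (differentiableAt_form_apply hA u).hasFDerivAt hasFDerivAt_fst
  have hB' : HasFDerivAt (fun p : E × E' => B p.2 t)
      ((fderiv ℝ (fun y => B y t) z).comp (ContinuousLinearMap.snd ℝ E E')) (y, z) :=
    HasFDerivAt.comp (y, z) (f := Prod.snd) (g := fun y => B y t)
      (differentiableAt_form_apply hB t).hasFDerivAt hasFDerivAt_snd
  erw [(hA'.mul hB').fderiv]
  simp
  ring

theorem fderiv_box_mix_of_ne (h : k + l = n) (x : E × E') {k' l' : ℕ} (h' : k' + l' = n) (hk : k ≠ k')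
    (u : Fin k' → E) (t : Fin l' → E') :
    fderiv ℝ (fun p : E × E' => box h (A p.1) (B p.2) (mix h' u t)) (y, z) x = 0 := by
  simp only [box_mix_of_ne h h' hk]
  simp

theorem extDeriv_box (h : k + l = n) (h1 : k + 1 + l = n + 1) (h2 : k + (l + 1) = n + 1)
    (hA : DifferentiableAt ℝ A y) (hB : DifferentiableAt ℝ B z) :
    extDeriv (fun p : E × E' => box h (A p.1) (B p.2)) (y, z) =
      box h1 (extDeriv A y) (B z) + (-1 : ℝ) ^ k • box h2 (A y) (extDeriv B z) := by
  refine ext_mix fun k' l' e u t => ?_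
  rw [extDeriv_apply (differentiableAt_box h hA hB), ContinuousAlternatingMap.add_apply,
    ContinuousAlternatingMap.smul_apply, smul_eq_mul, ← (finCongr e).sum_comp, Fin.sum_univ_add]
  have hval1 : ∀ i : Fin k', mix e u t (Fin.cast e (Fin.castAdd l' i)) = (u i, 0) := fun i => by
    simp [mix, app]
  have hval2 : ∀ i : Fin l', mix e u t (Fin.cast e (Fin.natAdd k' i)) = (0, t i) := fun i => by
    simp [mix, app]
  simp only [finCongr_apply, hval1, hval2]
  congr 1
  · cases k' with
    | zero => rw [box_mix_of_ne h1 e (by omega)]; simp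
    | succ r =>
      have hr : r + l' = n := by omega
      have hrem : ∀ i, (Fin.cast e (Fin.castAdd l' i)).removeNth (mix e u t) =
          mix hr (i.removeNth u) t := fun i => by
        rw [mix, removeNth_app_left e hr]
        rfl
      simp only [hrem]
      by_cases hk : k = r
      · subst hk
        obtain rfl : l = l' := by omega
        simp only [fderiv_box_mix h hA hB]
        rw [box_mix, extDeriv_apply hA, Finset.sum_mul]
        refine Finset.sum_congr rfl fun i _ => ?_
        simp [mul_assoc]
      · rw [box_mix_of_ne h1 e (by omega)]
        simp only [fderiv_box_mix_of_ne h _ hr hk]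
        simp
  · cases l' with
    | zero => rw [box_mix_of_ne h2 e (by omega)]; simp
    | succ s =>
      have hr : k' + s = n := by omega
      have hrem : ∀ i, (Fin.cast e (Fin.natAdd k' i)).removeNth (mix e u t) =
          mix hr u (i.removeNth t) := fun i => by
        rw [mix, removeNth_app_right e hr]
        rfl
      simp only [hrem]
      by_cases hk : k = k'
      · subst hk
        obtain rfl : l = s := by omega
        simp only [fderiv_box_mix h hA hB]
        rw [box_mix, extDeriv_apply hB, Finset.mul_sum, Finset.mul_sum]
        refine Finset.sum_congr rfl fun i _ => ?_
        simp [pow_add]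
        ring
      · rw [box_mix_of_ne h2 e (by omega)]
        simp only [fderiv_box_mix_of_ne h _ hr hk]
        simp

end ExtDerivBox

section StarDifferentiable

variable {E : Type*} [NormedAddCommGroup E] [NormedSpace ℝ E] [FiniteDimensional ℝ E]

theorem differentiableAt_prod {X ι : Type*} [NormedAddCommGroup X] [NormedSpace ℝ X] [Fintype ι]
    {f : ι → X → ℝ} {x : X} (h : ∀ i, DifferentiableAt ℝ (f i) x) :
    DifferentiableAt ℝ (fun y => ∏ i, f i y) x := by
  classical
  have := (HasFDerivAt.finsetProd (u := Finset.univ) fun i _ =>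
    (h i).hasFDerivAt).differentiableAt
  exact this

theorem differentiableAt_det {X : Type*} [NormedAddCommGroup X] [NormedSpace ℝ X] {d : ℕ}
    {Q : X → Matrix (Fin d) (Fin d) ℝ} {x : X} (h : ∀ i j, DifferentiableAt ℝ (fun y => Q y i j) x) :
    DifferentiableAt ℝ (fun y => (Q y).det) x := by
  simp only [Matrix.det_apply']
  refine DifferentiableAt.fun_sum fun σ _ => DifferentiableAt.const_mul ?_ _
  exact differentiableAt_prod fun i => h _ _

theorem differentiableAt_inv {X : Type*} [NormedAddCommGroup X] [NormedSpace ℝ X] {d : ℕ}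
    {Q : X → Matrix (Fin d) (Fin d) ℝ} {x : X} (h : ∀ i j, DifferentiableAt ℝ (fun y => Q y i j) x)
    (hx : IsUnit (Q x).det) (i j : Fin d) : DifferentiableAt ℝ (fun y => (Q y)⁻¹ i j) x := by
  simp only [Matrix.inv_def, Ring.inverse_eq_inv', Matrix.smul_apply, smul_eq_mul,
    Matrix.adjugate_apply]
  refine DifferentiableAt.mul ((differentiableAt_det h).inv hx.ne_zero)
    (differentiableAt_det fun r s => ?_)
  simp only [Matrix.updateRow_apply]
  split_ifs
  · exact differentiableAt_const _
  · exact h _ _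

theorem differentiableAt_starAt {k m n : ℕ} (h : k + m = n) {G : E → E →L[ℝ] E →L[ℝ] ℝ}
    {vol : E → E [⋀^Fin n]→L[ℝ] ℝ} {b : E → E [⋀^Fin k]→L[ℝ] ℝ} {y : E}
    (hG : DifferentiableAt ℝ G y) (hn : IsNondeg (G y)) (hv : DifferentiableAt ℝ vol y)
    (hb : DifferentiableAt ℝ b y) :
    DifferentiableAt ℝ (fun x => starAt h (G x) (vol x) (b x)) y := by
  refine differentiableAt_form fun u => ?_
  simp only [starAt, ContinuousAlternatingMap.smul_apply, ContinuousAlternatingMap.sum_apply,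
    smul_eq_mul, contract_apply]
  refine DifferentiableAt.const_mul (DifferentiableAt.fun_sum fun i _ =>
    DifferentiableAt.fun_sum fun j _ => ?_) _
  refine DifferentiableAt.mul (DifferentiableAt.mul (differentiableAt_form_apply hb _) ?_)
    (differentiableAt_form_apply hv _)
  refine differentiableAt_prod fun r => ?_
  refine differentiableAt_inv (Q := fun y => gram (G y)) (fun i j => ?_) (isUnit_det_gram hn) _ _
  exact (hG.clm_apply (differentiableAt_const _)).clm_apply (differentiableAt_const _)

end StarDifferentiable

section Curvature

variable {E : Type*} [NormedAddCommGroup E] [NormedSpace ℝ E] [FiniteDimensional ℝ E]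
variable {E' : Type*} [NormedAddCommGroup E'] [NormedSpace ℝ E'] [FiniteDimensional ℝ E']

theorem IsNondeg.isInvertible {g : E →L[ℝ] E →L[ℝ] ℝ} (hg : IsNondeg g) : g.IsInvertible := by
  have hinj : Function.Injective (g : E →ₗ[ℝ] (E →L[ℝ] ℝ)) := by
    rw [← LinearMap.ker_eq_bot, LinearMap.ker_eq_bot']
    intro v hv
    refine hg.nondeg v fun w => ?_
    rw [hg.symm]
    exact DFunLike.congr_fun hv w
  have hdim : Module.finrank ℝ E = Module.finrank ℝ (E →L[ℝ] ℝ) := by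
    rw [(LinearMap.toContinuousLinearMap (𝕜 := ℝ) (E := E) (F' := ℝ)).symm.finrank_eq]
    exact Subspace.dual_finrank_eq.symm
  exact ⟨(LinearEquiv.ofInjectiveOfFinrankEq _ hinj hdim).toContinuousLinearEquiv, rfl⟩

theorem christoffel_spec {G : E → E →L[ℝ] E →L[ℝ] ℝ} {y : E} (hg : IsNondeg (G y)) (u v w : E) :
    G y (christoffel G y u v) w =
      2⁻¹ * (fderiv ℝ G y u v w + fderiv ℝ G y v u w - fderiv ℝ G y w u v) := by
  obtain ⟨e, he⟩ := hg.isInvertible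
  have h1 : ∀ l, G y ((G y).inverse l) = l := fun l => by
    rw [← he, ContinuousLinearMap.inverse_equiv]
    exact e.apply_symm_apply l
  change G y ((G y).inverse _) w = _
  rw [h1]
  rfl

theorem christoffel_unique {G : E → E →L[ℝ] E →L[ℝ] ℝ} {y : E} (hg : IsNondeg (G y)) (u v x : E)
    (h : ∀ w, G y x w =
      2⁻¹ * (fderiv ℝ G y u v w + fderiv ℝ G y v u w - fderiv ℝ G y w u v)) :
    christoffel G y u v = x := by
  rw [← sub_eq_zero]
  refine hg.nondeg _ fun w => ?_
  rw [hg.symm, map_sub, sub_apply, christoffel_spec hg, h, sub_self]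

theorem differentiableAt_christoffel {G : E → E →L[ℝ] E →L[ℝ] ℝ} {y : E} (hg : IsNondeg (G y))
    (hG : ContDiffAt ℝ ∞ G y) : DifferentiableAt ℝ (christoffel G) y := by
  obtain ⟨e, he⟩ := hg.isInvertible
  have h1 : ContDiffAt ℝ ∞ (fun x => (G x).inverse) y :=
    ContDiffAt.comp y (g := ContinuousLinearMap.inverse) (he ▸ contDiffAt_map_inverse e) hG
  have h2 : ContDiffAt ℝ 1 (fderiv ℝ G) y := hG.fderiv_right (by norm_cast)
  have h3 : DifferentiableAt ℝ (fun x => (G x).inverse) y := h1.differentiableAt (by simp)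
  have h4 : DifferentiableAt ℝ (fderiv ℝ G) y := h2.differentiableAt (by simp)
  have h5 : DifferentiableAt ℝ (fun x => (fderiv ℝ G x).flip) y :=
    (ContinuousLinearMap.flipₗᵢ ℝ E E (E →L[ℝ] ℝ)).toContinuousLinearEquiv.differentiableAt.comp y h4
  unfold christoffel
  refine DifferentiableAt.clm_comp ?_ ?_
  · exact (ContinuousLinearMap.compL ℝ E (E →L[ℝ] ℝ) E).differentiableAt.comp y h3
  · exact ((h4.add h5).sub ((differentiableAt_const _).clm_comp h5)).const_smul (2 : ℝ)⁻¹

theorem curvature_apply (G : E → E →L[ℝ] E →L[ℝ] ℝ) (y v w u : E) :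
    curvature G y v w u = fderiv ℝ (christoffel G) y u v w - fderiv ℝ (christoffel G) y v u w
      + christoffel G y u (christoffel G y v w) - christoffel G y v (christoffel G y u w) := rfl

variable {G₁ : E → E →L[ℝ] E →L[ℝ] ℝ} {G₂ : E' → E' →L[ℝ] E' →L[ℝ] ℝ}
  {G : E × E' → (E × E') →L[ℝ] (E × E') →L[ℝ] ℝ} {U : Set E} {U' : Set E'}

theorem contDiffOn_prodMetric (h₁ : ContDiffOn ℝ ∞ G₁ U) (h₂ : ContDiffOn ℝ ∞ G₂ U')
    (hG : ∀ y ∈ U, ∀ z ∈ U', ∀ u v, G (y, z) u v = G₁ y u.1 v.1 + G₂ z u.2 v.2) :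
    ContDiffOn ℝ ∞ G (U ×ˢ U') := by
  refine contDiffOn_clm_apply.2 fun u => contDiffOn_clm_apply.2 fun v => ?_
  refine ContDiffOn.congr (f := fun p => G₁ p.1 u.1 v.1 + G₂ p.2 u.2 v.2) ?_
    fun p hp => hG p.1 hp.1 p.2 hp.2 u v
  refine ContDiffOn.add ?_ ?_
  · exact ((h₁.comp contDiffOn_fst fun p hp => hp.1).clm_apply contDiffOn_const).clm_apply
      contDiffOn_const
  · exact ((h₂.comp contDiffOn_snd fun p hp => hp.2).clm_apply contDiffOn_const).clm_apply
      contDiffOn_const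

theorem fderiv_apply_apply {X Y Z T : Type*} [NormedAddCommGroup X] [NormedSpace ℝ X]
    [NormedAddCommGroup Y] [NormedSpace ℝ Y] [NormedAddCommGroup Z] [NormedSpace ℝ Z]
    [NormedAddCommGroup T] [NormedSpace ℝ T] {F : X → Y →L[ℝ] Z →L[ℝ] T} {x : X}
    (hF : DifferentiableAt ℝ F x) (w : X) (u : Y) (v : Z) :
    fderiv ℝ F x w u v = fderiv ℝ (fun y => F y u v) x w := by
  have := ((hF.hasFDerivAt.clm_apply (hasFDerivAt_const u x)).clm_apply
    (hasFDerivAt_const v x)).fderiv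
  rw [this]
  simp

theorem fderiv_prodMetric (hU : IsOpen U) (hU' : IsOpen U') (h₁ : ContDiffOn ℝ ∞ G₁ U)
    (h₂ : ContDiffOn ℝ ∞ G₂ U')
    (hG : ∀ y ∈ U, ∀ z ∈ U', ∀ u v, G (y, z) u v = G₁ y u.1 v.1 + G₂ z u.2 v.2)
    {y : E} (hy : y ∈ U) {z : E'} (hz : z ∈ U') (w u v : E × E') :
    fderiv ℝ G (y, z) w u v = fderiv ℝ G₁ y w.1 u.1 v.1 + fderiv ℝ G₂ z w.2 u.2 v.2 := by
  have hd : DifferentiableAt ℝ G (y, z) :=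
    ((contDiffOn_prodMetric h₁ h₂ hG).contDiffAt
      ((hU.prod hU').mem_nhds ⟨hy, hz⟩)).differentiableAt (by simp)
  have hd1 : DifferentiableAt ℝ G₁ y := (h₁.contDiffAt (hU.mem_nhds hy)).differentiableAt (by simp)
  have hd2 : DifferentiableAt ℝ G₂ z :=
    (h₂.contDiffAt (hU'.mem_nhds hz)).differentiableAt (by simp)
  rw [fderiv_apply_apply hd, fderiv_apply_apply hd1, fderiv_apply_apply hd2]
  have hev : (fun p => G p u v) =ᶠ[nhds (y, z)] fun p => G₁ p.1 u.1 v.1 + G₂ p.2 u.2 v.2 := by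
    filter_upwards [(hU.prod hU').mem_nhds ⟨hy, hz⟩] with p hp using hG p.1 hp.1 p.2 hp.2 u v
  have k1 : HasFDerivAt (fun p : E × E' => G₁ p.1 u.1 v.1)
      ((fderiv ℝ (fun y => G₁ y u.1 v.1) y).comp (ContinuousLinearMap.fst ℝ E E')) (y, z) :=
    HasFDerivAt.comp (y, z) (f := Prod.fst) (g := fun y => G₁ y u.1 v.1)
      ((hd1.clm_apply (differentiableAt_const _)).clm_apply
        (differentiableAt_const _)).hasFDerivAt hasFDerivAt_fst
  have k2 : HasFDerivAt (fun p : E × E' => G₂ p.2 u.2 v.2)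
      ((fderiv ℝ (fun y => G₂ y u.2 v.2) z).comp (ContinuousLinearMap.snd ℝ E E')) (y, z) :=
    HasFDerivAt.comp (y, z) (f := Prod.snd) (g := fun y => G₂ y u.2 v.2)
      ((hd2.clm_apply (differentiableAt_const _)).clm_apply
        (differentiableAt_const _)).hasFDerivAt hasFDerivAt_snd
  rw [hev.fderiv_eq]
  erw [(k1.add k2).fderiv]
  rfl

theorem christoffel_prod (hU : IsOpen U) (hU' : IsOpen U') (h₁ : ContDiffOn ℝ ∞ G₁ U)
    (h₂ : ContDiffOn ℝ ∞ G₂ U') (n₁ : ∀ y ∈ U, IsNondeg (G₁ y)) (n₂ : ∀ z ∈ U', IsNondeg (G₂ z))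
    (hG : ∀ y ∈ U, ∀ z ∈ U', ∀ u v, G (y, z) u v = G₁ y u.1 v.1 + G₂ z u.2 v.2)
    {y : E} (hy : y ∈ U) {z : E'} (hz : z ∈ U') (u v : E × E') :
    christoffel G (y, z) u v = (christoffel G₁ y u.1 v.1, christoffel G₂ z u.2 v.2) := by
  refine christoffel_unique ((n₁ y hy).prod (n₂ z hz) (hG y hy z hz)) _ _ _ fun w => ?_
  rw [hG y hy z hz, christoffel_spec (n₁ y hy), christoffel_spec (n₂ z hz)]
  simp only [fderiv_prodMetric hU hU' h₁ h₂ hG hy hz]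
  ring

theorem fderiv_christoffel_prod (hU : IsOpen U) (hU' : IsOpen U') (h₁ : ContDiffOn ℝ ∞ G₁ U)
    (h₂ : ContDiffOn ℝ ∞ G₂ U') (n₁ : ∀ y ∈ U, IsNondeg (G₁ y)) (n₂ : ∀ z ∈ U', IsNondeg (G₂ z))
    (hG : ∀ y ∈ U, ∀ z ∈ U', ∀ u v, G (y, z) u v = G₁ y u.1 v.1 + G₂ z u.2 v.2)
    {y : E} (hy : y ∈ U) {z : E'} (hz : z ∈ U') (w u v : E × E') :
    fderiv ℝ (christoffel G) (y, z) w u v = (fderiv ℝ (christoffel G₁) y w.1 u.1 v.1,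
      fderiv ℝ (christoffel G₂) z w.2 u.2 v.2) := by
  have hd : DifferentiableAt ℝ (christoffel G) (y, z) :=
    differentiableAt_christoffel ((n₁ y hy).prod (n₂ z hz) (hG y hy z hz))
      ((contDiffOn_prodMetric h₁ h₂ hG).contDiffAt ((hU.prod hU').mem_nhds ⟨hy, hz⟩))
  have hd1 := differentiableAt_christoffel (n₁ y hy) (h₁.contDiffAt (hU.mem_nhds hy))
  have hd2 := differentiableAt_christoffel (n₂ z hz) (h₂.contDiffAt (hU'.mem_nhds hz))
  rw [fderiv_apply_apply hd, fderiv_apply_apply hd1, fderiv_apply_apply hd2]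
  have hev : (fun p => christoffel G p u v) =ᶠ[nhds (y, z)]
      fun p => (christoffel G₁ p.1 u.1 v.1, christoffel G₂ p.2 u.2 v.2) := by
    filter_upwards [(hU.prod hU').mem_nhds ⟨hy, hz⟩] with p hp using
      christoffel_prod hU hU' h₁ h₂ n₁ n₂ hG hp.1 hp.2 u v
  have k1 : HasFDerivAt (fun p : E × E' => christoffel G₁ p.1 u.1 v.1)
      ((fderiv ℝ (fun y => christoffel G₁ y u.1 v.1) y).comp
        (ContinuousLinearMap.fst ℝ E E')) (y, z) :=
    HasFDerivAt.comp (y, z) (f := Prod.fst) (g := fun y => christoffel G₁ y u.1 v.1)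
      ((hd1.clm_apply (differentiableAt_const _)).clm_apply
        (differentiableAt_const _)).hasFDerivAt hasFDerivAt_fst
  have k2 : HasFDerivAt (fun p : E × E' => christoffel G₂ p.2 u.2 v.2)
      ((fderiv ℝ (fun y => christoffel G₂ y u.2 v.2) z).comp
        (ContinuousLinearMap.snd ℝ E E')) (y, z) :=
    HasFDerivAt.comp (y, z) (f := Prod.snd) (g := fun y => christoffel G₂ y u.2 v.2)
      ((hd2.clm_apply (differentiableAt_const _)).clm_apply
        (differentiableAt_const _)).hasFDerivAt hasFDerivAt_snd
  rw [hev.fderiv_eq, (k1.prodMk k2).fderiv]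
  rfl

theorem trace_curvature_prod (hU : IsOpen U) (hU' : IsOpen U') (h₁ : ContDiffOn ℝ ∞ G₁ U)
    (h₂ : ContDiffOn ℝ ∞ G₂ U') (n₁ : ∀ y ∈ U, IsNondeg (G₁ y)) (n₂ : ∀ z ∈ U', IsNondeg (G₂ z))
    (hG : ∀ y ∈ U, ∀ z ∈ U', ∀ u v, G (y, z) u v = G₁ y u.1 v.1 + G₂ z u.2 v.2)
    {y : E} (hy : y ∈ U) {z : E'} (hz : z ∈ U') (v w : E × E') :
    LinearMap.trace ℝ (E × E') (curvature G (y, z) v w : (E × E') →ₗ[ℝ] (E × E')) =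
      LinearMap.trace ℝ E (curvature G₁ y v.1 w.1 : E →ₗ[ℝ] E) +
        LinearMap.trace ℝ E' (curvature G₂ z v.2 w.2 : E' →ₗ[ℝ] E') := by
  rw [← LinearMap.trace_prodMap']
  congr 1
  refine LinearMap.ext fun u => ?_
  change curvature G (y, z) v w u = (curvature G₁ y v.1 w.1 u.1, curvature G₂ z v.2 w.2 u.2)
  simp only [curvature_apply, fderiv_christoffel_prod hU hU' h₁ h₂ n₁ n₂ hG hy hz,
    christoffel_prod hU hU' h₁ h₂ n₁ n₂ hG hy hz]
  rfl

end Curvature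

section Charts

variable {E : Type*} [NormedAddCommGroup E] [NormedSpace ℝ E] [FiniteDimensional ℝ E]
  {H : Type*} [TopologicalSpace H] {I : ModelWithCorners ℝ E H}
  {M : Type*} [TopologicalSpace M] [ChartedSpace H M]
  {E' : Type*} [NormedAddCommGroup E'] [NormedSpace ℝ E'] [FiniteDimensional ℝ E']
  {H' : Type*} [TopologicalSpace H'] {I' : ModelWithCorners ℝ E' H'}
  {M' : Type*} [TopologicalSpace M'] [ChartedSpace H' M']

/-- A form on the tangent space of a product, as a form on the product of the tangent spaces. -/
def asProd {x : M × M'} {k : ℕ} (a : TangentSpace (I.prod I') x [⋀^Fin k]→L[ℝ] ℝ) :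
    (TangentSpace I x.1 × TangentSpace I' x.2) [⋀^Fin k]→L[ℝ] ℝ := a

/-- A bilinear form on the tangent space of a product, as one on the product of the tangent
spaces. -/
def asProd₂ {x : M × M'}
    (a : TangentSpace (I.prod I') x →L[ℝ] TangentSpace (I.prod I') x →L[ℝ] ℝ) :
    (TangentSpace I x.1 × TangentSpace I' x.2) →L[ℝ]
      (TangentSpace I x.1 × TangentSpace I' x.2) →L[ℝ] ℝ := a

theorem asProd_box {x : M × M'} {k l : ℕ} (a : FormField I M k) (b : FormField I' M' l) :
    asProd ((a.left.wedge b.right : FormField (I.prod I') (M × M') _) x) =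
      box rfl (a x.1) (b x.2) := by
  simp only [FormField.wedge, FormField.left, FormField.right, FormField.pullback, mfderiv_fst,
    mfderiv_snd]
  rfl

theorem asProd_starAt {x : M × M'} {k m n : ℕ} (h : k + m = n)
    (g : TangentSpace (I.prod I') x →L[ℝ] TangentSpace (I.prod I') x →L[ℝ] ℝ)
    (vol : TangentSpace (I.prod I') x [⋀^Fin n]→L[ℝ] ℝ)
    (b : TangentSpace (I.prod I') x [⋀^Fin k]→L[ℝ] ℝ) :
    asProd (starAt h g vol b) = starAt h (asProd₂ g) (asProd vol) (asProd b) := rfl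

theorem asProd₂_prodMetric {x : M × M'} (g : BilinField I M) (g' : BilinField I' M')
    (X Y : TangentSpace I x.1 × TangentSpace I' x.2) :
    asProd₂ (prodMetric g g' x) X Y = g x.1 X.1 Y.1 + g' x.2 X.2 Y.2 := by
  simp only [prodMetric, BilinField.pullback, mfderiv_fst, mfderiv_snd]
  rfl

theorem FormField.left_apply {k : ℕ} (w : FormField I M k) (x : M × M') :
    asProd ((w.left : FormField (I.prod I') (M × M') k) x) =
      (w x.1).compContinuousLinearMap (ContinuousLinearMap.fst ℝ _ _) := by
  simp only [FormField.left, FormField.pullback, mfderiv_fst]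
  rfl

variable [IsManifold I 1 M] [IsManifold I' 1 M'] [I.Boundaryless] [I'.Boundaryless]

/-- A form is differentiable if its expression in the chart around each point is, at that point. -/
def FormField.IsDiff {k : ℕ} (w : FormField I M k) : Prop :=
  ∀ x, DifferentiableAt ℝ (w.inChart x) (extChartAt I x x)

theorem FormField.Smooth.isDiff {k : ℕ} {w : FormField I M k} (h : w.Smooth) : w.IsDiff :=
  fun x => ((h x).contDiffAt ((isOpen_extChartAt_target x).mem_nhds
    (mem_extChartAt_target x))).differentiableAt (by simp)

theorem mfderiv_fst_chartSymmDeriv (x₀ : M × M') {y : E × E'}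
    (hy : y ∈ (extChartAt (I.prod I') x₀).target) (u : E × E') :
    (mfderiv (I.prod I') I (Prod.fst : M × M' → M) ((extChartAt (I.prod I') x₀).symm y)
      (chartSymmDeriv (I := I.prod I') x₀ y u) : E) =
      chartSymmDeriv (I := I) x₀.1 y.1 u.1 := by
  have h1 : MDifferentiableAt 𝓘(ℝ, E × E') (I.prod I') (extChartAt (I.prod I') x₀).symm y := by
    have := mdifferentiableWithinAt_extChartAt_symm (I := I.prod I') hy
    rwa [ModelWithCorners.range_eq_univ, mdifferentiableWithinAt_univ] at this
  have hy1 : y.1 ∈ (extChartAt I x₀.1).target := by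
    rw [extChartAt_prod] at hy
    exact hy.1
  have h2 : MDifferentiableAt 𝓘(ℝ, E) I (extChartAt I x₀.1).symm y.1 := by
    have := mdifferentiableWithinAt_extChartAt_symm (I := I) hy1
    rwa [ModelWithCorners.range_eq_univ, mdifferentiableWithinAt_univ] at this
  have e1 := mfderiv_comp (I := 𝓘(ℝ, E × E')) (I' := I.prod I') (I'' := I) y
    (g := (Prod.fst : M × M' → M)) mdifferentiableAt_fst h1
  have e2 := mfderiv_comp (I := 𝓘(ℝ, E × E')) (I' := 𝓘(ℝ, E)) (I'' := I) y
    (f := (Prod.fst : E × E' → E)) h2 differentiableAt_fst.mdifferentiableAt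
  rw [mfderiv_eq_fderiv, fderiv_fst] at e2
  exact (DFunLike.congr_fun e1 u).symm.trans (DFunLike.congr_fun e2 u)

theorem left_inChart {k : ℕ} (w : FormField I M k) (x₀ : M × M') {y : E × E'}
    (hy : y ∈ (extChartAt (I.prod I') x₀).target) :
    (w.left : FormField (I.prod I') (M × M') k).inChart x₀ y =
      (w.inChart x₀.1 y.1).compContinuousLinearMap (ContinuousLinearMap.fst ℝ E E') := by
  ext v
  exact congrArg (w ((extChartAt I x₀.1).symm y.1))
    (funext fun i => mfderiv_fst_chartSymmDeriv x₀ hy (v i))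

theorem mfderiv_snd_chartSymmDeriv (x₀ : M × M') {y : E × E'}
    (hy : y ∈ (extChartAt (I.prod I') x₀).target) (u : E × E') :
    (mfderiv (I.prod I') I' (Prod.snd : M × M' → M') ((extChartAt (I.prod I') x₀).symm y)
      (chartSymmDeriv (I := I.prod I') x₀ y u) : E') =
      chartSymmDeriv (I := I') x₀.2 y.2 u.2 := by
  have h1 : MDifferentiableAt 𝓘(ℝ, E × E') (I.prod I') (extChartAt (I.prod I') x₀).symm y := by
    have := mdifferentiableWithinAt_extChartAt_symm (I := I.prod I') hy
    rwa [ModelWithCorners.range_eq_univ, mdifferentiableWithinAt_univ] at this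
  have hy1 : y.2 ∈ (extChartAt I' x₀.2).target := by
    rw [extChartAt_prod] at hy
    exact hy.2
  have h2 : MDifferentiableAt 𝓘(ℝ, E') I' (extChartAt I' x₀.2).symm y.2 := by
    have := mdifferentiableWithinAt_extChartAt_symm (I := I') hy1
    rwa [ModelWithCorners.range_eq_univ, mdifferentiableWithinAt_univ] at this
  have e1 := mfderiv_comp (I := 𝓘(ℝ, E × E')) (I' := I.prod I') (I'' := I') y
    (g := (Prod.snd : M × M' → M')) mdifferentiableAt_snd h1
  have e2 := mfderiv_comp (I := 𝓘(ℝ, E × E')) (I' := 𝓘(ℝ, E')) (I'' := I') y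
    (f := (Prod.snd : E × E' → E')) h2 differentiableAt_snd.mdifferentiableAt
  rw [mfderiv_eq_fderiv, fderiv_snd] at e2
  exact (DFunLike.congr_fun e1 u).symm.trans (DFunLike.congr_fun e2 u)

theorem right_inChart {k : ℕ} (w : FormField I' M' k) (x₀ : M × M') {y : E × E'}
    (hy : y ∈ (extChartAt (I.prod I') x₀).target) :
    (w.right : FormField (I.prod I') (M × M') k).inChart x₀ y =
      (w.inChart x₀.2 y.2).compContinuousLinearMap (ContinuousLinearMap.snd ℝ E E') := by
  ext v
  exact congrArg (w ((extChartAt I' x₀.2).symm y.2))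
    (funext fun i => mfderiv_snd_chartSymmDeriv x₀ hy (v i))


theorem chartDeriv_prod (x : M × M') (X : TangentSpace I x.1 × TangentSpace I' x.2) :
    (chartDeriv (I.prod I') x X : E × E') = (chartDeriv I x.1 X.1, chartDeriv I' x.2 X.2) := by
  have h1 : MDifferentiableAt (I.prod I') 𝓘(ℝ, E × E') (extChartAt (I.prod I') x) x :=
    mdifferentiableAt_extChartAt (mem_chart_source _ x)
  have h2 : MDifferentiableAt I 𝓘(ℝ, E) (extChartAt I x.1) x.1 :=
    mdifferentiableAt_extChartAt (mem_chart_source _ x.1)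
  have h3 : MDifferentiableAt I' 𝓘(ℝ, E') (extChartAt I' x.2) x.2 :=
    mdifferentiableAt_extChartAt (mem_chart_source _ x.2)
  have e1 := mfderiv_comp (I := I.prod I') (I' := 𝓘(ℝ, E × E')) (I'' := 𝓘(ℝ, E)) x
    (g := (Prod.fst : E × E' → E)) differentiableAt_fst.mdifferentiableAt h1
  have e2 := mfderiv_comp (I := I.prod I') (I' := I) (I'' := 𝓘(ℝ, E)) x
    (f := (Prod.fst : M × M' → M)) h2 mdifferentiableAt_fst
  have e3 := mfderiv_comp (I := I.prod I') (I' := 𝓘(ℝ, E × E')) (I'' := 𝓘(ℝ, E')) x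
    (g := (Prod.snd : E × E' → E')) differentiableAt_snd.mdifferentiableAt h1
  have e4 := mfderiv_comp (I := I.prod I') (I' := I') (I'' := 𝓘(ℝ, E')) x
    (f := (Prod.snd : M × M' → M')) h3 mdifferentiableAt_snd
  rw [mfderiv_eq_fderiv, fderiv_fst] at e1
  rw [mfderiv_eq_fderiv, fderiv_snd] at e3
  rw [mfderiv_fst] at e2
  rw [mfderiv_snd] at e4
  exact Prod.ext ((DFunLike.congr_fun e1 X).symm.trans (DFunLike.congr_fun e2 X))
    ((DFunLike.congr_fun e3 X).symm.trans (DFunLike.congr_fun e4 X))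

theorem chartSymmDeriv_isInvertible (x₀ : M) {y : E} (hy : y ∈ (extChartAt I x₀).target) :
    (chartSymmDeriv (I := I) x₀ y).IsInvertible := by
  have := isInvertible_mfderivWithin_extChartAt_symm (I := I) hy
  rwa [ModelWithCorners.range_eq_univ, mfderivWithin_univ] at this

theorem form_comp_eq {k : ℕ} (w : FormField I M k) {x x' : M} (hx : x' = x)
    (D : TangentSpace I x →L[ℝ] TangentSpace I x') (hD : ∀ v : E, (D v : E) = v) :
    (w x').compContinuousLinearMap D = w x := by
  subst hx
  ext v
  exact congrArg (w x') (funext fun i => hD (v i))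

theorem chartSymmDeriv_chartDeriv (x : M) (v : TangentSpace I x) :
    (chartSymmDeriv (I := I) x (extChartAt I x x) (chartDeriv I x v) : E) = v := by
  have h1 : MDifferentiableAt I 𝓘(ℝ, E) (extChartAt I x) x :=
    mdifferentiableAt_extChartAt (mem_chart_source _ x)
  have h2 : MDifferentiableAt 𝓘(ℝ, E) I (extChartAt I x).symm (extChartAt I x x) := by
    have := mdifferentiableWithinAt_extChartAt_symm (I := I) (mem_extChartAt_target x)
    rwa [ModelWithCorners.range_eq_univ, mdifferentiableWithinAt_univ] at this
  have e := mfderiv_comp (I := I) (I' := 𝓘(ℝ, E)) (I'' := I) x h2 h1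
  have e2 : mfderiv I I ((extChartAt I x).symm ∘ extChartAt I x) x = mfderiv I I id x := by
    refine Filter.EventuallyEq.mfderiv_eq ?_
    filter_upwards [extChartAt_source_mem_nhds (I := I) x] with z hz
    exact (extChartAt I x).left_inv hz
  have e3 : ∀ v : E, (mfderiv I I (id : M → M) x v : E) = v := fun v => by
    rw [mfderiv_id]; rfl
  exact (DFunLike.congr_fun e v).symm.trans ((DFunLike.congr_fun e2 v).trans (e3 v))

theorem inChart_comp_chartDeriv {k : ℕ} (w : FormField I M k) (x : M) :
    (w.inChart x (extChartAt I x x)).compContinuousLinearMap (chartDeriv I x) = w x :=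
  form_comp_eq w ((extChartAt I x).left_inv (mem_extChartAt_source x))
    ((chartSymmDeriv x (extChartAt I x x)).comp (chartDeriv I x))
    fun v => chartSymmDeriv_chartDeriv x v

theorem wedge_inChart {k l : ℕ} (a : FormField I M k) (b : FormField I' M' l) (x : M × M')
    {y : E × E'} (hy : y ∈ (extChartAt (I.prod I') x).target) :
    (a.left.wedge b.right : FormField (I.prod I') (M × M') _).inChart x y =
      box rfl (a.inChart x.1 y.1) (b.inChart x.2 y.2) := by
  have h1 := left_inChart a x hy
  have h2 := right_inChart b x hy
  rw [box, ← h1, ← h2]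
  exact wedgeTo_comp rfl _ _ _

theorem wedge_inChart_eventuallyEq {k l : ℕ} (a : FormField I M k) (b : FormField I' M' l)
    (x : M × M') : (a.left.wedge b.right : FormField (I.prod I') (M × M') _).inChart x =ᶠ[nhds
      (extChartAt I x.1 x.1, extChartAt I' x.2 x.2)]
      fun y => box rfl (a.inChart x.1 y.1) (b.inChart x.2 y.2) := by
  filter_upwards [(isOpen_extChartAt_target (I := I.prod I') x).mem_nhds
    (mem_extChartAt_target (I := I.prod I') x)] with y hy using wedge_inChart a b x hy

theorem FormField.IsDiff.wedge {k l : ℕ} {a : FormField I M k} {b : FormField I' M' l}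
    (ha : a.IsDiff) (hb : b.IsDiff) :
    (a.left.wedge b.right : FormField (I.prod I') (M × M') _).IsDiff := fun x =>
  (wedge_inChart_eventuallyEq a b x).differentiableAt_iff.2
    (differentiableAt_box rfl (ha x.1) (hb x.2))

theorem FormField.d_add {k : ℕ} {a b : FormField I M k} (ha : a.IsDiff) (hb : b.IsDiff) (x : M) :
    (a + b).d x = a.d x + b.d x := by
  have h := extDeriv_add (ha x) (hb x)
  change (extDeriv (a.inChart x + b.inChart x) _).compContinuousLinearMap _ = _
  rw [h]
  rfl

theorem d_wedge {k l : ℕ} {a : FormField I M k} {b : FormField I' M' l}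
    (ha : a.IsDiff) (hb : b.IsDiff) (h1 : k + 1 + l = k + l + 1)
    (h2 : k + (l + 1) = k + l + 1) (x : M × M') :
    asProd ((a.left.wedge b.right : FormField (I.prod I') (M × M') _).d x) =
      box h1 (a.d x.1) (b x.2) + (-1 : ℝ) ^ k • box h2 (a x.1) (b.d x.2) := by
  have e := (wedge_inChart_eventuallyEq a b x).extDeriv_eq
  rw [extDeriv_box rfl h1 h2 (ha x.1) (hb x.2)] at e
  have e2 : asProd ((a.left.wedge b.right : FormField (I.prod I') (M × M') _).d x) =
      (box h1 (extDeriv (a.inChart x.1) (extChartAt I x.1 x.1))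
        (b.inChart x.2 (extChartAt I' x.2 x.2)) +
      (-1 : ℝ) ^ k • box h2 (a.inChart x.1 (extChartAt I x.1 x.1))
        (extDeriv (b.inChart x.2) (extChartAt I' x.2 x.2))).compContinuousLinearMap
        ((chartDeriv I x.1).prodMap (chartDeriv I' x.2)) := by
    rw [← e]
    ext v
    exact congrArg (extDeriv _ _) (funext fun i => chartDeriv_prod x (v i))
  have e3 := box_comp_prodMap h1 (extDeriv (a.inChart x.1) (extChartAt I x.1 x.1))
    (b.inChart x.2 (extChartAt I' x.2 x.2)) (chartDeriv I x.1) (chartDeriv I' x.2)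
  have e4 := box_comp_prodMap h2 (a.inChart x.1 (extChartAt I x.1 x.1))
    (extDeriv (b.inChart x.2) (extChartAt I' x.2 x.2)) (chartDeriv I x.1) (chartDeriv I' x.2)
  rw [inChart_comp_chartDeriv] at e3 e4
  rw [e2]
  exact congrArg₂ (fun a b => a + (-1 : ℝ) ^ k • b) e3 e4

end Charts

section Metric

variable {E : Type*} [NormedAddCommGroup E] [NormedSpace ℝ E] [FiniteDimensional ℝ E]
  {H : Type*} [TopologicalSpace H] {I : ModelWithCorners ℝ E H}
  {M : Type*} [TopologicalSpace M] [ChartedSpace H M]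
  {E' : Type*} [NormedAddCommGroup E'] [NormedSpace ℝ E'] [FiniteDimensional ℝ E']
  {H' : Type*} [TopologicalSpace H'] {I' : ModelWithCorners ℝ E' H'}
  {M' : Type*} [TopologicalSpace M'] [ChartedSpace H' M']

theorem IsLorentzian.isNondeg {g : BilinField I M} (h : IsLorentzian g) (x : M) :
    IsNondeg (g x) := by
  refine ⟨h.symm x, fun v hv => ?_⟩
  obtain ⟨t, _, ht⟩ := h.signature x
  by_contra hne
  have := ht v hne (hv t)
  rw [hv] at this
  exact lt_irrefl _ this

theorem IsNegRiemannian.isNondeg {g : BilinField I M} (h : IsNegRiemannian g) (x : M) :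
    IsNondeg (g x) := by
  refine ⟨h.symm x, fun v hv => ?_⟩
  by_contra hne
  have := h.neg x v hne
  rw [hv] at this
  exact lt_irrefl _ this

variable [IsManifold I 1 M] [IsManifold I' 1 M'] [I.Boundaryless] [I'.Boundaryless]

theorem isNondeg_inChart {g : BilinField I M} (hg : ∀ x, IsNondeg (g x)) (x₀ : M) {y : E}
    (hy : y ∈ (extChartAt I x₀).target) : IsNondeg (g.inChart x₀ y) := by
  obtain ⟨L, hL⟩ := chartSymmDeriv_isInvertible x₀ hy
  refine (hg _).comp L fun u v => ?_
  change g _ (chartSymmDeriv x₀ y u) (chartSymmDeriv x₀ y v) = _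
  rw [← hL]
  rfl

theorem hodge_inChart {g : BilinField I M} (hg : ∀ x, IsNondeg (g x)) {k m n : ℕ} (h : k + m = n)
    (vol : FormField I M n) (w : FormField I M k) (x₀ : M) {y : E}
    (hy : y ∈ (extChartAt I x₀).target) : (hodge g vol h w).inChart x₀ y =
      starAt h (g.inChart x₀ y) (vol.inChart x₀ y) (w.inChart x₀ y) := by
  obtain ⟨L, hL⟩ := chartSymmDeriv_isInvertible x₀ hy
  rw [FormField.inChart, FormField.inChart, FormField.inChart, ← hL]
  refine starAt_comp h (hg _) _ _ L fun u v => ?_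
  change g _ (chartSymmDeriv x₀ y u) (chartSymmDeriv x₀ y v) = _
  rw [← hL]
  rfl

theorem hodge_isDiff {g : BilinField I M} (hg : ∀ x, IsNondeg (g x)) (hs : g.Smooth) {k m n : ℕ}
    (h : k + m = n) {vol : FormField I M n} (hv : vol.IsDiff) {w : FormField I M k}
    (hw : w.IsDiff) : (hodge g vol h w).IsDiff := fun x => by
  have hx := (isOpen_extChartAt_target (I := I) x).mem_nhds (mem_extChartAt_target x)
  have hev : (hodge g vol h w).inChart x =ᶠ[nhds (extChartAt I x x)] fun y =>
      starAt h (g.inChart x y) (vol.inChart x y) (w.inChart x y) := by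
    filter_upwards [hx] with y hy using hodge_inChart hg h vol w x hy
  refine hev.differentiableAt_iff.2 (differentiableAt_starAt h ?_
    (isNondeg_inChart hg x (mem_extChartAt_target x)) (hv x) (hw x))
  exact ((hs x).contDiffAt hx).differentiableAt (by simp)

theorem prodMetric_inChart (g : BilinField I M) (g' : BilinField I' M') (x : M × M') {y : E × E'}
    (hy : y ∈ (extChartAt (I.prod I') x).target) (u v : E × E') :
    (prodMetric g g').inChart x y u v =
      g.inChart x.1 y.1 u.1 v.1 + g'.inChart x.2 y.2 u.2 v.2 := by
  have e1 := mfderiv_fst_chartSymmDeriv (I := I) (I' := I') x hy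
  have e2 := mfderiv_snd_chartSymmDeriv (I := I) (I' := I') x hy
  exact congrArg₂ (· + ·)
    (congrArg₂ (fun a b : E => g ((extChartAt I x.1).symm y.1) a b) (e1 u) (e1 v))
    (congrArg₂ (fun a b : E' => g' ((extChartAt I' x.2).symm y.2) a b) (e2 u) (e2 v))

theorem ricci_prodMetric {g : BilinField I M} {g' : BilinField I' M'} (hg : ∀ x, IsNondeg (g x))
    (hg' : ∀ x, IsNondeg (g' x)) (hs : g.Smooth) (hs' : g'.Smooth) (x : M × M')
    (X Y : TangentSpace I x.1 × TangentSpace I' x.2) :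
    ricci (prodMetric g g') x X Y = ricci g x.1 X.1 Y.1 + ricci g' x.2 X.2 Y.2 := by
  have key := trace_curvature_prod (G := (prodMetric g g').inChart x)
    (isOpen_extChartAt_target (I := I) x.1)
    (isOpen_extChartAt_target (I := I') x.2) (hs x.1) (hs' x.2)
    (fun y hy => isNondeg_inChart hg x.1 hy) (fun y hy => isNondeg_inChart hg' x.2 hy)
    (fun y hy z hz u v => prodMetric_inChart g g' x (y := (y, z))
      (by rw [extChartAt_prod]; exact ⟨hy, hz⟩) u v)
    (mem_extChartAt_target x.1) (mem_extChartAt_target x.2)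
    (chartDeriv (I.prod I') x X) (chartDeriv (I.prod I') x Y)
  have h1 := chartDeriv_prod x X
  have h2 := chartDeriv_prod x Y
  refine key.trans ?_
  rw [ricci, ricci]
  congr 3
  · congr 1
    · exact congrArg Prod.fst h1
    · exact congrArg Prod.fst h2
  · congr 1
    · exact congrArg Prod.snd h1
    · exact congrArg Prod.snd h2

theorem ricci_zero_left (g : BilinField I M) (x : M) (v : TangentSpace I x) :
    ricci g x 0 v = 0 := by
  have : curvature (g.inChart x) (extChartAt I x x) (chartDeriv I x 0) (chartDeriv I x v) = 0 := by
    ext u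
    simp [curvature_apply]
  rw [ricci, this]
  simp

theorem ricci_zero_right (g : BilinField I M) (x : M) (v : TangentSpace I x) :
    ricci g x v 0 = 0 := by
  have : curvature (g.inChart x) (extChartAt I x x) (chartDeriv I x v) (chartDeriv I x 0) = 0 := by
    ext u
    simp [curvature_apply]
  rw [ricci, this]
  simp

end Metric

section StarInjective

variable {V : Type*} [AddCommGroup V] [Module ℝ V] [TopologicalSpace V] [FiniteDimensional ℝ V]

theorem exists_perm_castAdd {k m : ℕ} {J : Fin k → Fin (k + m)} (hJ : Function.Injective J) :
    ∃ σ : Equiv.Perm (Fin (k + m)), ∀ r, σ (Fin.castAdd m r) = J r := by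
  classical
  let e : {x // x ∈ Set.range (Fin.castAdd m : Fin k → Fin (k + m))} ≃ {x // x ∈ Set.range J} :=
    (Equiv.ofInjective _ (Fin.castAdd_injective k m)).symm.trans (Equiv.ofInjective J hJ)
  refine ⟨e.extendSubtype, fun r => ?_⟩
  rw [Equiv.extendSubtype_apply_of_mem e _ ⟨r, rfl⟩]
  have : (⟨Fin.castAdd m r, ⟨r, rfl⟩⟩ : {x // x ∈ Set.range (Fin.castAdd m : Fin k → Fin (k + m))}) =
      Equiv.ofInjective _ (Fin.castAdd_injective k m) r := rfl
  simp only [e, Equiv.trans_apply, this, Equiv.symm_apply_apply]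
  rfl

theorem contr_contractTail_basis {k m : ℕ} {e' e : Fin (k + m) → V} (b : V [⋀^Fin k]→L[ℝ] ℝ)
    (vol : V [⋀^Fin (k + m)]→L[ℝ] ℝ) (σ : Equiv.Perm (Fin (k + m))) :
    contr e' e b (contractTail rfl (fun j => e (σ (Fin.natAdd k j))) vol) =
      k.factorial * (b (fun r => e' (σ (Fin.castAdd m r))) * vol (fun i => e (σ i))) := by
  classical
  have hsum : ∑ i : Fin k → Fin (k + m), b (fun r => e' (i r)) *
      contractTail rfl (fun j => e (σ (Fin.natAdd k j))) vol (fun r => e (i r)) =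
      ∑ τ : Equiv.Perm (Fin k), b (fun r => e' (σ (Fin.castAdd m (τ r)))) *
      contractTail rfl (fun j => e (σ (Fin.natAdd k j))) vol
        (fun r => e (σ (Fin.castAdd m (τ r)))) := by
    symm
    refine Fintype.sum_of_injective (fun τ : Equiv.Perm (Fin k) => fun r => σ (Fin.castAdd m (τ r)))
      (fun τ τ' h => Equiv.ext fun r =>
        Fin.castAdd_injective k m (σ.injective (congrFun h r))) _ _ (fun i hi => ?_) (fun _ => rfl)
    by_cases hinj : Function.Injective i
    · by_cases hmem : ∀ r, ∃ s, i r = σ (Fin.castAdd m s)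
      · refine absurd ?_ hi
        choose s hs using hmem
        have hsi : Function.Injective s := fun r r' h => hinj (by rw [hs, hs, h])
        exact ⟨Equiv.ofBijective s (Finite.injective_iff_bijective.1 hsi),
          funext fun r => (hs r).symm⟩
      · push Not at hmem
        obtain ⟨r, hr⟩ := hmem
        refine mul_eq_zero_of_right _ ?_
        obtain ⟨j, hj⟩ : ∃ j, σ.symm (i r) = Fin.natAdd k j := by
          rcases h : finSumFinEquiv.symm (σ.symm (i r)) with s | j
          · exact absurd (by rw [Equiv.symm_apply_eq, Equiv.symm_apply_eq] at h; exact h) (hr s)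
          · exact ⟨j, by rw [Equiv.symm_apply_eq] at h; exact h⟩
        rw [contractTail_apply]
        refine vol.map_eq_zero_of_eq _ (i := Fin.castAdd m r) (j := Fin.natAdd k j) ?_
          (by simp [Fin.ext_iff]; omega)
        have hj' : i r = σ (Fin.natAdd k j) := by rw [← hj, Equiv.apply_symm_apply]
        simp [app, hj']
    · refine mul_eq_zero_of_left (b.map_eq_zero_of_not_injective _ fun h => hinj fun r r' hr => h ?_) _
      simp only [hr]
  have hterm : ∀ τ : Equiv.Perm (Fin k), b (fun r => e' (σ (Fin.castAdd m (τ r)))) *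
      contractTail rfl (fun j => e (σ (Fin.natAdd k j))) vol
        (fun r => e (σ (Fin.castAdd m (τ r)))) =
      b (fun r => e' (σ (Fin.castAdd m r))) * vol (fun i => e (σ i)) := by
    intro τ
    have h1 := b.toAlternatingMap.map_perm (fun r => e' (σ (Fin.castAdd m r))) τ
    have h2 := (contractTail rfl (fun j => e (σ (Fin.natAdd k j))) vol).toAlternatingMap.map_perm
      (fun r => e (σ (Fin.castAdd m r))) τ
    rw [Units.smul_def, zsmul_eq_mul] at h1 h2
    have h1' : b (fun r => e' (σ (Fin.castAdd m (τ r)))) =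
      ((Equiv.Perm.sign τ : ℤ) : ℝ) * b (fun r => e' (σ (Fin.castAdd m r))) := h1
    have h2' : contractTail rfl (fun j => e (σ (Fin.natAdd k j))) vol
        (fun r => e (σ (Fin.castAdd m (τ r)))) = ((Equiv.Perm.sign τ : ℤ) : ℝ) *
      contractTail rfl (fun j => e (σ (Fin.natAdd k j))) vol
        (fun r => e (σ (Fin.castAdd m r))) := h2
    have h3 : app rfl (fun r => e (σ (Fin.castAdd m r))) (fun j => e (σ (Fin.natAdd k j))) =
        fun i => e (σ i) := by
      funext i
      refine Fin.addCases (fun i => ?_) (fun i => ?_) i <;> simp [app]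
    have s1 : ((Equiv.Perm.sign τ : ℤ) : ℝ) * ((Equiv.Perm.sign τ : ℤ) : ℝ) = 1 := by
      exact_mod_cast Int.units_coe_mul_self _
    rw [h1', h2', contractTail_apply, h3]
    linear_combination (b (fun r => e' (σ (Fin.castAdd m r))) * vol (fun i => e (σ i))) * s1
  rw [contr, hsum, Finset.sum_congr rfl fun τ _ => hterm τ, Finset.sum_const, Finset.card_univ,
    Fintype.card_perm, Fintype.card_fin, nsmul_eq_mul]

theorem starAt_eq_zero {k m n : ℕ} (h : k + m = n) (hn : Module.finrank ℝ V = n)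
    {g : V →L[ℝ] V →L[ℝ] ℝ} (hg : IsNondeg g) {vol : V [⋀^Fin n]→L[ℝ] ℝ} (hvol : vol ≠ 0)
    {b : V [⋀^Fin k]→L[ℝ] ℝ} (hb : starAt h g vol b = 0) : b = 0 := by
  classical
  subst h
  let s := finCongr hn.symm
  let e : Fin (k + m) → V := fun i => Module.finBasis ℝ V (s i)
  let e' : Fin (k + m) → V := fun i => dualFamily g (s i)
  have he0 := (isRecip_finBasis hg).swap hg.symm
  have he : IsRecip g e' e :=
    ⟨fun v => (he0.left v).trans (s.sum_comp fun i => g v (Module.finBasis ℝ V i) •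
        dualFamily g i).symm,
      fun v => (he0.right v).trans (s.sum_comp fun i => g (dualFamily g i) v •
        Module.finBasis ℝ V i).symm⟩
  have hve : vol e ≠ 0 := by
    have := (AlternatingMap.map_basis_ne_zero_iff ((Module.finBasis ℝ V).reindex s.symm)
      vol.toAlternatingMap).2 fun h0 => hvol (ContinuousAlternatingMap.toAlternatingMap_injective h0)
    have h2 : ⇑((Module.finBasis ℝ V).reindex s.symm) = e := by
      funext i; simp [e]
    rwa [h2] at this
  have key : ∀ J : Fin k → Fin (k + m), b (fun r => e' (J r)) = 0 := by
    intro J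
    by_cases hJ : Function.Injective J
    · obtain ⟨σ, hσ⟩ := exists_perm_castAdd hJ
      have h0 : starAt rfl g vol b (fun j => e (σ (Fin.natAdd k j))) = 0 := by rw [hb]; rfl
      rw [starAt_apply rfl hg he, contr_contractTail_basis] at h0
      have hk : (k.factorial : ℝ) ≠ 0 := by positivity
      have hvs : vol (fun i => e (σ i)) ≠ 0 := by
        have := vol.toAlternatingMap.map_perm e σ
        intro hz
        have h1 : vol.toAlternatingMap (e ∘ σ) = 0 := hz
        rw [this, smul_eq_zero_iff_eq] at h1
        exact hve h1
      simp only [hσ] at h0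
      simpa [hk, hvs] using h0
    · refine b.map_eq_zero_of_not_injective _ fun h => hJ fun r r' hr => h ?_
      simp only [hr]
  ext v
  have hv : v = fun r => ∑ i, g (v r) (e i) • e' i := funext fun r => he.left (v r)
  rw [hv, ContinuousAlternatingMap.map_sum]
  refine Finset.sum_eq_zero fun J _ => ?_
  rw [ContinuousAlternatingMap.map_smul_univ, key, smul_zero]

theorem volume_ne_zero {n : ℕ} (hn : Module.finrank ℝ V = n) {g : V →L[ℝ] V →L[ℝ] ℝ}
    (hg : IsNondeg g) {vol : V [⋀^Fin n]→L[ℝ] ℝ}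
    (hvol : ∀ v : Fin n → V, vol v ^ 2 = |(Matrix.of fun i j => g (v i) (v j)).det|) : vol ≠ 0 := by
  subst hn
  rintro rfl
  have h := hvol (Module.finBasis ℝ V)
  have h2 := (isUnit_det_gram hg).ne_zero
  rw [gram] at h2
  simp at h
  exact h2 (abs_eq_zero.1 h.symm)

end StarInjective

section BoxAlgebra

variable {V : Type*} [AddCommGroup V] [Module ℝ V] [TopologicalSpace V]
variable {W : Type*} [AddCommGroup W] [Module ℝ W] [TopologicalSpace W]

theorem box_smul_left {k l n : ℕ} (h : k + l = n) (c : ℝ) (a : V [⋀^Fin k]→L[ℝ] ℝ)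
    (b : W [⋀^Fin l]→L[ℝ] ℝ) : box h (c • a) b = c • box h a b := by
  refine ext_mix fun k' l' h' v w => ?_
  rw [ContinuousAlternatingMap.smul_apply]
  by_cases hk : k = k'
  · subst hk
    obtain rfl : l = l' := by omega
    rw [box_mix, box_mix, ContinuousAlternatingMap.smul_apply, smul_eq_mul, smul_eq_mul, mul_assoc]
  · rw [box_mix_of_ne _ _ hk, box_mix_of_ne _ _ hk, smul_zero]

theorem box_smul_right {k l n : ℕ} (h : k + l = n) (c : ℝ) (a : V [⋀^Fin k]→L[ℝ] ℝ)
    (b : W [⋀^Fin l]→L[ℝ] ℝ) : box h a (c • b) = c • box h a b := by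
  refine ext_mix fun k' l' h' v w => ?_
  rw [ContinuousAlternatingMap.smul_apply]
  by_cases hk : k = k'
  · subst hk
    obtain rfl : l = l' := by omega
    rw [box_mix, box_mix, ContinuousAlternatingMap.smul_apply, smul_eq_mul, smul_eq_mul,
      mul_left_comm]
  · rw [box_mix_of_ne _ _ hk, box_mix_of_ne _ _ hk, smul_zero]

theorem box_zero_left {k l n : ℕ} (h : k + l = n) (b : W [⋀^Fin l]→L[ℝ] ℝ) :
    box h (0 : V [⋀^Fin k]→L[ℝ] ℝ) b = 0 := by
  simpa using box_smul_left h 0 (0 : V [⋀^Fin k]→L[ℝ] ℝ) b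

theorem box_zero_right {k l n : ℕ} (h : k + l = n) (a : V [⋀^Fin k]→L[ℝ] ℝ) :
    box h a (0 : W [⋀^Fin l]→L[ℝ] ℝ) = 0 := by
  simpa using box_smul_right h 0 a (0 : W [⋀^Fin l]→L[ℝ] ℝ)

theorem box_const {k : ℕ} (a : V [⋀^Fin k]→L[ℝ] ℝ) (c : ℝ) :
    box (Nat.add_zero k) a (ContinuousAlternatingMap.constOfIsEmpty ℝ W (Fin 0) c) =
      c • a.compContinuousLinearMap (ContinuousLinearMap.fst ℝ V W) := by
  refine ext_mix fun k' l' h v w => ?_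
  rw [ContinuousAlternatingMap.smul_apply, ContinuousAlternatingMap.compContinuousLinearMap_apply]
  by_cases hk : k = k'
  · subst hk
    obtain rfl : l' = 0 := by omega
    rw [box_mix, mix, app_zero_right, mul_comm]
    rfl
  · rw [box_mix_of_ne _ _ hk, a.map_coord_zero (Fin.cast h (Fin.natAdd k' ⟨0, by omega⟩)),
      smul_zero]
    simp only [Function.comp_apply, mix, app, Fin.cast_cast, Fin.cast_eq_self, Fin.append_right]
    rfl

theorem eq_zero_of_box_eq_zero {k l n : ℕ} {h : k + l = n} {a : V [⋀^Fin k]→L[ℝ] ℝ}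
    {b : W [⋀^Fin l]→L[ℝ] ℝ} (hab : box h a b = 0) : a = 0 ∨ b = 0 := by
  by_contra! hne
  obtain ⟨u, hu⟩ : ∃ u, a u ≠ 0 := by
    by_contra! h0; exact hne.1 (ContinuousAlternatingMap.ext h0)
  obtain ⟨t, ht⟩ : ∃ t, b t ≠ 0 := by
    by_contra! h0; exact hne.2 (ContinuousAlternatingMap.ext h0)
  have := DFunLike.congr_fun hab (mix h u t)
  rw [box_mix] at this
  exact mul_ne_zero hu ht this

/-- Forms on a product split into components of different bidegree; here two of the four terms
have the same one. -/
theorem box_sum_shared {k₁ l₁ k₂ l₂ k₃ l₃ n : ℕ} {h₁ : k₁ + l₁ = n} {h₂ : k₂ + l₂ = n}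
    {h₃ : k₃ + l₃ = n} (h12 : k₁ ≠ k₂) (h13 : k₁ ≠ k₃) (h23 : k₂ ≠ k₃)
    {a : V [⋀^Fin k₁]→L[ℝ] ℝ} {b : W [⋀^Fin l₁]→L[ℝ] ℝ} {c e : V [⋀^Fin k₂]→L[ℝ] ℝ}
    {d f : W [⋀^Fin l₂]→L[ℝ] ℝ} {p : V [⋀^Fin k₃]→L[ℝ] ℝ} {q : W [⋀^Fin l₃]→L[ℝ] ℝ} {r s t : ℝ}
    (H : r • box h₁ a b + (box h₂ c d + s • box h₂ e f) + t • box h₃ p q = 0) :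
    r • box h₁ a b = 0 ∧ (∀ u v, c u * d v + s * (e u * f v) = 0) ∧ t • box h₃ p q = 0 := by
  have ev := fun {k' l'} (h : k' + l' = n) (u : Fin k' → V) (v : Fin l' → W) =>
    DFunLike.congr_fun H (mix h u v)
  simp only [ContinuousAlternatingMap.add_apply, ContinuousAlternatingMap.smul_apply,
    smul_eq_mul, ContinuousAlternatingMap.coe_zero, Pi.zero_apply] at ev
  have e1 : r • box h₁ a b = 0 := by
    refine ext_mix_zero _ fun k' l' h u v => ?_
    rw [ContinuousAlternatingMap.smul_apply, smul_eq_mul]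
    by_cases hk : k₁ = k'
    · subst hk
      obtain rfl : l₁ = l' := by omega
      have := ev h₁ u v
      rwa [box_mix_of_ne h₂ h₁ h12.symm, box_mix_of_ne h₂ h₁ h12.symm,
        box_mix_of_ne h₃ h₁ h13.symm, mul_zero, mul_zero, add_zero, add_zero, add_zero] at this
    · rw [box_mix_of_ne h₁ h hk, mul_zero]
  have e3 : t • box h₃ p q = 0 := by
    refine ext_mix_zero _ fun k' l' h u v => ?_
    rw [ContinuousAlternatingMap.smul_apply, smul_eq_mul]
    by_cases hk : k₃ = k'
    · subst hk
      obtain rfl : l₃ = l' := by omega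
      have := ev h₃ u v
      rwa [box_mix_of_ne h₂ h₃ h23, box_mix_of_ne h₂ h₃ h23, box_mix_of_ne h₁ h₃ h13, mul_zero,
        mul_zero, add_zero, zero_add, zero_add] at this
    · rw [box_mix_of_ne h₃ h hk, mul_zero]
  refine ⟨e1, fun u v => ?_, e3⟩
  rw [e1, e3, zero_add, add_zero] at H
  have := DFunLike.congr_fun H (mix h₂ u v)
  rwa [ContinuousAlternatingMap.add_apply, ContinuousAlternatingMap.smul_apply, box_mix,
    box_mix, smul_eq_mul] at this

theorem box_sum_distinct {k₁ l₁ k₂ l₂ k₃ l₃ k₄ l₄ n : ℕ} {h₁ : k₁ + l₁ = n} {h₂ : k₂ + l₂ = n}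
    {h₃ : k₃ + l₃ = n} {h₄ : k₄ + l₄ = n} (h12 : k₁ ≠ k₂) (h13 : k₁ ≠ k₃) (h14 : k₁ ≠ k₄)
    (h23 : k₂ ≠ k₃) (h24 : k₂ ≠ k₄) (h34 : k₃ ≠ k₄)
    {a : V [⋀^Fin k₁]→L[ℝ] ℝ} {b : W [⋀^Fin l₁]→L[ℝ] ℝ} {c : V [⋀^Fin k₂]→L[ℝ] ℝ}
    {d : W [⋀^Fin l₂]→L[ℝ] ℝ} {e : V [⋀^Fin k₃]→L[ℝ] ℝ} {f : W [⋀^Fin l₃]→L[ℝ] ℝ}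
    {p p' : V [⋀^Fin k₄]→L[ℝ] ℝ} {q q' : W [⋀^Fin l₄]→L[ℝ] ℝ} {r s t : ℝ}
    (H : box h₁ a b + r • box h₂ c d + (box h₃ e f + s • box h₄ p q) = t • box h₄ p' q') :
    box h₁ a b = 0 ∧ r • box h₂ c d = 0 ∧ box h₃ e f = 0 ∧ s • box h₄ p q = t • box h₄ p' q' := by
  have ev := fun {k' l'} (h : k' + l' = n) (u : Fin k' → V) (v : Fin l' → W) =>
    DFunLike.congr_fun H (mix h u v)
  simp only [ContinuousAlternatingMap.add_apply, ContinuousAlternatingMap.smul_apply,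
    smul_eq_mul] at ev
  have e1 : box h₁ a b = 0 := by
    refine ext_mix_zero _ fun k' l' h u v => ?_
    by_cases hk : k₁ = k'
    · subst hk
      obtain rfl : l₁ = l' := by omega
      have := ev h₁ u v
      rwa [box_mix_of_ne h₂ h₁ h12.symm, box_mix_of_ne h₃ h₁ h13.symm,
        box_mix_of_ne h₄ h₁ h14.symm, box_mix_of_ne h₄ h₁ h14.symm, mul_zero, mul_zero, mul_zero,
        add_zero, add_zero, add_zero] at this
    · exact box_mix_of_ne h₁ h hk a b u v
  have e2 : r • box h₂ c d = 0 := by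
    refine ext_mix_zero _ fun k' l' h u v => ?_
    rw [ContinuousAlternatingMap.smul_apply, smul_eq_mul]
    by_cases hk : k₂ = k'
    · subst hk
      obtain rfl : l₂ = l' := by omega
      have := ev h₂ u v
      rwa [box_mix_of_ne h₁ h₂ h12, box_mix_of_ne h₃ h₂ h23.symm,
        box_mix_of_ne h₄ h₂ h24.symm, box_mix_of_ne h₄ h₂ h24.symm, mul_zero, mul_zero,
        add_zero, add_zero, zero_add] at this
    · rw [box_mix_of_ne h₂ h hk, mul_zero]
  have e3 : box h₃ e f = 0 := by
    refine ext_mix_zero _ fun k' l' h u v => ?_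
    by_cases hk : k₃ = k'
    · subst hk
      obtain rfl : l₃ = l' := by omega
      have := ev h₃ u v
      rwa [box_mix_of_ne h₁ h₃ h13, box_mix_of_ne h₂ h₃ h23,
        box_mix_of_ne h₄ h₃ h34.symm, box_mix_of_ne h₄ h₃ h34.symm, mul_zero, mul_zero, mul_zero,
        add_zero, add_zero, zero_add] at this
    · exact box_mix_of_ne h₃ h hk e f u v
  refine ⟨e1, e2, e3, ?_⟩
  rwa [e1, e2, e3, zero_add, zero_add, zero_add] at H

theorem wedge_left_left_right_right {k k' l l' : ℕ} (a : V [⋀^Fin k]→L[ℝ] ℝ)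
    (c : V [⋀^Fin k']→L[ℝ] ℝ) (b : W [⋀^Fin l]→L[ℝ] ℝ) (d : W [⋀^Fin l']→L[ℝ] ℝ)
    {n : ℕ} (h : k + k' + l + l' = n) (h' : k + k' + (l + l') = n) :
    wedgeTo h (wedgeTo rfl (wedgeTo rfl (a.compContinuousLinearMap (ContinuousLinearMap.fst ℝ V W))
      (c.compContinuousLinearMap (ContinuousLinearMap.fst ℝ V W)))
      (b.compContinuousLinearMap (ContinuousLinearMap.snd ℝ V W)))
      (d.compContinuousLinearMap (ContinuousLinearMap.snd ℝ V W)) =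
    box h' (wedge a c) (wedge b d) := by
  rw [wedgeTo_assoc rfl h rfl h', ← wedgeTo_comp, ← wedgeTo_comp]
  rfl

theorem exists_scalar_of_mul_add_mul_eq_zero {S T : Type*} {a c : S → ℝ} {b d : T → ℝ}
    (h : ∀ s t, a s * b t + c s * d t = 0) {s₀ : S} (hs : a s₀ ≠ 0) {t₀ : T} (ht : d t₀ ≠ 0) :
    ∃ κ : ℝ, (∀ t, b t = κ * d t) ∧ ∀ s, c s = -κ * a s := by
  refine ⟨-(c s₀) / a s₀, fun t => ?_, fun s => ?_⟩
  · have := h s₀ t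
    field_simp
    linarith
  · have h1 := h s t₀
    have h2 := h s₀ t₀
    have : c s * a s₀ = c s₀ * a s := by
      refine mul_right_cancel₀ ht ?_
      linear_combination a s₀ * h1 - a s * h2
    field_simp
    linarith

end BoxAlgebra

section EinsteinAlgebra

variable {V : Type*} [AddCommGroup V] [Module ℝ V] [TopologicalSpace V] [FiniteDimensional ℝ V]
variable {W : Type*} [AddCommGroup W] [Module ℝ W] [TopologicalSpace W] [FiniteDimensional ℝ W]
variable {g : V →L[ℝ] V →L[ℝ] ℝ} {g' : W →L[ℝ] W →L[ℝ] ℝ} {G : (V × W) →L[ℝ] (V × W) →L[ℝ] ℝ}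

theorem interior_box {k l : ℕ} (a : V [⋀^Fin (k + 1)]→L[ℝ] ℝ) (b : W [⋀^Fin (l + 1)]→L[ℝ] ℝ)
    (h : k + 1 + (l + 1) = k + 1 + l + 1) (h1 : k + (l + 1) = k + 1 + l) (X : V × W) :
    interior X (box h a b) =
      box h1 (interior X.1 a) b + (-1 : ℝ) ^ (k + 1) • box rfl a (interior X.2 b) := by
  have hX : X = (X.1, 0) + (0, X.2) := by simp
  conv_lhs => rw [hX]
  rw [interior_add, interior_inl_box h1, interior_inr_box rfl]

theorem interior_box_zero {k : ℕ} (a : V [⋀^Fin (k + 1)]→L[ℝ] ℝ) (b : W [⋀^Fin 0]→L[ℝ] ℝ)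
    (X : V × W) : interior X (box (Nat.add_zero (k + 1)) a b) =
      box (Nat.add_zero k) (interior X.1 a) b := by
  have hX : X = (X.1, 0) + (0, X.2) := by simp
  conv_lhs => rw [hX]
  rw [interior_add, interior_inr_box_zero, add_zero]
  exact interior_inl_box _ _ a b X.1

theorem formInner_interior_even (hg : IsNondeg g) (hg' : IsNondeg g')
    (hG : ∀ x y, G x y = g x.1 y.1 + g' x.2 y.2) (a : V [⋀^Fin 4]→L[ℝ] ℝ) (f : W [⋀^Fin 0]→L[ℝ] ℝ)
    (b : V [⋀^Fin 3]→L[ℝ] ℝ) (n : W [⋀^Fin 1]→L[ℝ] ℝ) (X Y : V × W) :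
    formInner G (interior X (box (show 4 + 0 = 4 from rfl) a f + box (show 3 + 1 = 4 from rfl) b n))
      (interior Y (box (show 4 + 0 = 4 from rfl) a f + box (show 3 + 1 = 4 from rfl) b n)) =
    formInner g (interior X.1 a) (interior Y.1 a) * formInner g' f f
      + formInner g (interior X.1 b) (interior Y.1 b) * formInner g' n n
      - formInner g (interior X.1 a) b * formInner g' f (interior Y.2 n)
      - formInner g b (interior Y.1 a) * formInner g' (interior X.2 n) f
      + formInner g b b * formInner g' (interior X.2 n) (interior Y.2 n) := by
  have key : ∀ Z : V × W, interior Z (box (show 4 + 0 = 4 from rfl) a f +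
      box (show 3 + 1 = 4 from rfl) b n) = box (show 3 + 0 = 3 from rfl) (interior Z.1 a) f +
      (box (show 2 + 1 = 3 from rfl) (interior Z.1 b) n +
        (-1 : ℝ) ^ 3 • box (show 3 + 0 = 3 from rfl) b (interior Z.2 n)) := fun Z =>
    congrArg₂ (· + ·) (interior_box_zero a f Z) (interior_box (k := 2) (l := 0) b n rfl rfl Z)
  rw [key, key]
  simp only [formInner_add_left, formInner_add_right, formInner_smul_left, formInner_smul_right,
    formInner_box_box hg hg' hG, formInner_box_box_of_ne hg hg' hG _ _ (show 2 ≠ 3 by decide),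
    formInner_box_box_of_ne hg hg' hG _ _ (show 3 ≠ 2 by decide)]
  ring

theorem formInner_even (hg : IsNondeg g) (hg' : IsNondeg g')
    (hG : ∀ x y, G x y = g x.1 y.1 + g' x.2 y.2) (a : V [⋀^Fin 4]→L[ℝ] ℝ) (f : W [⋀^Fin 0]→L[ℝ] ℝ)
    (b : V [⋀^Fin 3]→L[ℝ] ℝ) (n : W [⋀^Fin 1]→L[ℝ] ℝ) :
    formInner G (box (show 4 + 0 = 4 from rfl) a f + box (show 3 + 1 = 4 from rfl) b n)
      (box (show 4 + 0 = 4 from rfl) a f + box (show 3 + 1 = 4 from rfl) b n) =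
    formInner g a a * formInner g' f f + formInner g b b * formInner g' n n := by
  simp only [formInner_add_left, formInner_add_right,
    formInner_box_box hg hg' hG, formInner_box_box_of_ne hg hg' hG _ _ (show 3 ≠ 4 by decide),
    formInner_box_box_of_ne hg hg' hG _ _ (show 4 ≠ 3 by decide)]
  ring

theorem formInner_interior_odd (hg : IsNondeg g) (hg' : IsNondeg g')
    (hG : ∀ x y, G x y = g x.1 y.1 + g' x.2 y.2) (b : V [⋀^Fin 3]→L[ℝ] ℝ) (n : W [⋀^Fin 1]→L[ℝ] ℝ)
    (a : V [⋀^Fin 1]→L[ℝ] ℝ) (c : W [⋀^Fin 3]→L[ℝ] ℝ) (X Y : V × W) :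
    formInner G (interior X (box (show 3 + 1 = 4 from rfl) b n + box (show 1 + 3 = 4 from rfl) a c))
      (interior Y (box (show 3 + 1 = 4 from rfl) b n + box (show 1 + 3 = 4 from rfl) a c)) =
    formInner g (interior X.1 b) (interior Y.1 b) * formInner g' n n
      + formInner g b b * formInner g' (interior X.2 n) (interior Y.2 n)
      + formInner g (interior X.1 a) (interior Y.1 a) * formInner g' c c
      + formInner g a a * formInner g' (interior X.2 c) (interior Y.2 c) := by
  have key : ∀ Z : V × W, interior Z (box (show 3 + 1 = 4 from rfl) b n +
      box (show 1 + 3 = 4 from rfl) a c) = box (show 2 + 1 = 3 from rfl) (interior Z.1 b) n +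
        (-1 : ℝ) ^ 3 • box (show 3 + 0 = 3 from rfl) b (interior Z.2 n) +
      (box (show 0 + 3 = 3 from rfl) (interior Z.1 a) c +
        (-1 : ℝ) ^ 1 • box (show 1 + 2 = 3 from rfl) a (interior Z.2 c)) := fun Z =>
    congrArg₂ (· + ·) (interior_box (k := 2) (l := 0) b n rfl rfl Z)
      (interior_box (k := 0) (l := 2) a c rfl rfl Z)
  rw [key, key]
  simp only [formInner_add_left, formInner_add_right, formInner_smul_left, formInner_smul_right,
    formInner_box_box hg hg' hG, formInner_box_box_of_ne hg hg' hG _ _ (show 2 ≠ 3 by decide),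
    formInner_box_box_of_ne hg hg' hG _ _ (show 3 ≠ 2 by decide),
    formInner_box_box_of_ne hg hg' hG _ _ (show 0 ≠ 2 by decide),
    formInner_box_box_of_ne hg hg' hG _ _ (show 2 ≠ 0 by decide),
    formInner_box_box_of_ne hg hg' hG _ _ (show 0 ≠ 3 by decide),
    formInner_box_box_of_ne hg hg' hG _ _ (show 3 ≠ 0 by decide),
    formInner_box_box_of_ne hg hg' hG _ _ (show 1 ≠ 2 by decide),
    formInner_box_box_of_ne hg hg' hG _ _ (show 2 ≠ 1 by decide),
    formInner_box_box_of_ne hg hg' hG _ _ (show 1 ≠ 3 by decide),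
    formInner_box_box_of_ne hg hg' hG _ _ (show 3 ≠ 1 by decide),
    formInner_box_box_of_ne hg hg' hG _ _ (show 0 ≠ 1 by decide),
    formInner_box_box_of_ne hg hg' hG _ _ (show 1 ≠ 0 by decide)]
  ring

theorem formInner_odd (hg : IsNondeg g) (hg' : IsNondeg g')
    (hG : ∀ x y, G x y = g x.1 y.1 + g' x.2 y.2) (b : V [⋀^Fin 3]→L[ℝ] ℝ) (n : W [⋀^Fin 1]→L[ℝ] ℝ)
    (a : V [⋀^Fin 1]→L[ℝ] ℝ) (c : W [⋀^Fin 3]→L[ℝ] ℝ) :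
    formInner G (box (show 3 + 1 = 4 from rfl) b n + box (show 1 + 3 = 4 from rfl) a c)
      (box (show 3 + 1 = 4 from rfl) b n + box (show 1 + 3 = 4 from rfl) a c) =
    formInner g b b * formInner g' n n + formInner g a a * formInner g' c c := by
  simp only [formInner_add_left, formInner_add_right,
    formInner_box_box hg hg' hG, formInner_box_box_of_ne hg hg' hG _ _ (show 3 ≠ 1 by decide),
    formInner_box_box_of_ne hg hg' hG _ _ (show 1 ≠ 3 by decide)]
  ring

end EinsteinAlgebra

section Functions

variable {E : Type*} [NormedAddCommGroup E] [NormedSpace ℝ E] [FiniteDimensional ℝ E]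
  {H : Type*} [TopologicalSpace H] {I : ModelWithCorners ℝ E H}
  {M : Type*} [TopologicalSpace M] [ChartedSpace H M] [IsManifold I 1 M] [I.Boundaryless]
  {f : M → ℝ}

theorem mdifferentiableAt_extChartAt_symm (x₀ : M) {y : E} (hy : y ∈ (extChartAt I x₀).target) :
    MDifferentiableAt 𝓘(ℝ, E) I (extChartAt I x₀).symm y := by
  have := mdifferentiableWithinAt_extChartAt_symm (I := I) hy
  rwa [ModelWithCorners.range_eq_univ, mdifferentiableWithinAt_univ] at this

theorem fderiv_comp_extChartAt_symm (hf : MDifferentiable I 𝓘(ℝ, ℝ) f) (x₀ : M) {y : E}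
    (hy : y ∈ (extChartAt I x₀).target) (u : E) :
    DifferentiableAt ℝ (f ∘ (extChartAt I x₀).symm) y ∧
    fderiv ℝ (f ∘ (extChartAt I x₀).symm) y u =
      mfderiv I 𝓘(ℝ, ℝ) f ((extChartAt I x₀).symm y) (chartSymmDeriv x₀ y u) := by
  have h := mdifferentiableAt_extChartAt_symm (I := I) x₀ hy
  have e := mfderiv_comp y (hf _) h
  rw [mfderiv_eq_fderiv] at e
  exact ⟨((hf _).comp y h).differentiableAt, DFunLike.congr_fun e u⟩

theorem ofFunction_isDiff (hf : MDifferentiable I 𝓘(ℝ, ℝ) f) : (ofFunction I f).IsDiff := fun x =>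
  (ContinuousAlternatingMap.constOfIsEmptyLIE ℝ E ℝ (Fin 0)).differentiableAt.comp _
    (fderiv_comp_extChartAt_symm hf x (mem_extChartAt_target x) 0).1

theorem ofFunction_d_apply (hf : MDifferentiable I 𝓘(ℝ, ℝ) f) (x : M)
    (v : Fin 1 → TangentSpace I x) :
    (ofFunction I f).d x v = mfderiv I 𝓘(ℝ, ℝ) f x (v 0) := by
  have h := fderiv_comp_extChartAt_symm hf x (mem_extChartAt_target x) (chartDeriv I x (v 0))
  have e := extDeriv_constOfIsEmpty (𝕜 := ℝ) (f ∘ (extChartAt I x).symm) (extChartAt I x x)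
  have e2 : (ofFunction I f).d x v =
      fderiv ℝ (f ∘ (extChartAt I x).symm) (extChartAt I x x) (chartDeriv I x (v 0)) := by
    refine (DFunLike.congr_fun e fun i => (chartDeriv I x (v i) : E)).trans ?_
    simp
  rw [e2, h.2]
  have e3 : ∀ {x' : M} (_ : x' = x) (u : TangentSpace I x'), (u : E) = v 0 →
      (mfderiv I 𝓘(ℝ, ℝ) f x' u : ℝ) = mfderiv I 𝓘(ℝ, ℝ) f x (v 0) := by
    rintro x' rfl u hu
    exact congrArg _ hu
  exact e3 ((extChartAt I x).left_inv (mem_extChartAt_source x)) _ (chartSymmDeriv_chartDeriv x _)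

theorem isLocallyConstant_of_mfderiv_eq_zero (hf : MDifferentiable I 𝓘(ℝ, ℝ) f)
    (h0 : ∀ x, mfderiv I 𝓘(ℝ, ℝ) f x = 0) : IsLocallyConstant f := by
  intro t
  rw [isOpen_iff_mem_nhds]
  intro x hx
  have h1 := (isOpen_extChartAt_target (I := I) x).isOpen_inter_preimage_of_fderiv_eq_zero
    (f := f ∘ (extChartAt I x).symm)
    (fun y hy => (fderiv_comp_extChartAt_symm hf x hy 0).1.differentiableWithinAt)
    (fun y hy => ContinuousLinearMap.ext fun u => by
      rw [(fderiv_comp_extChartAt_symm hf x hy u).2, h0]; rfl) t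
  have h2 : (extChartAt I x).target ∩ f ∘ (extChartAt I x).symm ⁻¹' t ∈ nhds (extChartAt I x x) := by
    refine h1.mem_nhds ⟨mem_extChartAt_target x, ?_⟩
    simpa using hx
  filter_upwards [(continuousAt_extChartAt x).preimage_mem_nhds h2,
    extChartAt_source_mem_nhds (I := I) x] with z hz hz'
  have h3 : f ((extChartAt I x).symm (extChartAt I x z)) ∈ t := hz.2
  rwa [(extChartAt I x).left_inv hz'] at h3

theorem exists_ne_zero_of_d_eq_smul [PreconnectedSpace M] (hf : MDifferentiable I 𝓘(ℝ, ℝ) f)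
    {ν : FormField I M 1} {κ : ℝ} (hd : (ofFunction I f).d = κ • ν) (hf0 : f ≠ 0) (hν : ν ≠ 0) :
    ∃ q, f q ≠ 0 ∧ ν q ≠ 0 := by
  by_contra! h
  have hmul : MDifferentiable I 𝓘(ℝ, ℝ) (f * f) := fun x => (hf x).mul (hf x)
  have hc : ∀ x, mfderiv I 𝓘(ℝ, ℝ) (f * f) x = 0 := fun x => by
    rw [((hf x).hasMFDerivAt.mul' (hf x).hasMFDerivAt).mfderiv]
    ext u
    suffices h' : ∀ D : ℝ, D = mfderiv I 𝓘(ℝ, ℝ) f x u → f x * D + D * f x = 0 from h' _ rfl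
    intro D hD
    by_cases hx : f x = 0
    · rw [hx, zero_mul, mul_zero, add_zero]
    · have := ofFunction_d_apply hf x fun _ => u
      rw [hd, Pi.smul_apply, h x hx, smul_zero] at this
      have h1 : (0 : ℝ) = mfderiv I 𝓘(ℝ, ℝ) f x u := this
      rw [hD, ← h1, mul_zero, zero_mul, add_zero]
  obtain ⟨q, hq⟩ : ∃ q, f q ≠ 0 := by
    by_contra! h0
    exact hf0 (funext h0)
  refine hν (funext fun x => h x fun hx => ?_)
  have := (isLocallyConstant_of_mfderiv_eq_zero hmul hc).apply_eq_of_isPreconnected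
    isPreconnected_univ (Set.mem_univ x) (Set.mem_univ q)
  simp [hx, hq] at this

end Functions

section Fields

variable {E : Type*} [NormedAddCommGroup E] [NormedSpace ℝ E] [FiniteDimensional ℝ E]
  {H : Type*} [TopologicalSpace H] {I : ModelWithCorners ℝ E H}
  {M : Type*} [TopologicalSpace M] [ChartedSpace H M]
  {E' : Type*} [NormedAddCommGroup E'] [NormedSpace ℝ E'] [FiniteDimensional ℝ E']
  {H' : Type*} [TopologicalSpace H'] {I' : ModelWithCorners ℝ E' H'}
  {M' : Type*} [TopologicalSpace M'] [ChartedSpace H' M']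

theorem FormField.exists_ne_zero {k : ℕ} {w : FormField I M k} (h : w ≠ 0) :
    ∃ x v, w x v ≠ 0 := by
  by_contra! h0
  exact h (funext fun x => ContinuousAlternatingMap.ext (h0 x))

theorem FormField.eq_zero_left {k l n : ℕ} (h : k + l = n) {a : FormField I M k}
    {b : FormField I' M' l} (hab : ∀ x : M × M', box h (a x.1) (b x.2) = 0) (hb : b ≠ 0) :
    a = 0 := by
  obtain ⟨q, v, hq⟩ := FormField.exists_ne_zero hb
  funext p
  refine (eq_zero_of_box_eq_zero (hab (p, q))).resolve_right fun h0 => hq ?_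
  exact congrArg (fun c => c v) h0

theorem FormField.eq_zero_right {k l n : ℕ} (h : k + l = n) {a : FormField I M k}
    {b : FormField I' M' l} (hab : ∀ x : M × M', box h (a x.1) (b x.2) = 0) (ha : a ≠ 0) :
    b = 0 := by
  obtain ⟨p, v, hp⟩ := FormField.exists_ne_zero ha
  funext q
  refine (eq_zero_of_box_eq_zero (hab (p, q))).resolve_left fun h0 => hp ?_
  exact congrArg (fun c => c v) h0

theorem FormField.ofFunction_ne_zero {f : M → ℝ} (hf : f ≠ 0) : ofFunction I f ≠ 0 := by
  intro h
  refine hf (funext fun x => ?_)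
  exact DFunLike.congr_fun (congrFun h x) Fin.elim0

theorem smul_left_eq_wedge {k : ℕ} (a : FormField I M k) (f : M' → ℝ) :
    (fun x : M × M' => f x.2 • (a.left : FormField (I.prod I') (M × M') k) x) =
      a.left.wedge (ofFunction I' f).right := by
  funext x
  refine Eq.trans ?_ (asProd_box a (ofFunction I' f) (x := x)).symm
  refine Eq.trans ?_ (box_const (W := TangentSpace I' x.2) (a x.1) (f x.2)).symm
  rw [← FormField.left_apply]
  rfl

theorem hodge_ne_zero {g : BilinField I M} (hg : ∀ x, IsNondeg (g x)) {n k m : ℕ}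
    (hn : Module.finrank ℝ E = n) {vol : FormField I M n} (hvol : IsVolumeForm g vol)
    (h : k + m = n) {w : FormField I M k} (hw : w ≠ 0) : hodge g vol h w ≠ 0 := fun h0 =>
  hw (funext fun x => starAt_eq_zero h hn (hg x) (volume_ne_zero hn (hg x) (hvol.sq_eq x))
    (congrFun h0 x))

theorem FormField.eq_zero_of_finrank_lt {k : ℕ} (h : Module.finrank ℝ E < k)
    (w : FormField I M k) : w = 0 :=
  funext fun x => Sugra.eq_zero_of_finrank_lt (V := E) h (w x)

/-- The components of `d(a ∧ b + c ∧ e)`, where `a, c` live on the first and `b, e` on the second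
factor, the degree of `a` being one more than that of `c`. -/
theorem wedge_add_wedge_closed_iff {k l n : ℕ} (h1 : k + 1 + 1 + l = n) (h2 : k + 1 + (l + 1) = n)
    (h3 : k + (l + 1 + 1) = n) {a : FormField I M (k + 1)} {b : FormField I' M' l}
    {c : FormField I M k} {e : FormField I' M' (l + 1)} (ha : a ≠ 0) (hb : b ≠ 0) (hc : c ≠ 0)
    (he : e ≠ 0) :
    (∀ x : M × M', box h1 (a.d x.1) (b x.2) + (-1 : ℝ) ^ (k + 1) • box h2 (a x.1) (b.d x.2) +
      (box h2 (c.d x.1) (e x.2) + (-1 : ℝ) ^ k • box h3 (c x.1) (e.d x.2)) = 0) ↔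
    a.d = 0 ∧ e.d = 0 ∧ ∃ κ : ℝ, b.d = κ • e ∧ c.d = ((-1) ^ k * κ) • a := by
  have hs : ((-1 : ℝ) ^ k) * (-1) ^ k = 1 := by rw [← mul_pow]; simp
  constructor
  · intro H
    have H' : ∀ x : M × M', (1 : ℝ) • box h1 (a.d x.1) (b x.2) +
        (box h2 (a x.1) (((-1 : ℝ) ^ (k + 1)) • b.d x.2) + (1 : ℝ) • box h2 (c.d x.1) (e x.2)) +
        ((-1 : ℝ) ^ k) • box h3 (c x.1) (e.d x.2) = 0 := fun x => by
      rw [← H x, box_smul_right, one_smul, one_smul]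
      abel
    have K := fun x => box_sum_shared (by omega) (by omega) (by omega) (H' x)
    have ha' : a.d = 0 := FormField.eq_zero_left h1 (fun x => by simpa using (K x).1) hb
    have he' : e.d = 0 := FormField.eq_zero_right h3 (fun x => by simpa using (K x).2.2) hc
    refine ⟨ha', he', ?_⟩
    obtain ⟨p, v, hp⟩ := FormField.exists_ne_zero ha
    obtain ⟨q, w, hq⟩ := FormField.exists_ne_zero he
    obtain ⟨κ, hκ1, hκ2⟩ := exists_scalar_of_mul_add_mul_eq_zero
      (S := Σ p : M, (Fin (k + 1) → TangentSpace I p))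
      (T := Σ q : M', (Fin (l + 1) → TangentSpace I' q))
      (a := fun s => a s.1 s.2) (c := fun s => c.d s.1 s.2)
      (b := fun t => ((-1 : ℝ) ^ (k + 1)) * b.d t.1 t.2) (d := fun t => e t.1 t.2)
      (fun s t => by
        have := (K (s.1, t.1)).2.1 s.2 t.2
        rwa [one_mul] at this) (s₀ := ⟨p, v⟩) hp (t₀ := ⟨q, w⟩) hq
    refine ⟨(-1) ^ (k + 1) * κ, ?_, ?_⟩
    · funext y
      ext u
      have h := hκ1 ⟨y, u⟩
      change b.d y u = (-1) ^ (k + 1) * κ * e y u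
      rw [mul_assoc, ← h, ← mul_assoc, pow_succ]
      linear_combination (-(b.d y u)) * hs
    · funext y
      ext u
      have h := hκ2 ⟨y, u⟩
      change c.d y u = ((-1) ^ k * ((-1) ^ (k + 1) * κ)) * a y u
      rw [show c.d y u = -κ * a y u from h, pow_succ]
      linear_combination (κ * a y u) * hs
  · rintro ⟨h1', h2', κ, h3', h4'⟩ x
    rw [h1', h2', h3', h4', Pi.smul_apply, Pi.smul_apply, Pi.zero_apply, Pi.zero_apply,
      box_zero_left, box_zero_right, box_smul_left, box_smul_right, smul_zero, add_zero, zero_add,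
      smul_smul, ← add_smul, pow_succ]
    rw [show (-1 : ℝ) ^ k * -1 * κ + (-1) ^ k * κ = 0 by ring, zero_smul]

end Fields

section WedgeSquare

variable {V : Type*} [AddCommGroup V] [Module ℝ V] [TopologicalSpace V] [FiniteDimensional ℝ V]
variable {W : Type*} [AddCommGroup W] [Module ℝ W] [TopologicalSpace W]

theorem starAt_add {k m n : ℕ} (h : k + m = n) (g : V →L[ℝ] V →L[ℝ] ℝ)
    (vol : V [⋀^Fin n]→L[ℝ] ℝ) (a b : V [⋀^Fin k]→L[ℝ] ℝ) :
    starAt h g vol (a + b) = starAt h g vol a + starAt h g vol b := by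
  simp only [starAt, ContinuousAlternatingMap.add_apply, add_mul, add_smul,
    Finset.sum_add_distrib, smul_add]

theorem wedgeTo_box_box_eq_zero {k l k' l' m m' n : ℕ} (hV : Module.finrank ℝ V < k + k')
    (h1 : k + l = m) (h2 : k' + l' = m') (h3 : m + m' = n)
    (a : V [⋀^Fin k]→L[ℝ] ℝ) (b : W [⋀^Fin l]→L[ℝ] ℝ) (c : V [⋀^Fin k']→L[ℝ] ℝ)
    (d : W [⋀^Fin l']→L[ℝ] ℝ) : wedgeTo h3 (box h1 a b) (box h2 c d) = 0 := by
  rw [wedgeTo_box_box h1 h2 h3 rfl rfl (by omega), eq_zero_of_finrank_lt hV (wedgeTo _ a c),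
    box_zero_left, smul_zero]

theorem wedge_self_even (hV : Module.finrank ℝ V = 5) (a : V [⋀^Fin 4]→L[ℝ] ℝ)
    (f : W [⋀^Fin 0]→L[ℝ] ℝ) (b : V [⋀^Fin 3]→L[ℝ] ℝ) (n : W [⋀^Fin 1]→L[ℝ] ℝ) :
    wedge (box (show 4 + 0 = 4 from rfl) a f + box (show 3 + 1 = 4 from rfl) b n)
      (box (show 4 + 0 = 4 from rfl) a f + box (show 3 + 1 = 4 from rfl) b n) = 0 := by
  have key : ∀ {k l k' l' : ℕ} (h1 : k + l = 4) (h2 : k' + l' = 4) (a : V [⋀^Fin k]→L[ℝ] ℝ)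
      (b : W [⋀^Fin l]→L[ℝ] ℝ) (c : V [⋀^Fin k']→L[ℝ] ℝ) (d : W [⋀^Fin l']→L[ℝ] ℝ),
      5 < k + k' → wedge (box h1 a b) (box h2 c d) = 0 := fun h1 h2 a b c d hk =>
    wedgeTo_box_box_eq_zero (hV.trans_lt hk) h1 h2 (rfl : 4 + 4 = 4 + 4) a b c d
  rw [wedge_add_left, wedge_add_right, wedge_add_right, key _ _ a f a f (by decide),
    key _ _ a f b n (by decide), key _ _ b n a f (by decide), key _ _ b n b n (by decide), add_zero,
    add_zero]

theorem wedge_self_odd (hV : Module.finrank ℝ V = 5) (b : V [⋀^Fin 3]→L[ℝ] ℝ)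
    (n : W [⋀^Fin 1]→L[ℝ] ℝ) (a : V [⋀^Fin 1]→L[ℝ] ℝ) (c : W [⋀^Fin 3]→L[ℝ] ℝ) :
    wedge (box (show 3 + 1 = 4 from rfl) b n + box (show 1 + 3 = 4 from rfl) a c)
      (box (show 3 + 1 = 4 from rfl) b n + box (show 1 + 3 = 4 from rfl) a c) =
    (2 : ℝ) • box (show 4 + 4 = 4 + 4 from rfl) (wedge b a) (wedge c n) := by
  have e1 : wedge (box (show 3 + 1 = 4 from rfl) b n) (box (show 3 + 1 = 4 from rfl) b n) = 0 :=
    wedgeTo_box_box_eq_zero (by omega) _ _ (rfl : 4 + 4 = 4 + 4) b n b n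
  have haa : wedgeTo (show 1 + 1 = 2 from rfl) a a = 0 := by
    have h := wedgeTo_comm (show 1 + 1 = 2 from rfl) rfl a a
    have h2 : (2 : ℝ) • wedgeTo (show 1 + 1 = 2 from rfl) a a = 0 := by
      rw [two_smul]
      nth_rw 1 [h]
      simp
    exact (smul_eq_zero.1 h2).resolve_left two_ne_zero
  have e2 : wedge (box (show 1 + 3 = 4 from rfl) a c) (box (show 1 + 3 = 4 from rfl) a c) = 0 := by
    refine (wedgeTo_box_box (show 1 + 3 = 4 from rfl) (show 1 + 3 = 4 from rfl)
      (rfl : 4 + 4 = 4 + 4) (show 1 + 1 = 2 from rfl) (show 3 + 3 = 6 from rfl) rfl a c a c).trans ?_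
    rw [haa, box_zero_left, smul_zero]
  have e3 : wedge (box (show 3 + 1 = 4 from rfl) b n) (box (show 1 + 3 = 4 from rfl) a c) =
      box (show 4 + 4 = 4 + 4 from rfl) (wedge b a) (wedge c n) := by
    refine (wedgeTo_box_box (show 3 + 1 = 4 from rfl) (show 1 + 3 = 4 from rfl)
      (rfl : 4 + 4 = 4 + 4) (show 3 + 1 = 4 from rfl) (show 1 + 3 = 4 from rfl) rfl b n a c).trans ?_
    rw [wedgeTo_comm (show 1 + 3 = 4 from rfl) (show 3 + 1 = 4 from rfl) n c, box_smul_right,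
      smul_smul]
    norm_num
    rfl
  have e4 : wedge (box (show 1 + 3 = 4 from rfl) a c) (box (show 3 + 1 = 4 from rfl) b n) =
      box (show 4 + 4 = 4 + 4 from rfl) (wedge b a) (wedge c n) := by
    refine (wedgeTo_box_box (show 1 + 3 = 4 from rfl) (show 3 + 1 = 4 from rfl)
      (rfl : 4 + 4 = 4 + 4) (show 1 + 3 = 4 from rfl) (show 3 + 1 = 4 from rfl) rfl a c b n).trans ?_
    rw [wedgeTo_comm (show 1 + 3 = 4 from rfl) (show 3 + 1 = 4 from rfl) a b, box_smul_left,
      smul_smul]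
    norm_num
    rfl
  rw [wedge_add_left, wedge_add_right, wedge_add_right, e1, e2, e3, e4, zero_add, add_zero,
    two_smul]

end WedgeSquare

section Fields

variable {E : Type*} [NormedAddCommGroup E] [NormedSpace ℝ E] [FiniteDimensional ℝ E]
  {H : Type*} [TopologicalSpace H] {I : ModelWithCorners ℝ E H}
  {M : Type*} [TopologicalSpace M] [ChartedSpace H M]
  {E' : Type*} [NormedAddCommGroup E'] [NormedSpace ℝ E'] [FiniteDimensional ℝ E']
  {H' : Type*} [TopologicalSpace H'] {I' : ModelWithCorners ℝ E' H'}
  {M' : Type*} [TopologicalSpace M'] [ChartedSpace H' M']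

theorem hodge_of_eq_box_add_box {g : BilinField I M} {g' : BilinField I' M'}
    (hg : ∀ x, IsNondeg (g x)) (hg' : ∀ x, IsNondeg (g' x))
    {k l k' l' c d c' d' p q m m' n : ℕ} (hkl : k + l = m) (hcd : c + d = m) (hkl' : k' + l' = m')
    (hcd' : c' + d' = m') (hpq : p + q = n) (hm : m + m' = n) (hk : k + k' = p) (hl : l + l' = q)
    (hc : c + c' = p) (hd : d + d' = q) (s : Even (l * k')) (s' : Even (d * c'))
    {vol : FormField I M p} {vol' : FormField I' M' q} {v : FormField (I.prod I') (M × M') n}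
    (hv : ∀ x, asProd (v x) = box hpq (vol x.1) (vol' x.2))
    {a : FormField I M k} {b : FormField I' M' l} {e : FormField I M c} {f : FormField I' M' d}
    {F : FormField (I.prod I') (M × M') m}
    (hF : ∀ x, asProd (F x) = box hkl (a x.1) (b x.2) + box hcd (e x.1) (f x.2)) (x : M × M') :
    asProd (hodge (prodMetric g g') v hm F x) =
      box hkl' (hodge g vol hk a x.1) (hodge g' vol' hl b x.2) +
      box hcd' (hodge g vol hc e x.1) (hodge g' vol' hd f x.2) := by
  rw [hodge, asProd_starAt, hF, hv, starAt_add, starAt_box (hg x.1) (hg' x.2)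
    (asProd₂_prodMetric g g') hkl hkl' hm hk hl hpq, starAt_box (hg x.1) (hg' x.2)
    (asProd₂_prodMetric g g') hcd hcd' hm hc hd hpq, s.neg_one_pow, s'.neg_one_pow, one_smul,
    one_smul]
  rfl

theorem asProd_wedge {k l : ℕ} (a : FormField (I.prod I') (M × M') k)
    (b : FormField (I.prod I') (M × M') l) (x : M × M') :
    asProd (a.wedge b x) = wedge (asProd (a x)) (asProd (b x)) := rfl

theorem FormField.ext_asProd {k : ℕ} {a b : FormField (I.prod I') (M × M') k} :
    a = b ↔ ∀ x, asProd (a x) = asProd (b x) := funext_iff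

theorem asProd_inv_two_smul_wedge_self {k l n : ℕ} (h : k + l = n + n)
    {F : FormField (I.prod I') (M × M') n} {x : M × M'} {a : TangentSpace I x.1 [⋀^Fin k]→L[ℝ] ℝ}
    {b : TangentSpace I' x.2 [⋀^Fin l]→L[ℝ] ℝ}
    (hF : wedge (asProd (F x)) (asProd (F x)) = (2 : ℝ) • box h a b) :
    asProd (((2⁻¹ : ℝ) • F.wedge F) x) = box h a b := by
  have : asProd (((2⁻¹ : ℝ) • F.wedge F) x) =
    (2⁻¹ : ℝ) • wedge (asProd (F x)) (asProd (F x)) := rfl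
  rw [this, hF, smul_smul, inv_mul_cancel₀ two_ne_zero, one_smul]

theorem inv_two_smul_wedge_self_even (hE : Module.finrank ℝ E = 5) {α : FormField I M 4}
    {f : FormField I' M' 0} {β : FormField I M 3} {ν : FormField I' M' 1}
    {F : FormField (I.prod I') (M × M') 4}
    (hF : ∀ x, asProd (F x) = box (show 4 + 0 = 4 from rfl) (α x.1) (f x.2) +
      box (show 3 + 1 = 4 from rfl) (β x.1) (ν x.2)) (x : M × M') :
    asProd (((2⁻¹ : ℝ) • F.wedge F) x) =
      asProd ((0 : FormField (I.prod I') (M × M') (4 + 4)) x) := by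
  have h : F.wedge F = 0 := FormField.ext_asProd.2 fun x => by
    have hE' : Module.finrank ℝ (TangentSpace I x.1) = 5 := hE
    rw [asProd_wedge, hF]
    exact wedge_self_even hE' (α x.1) (f x.2) (β x.1) (ν x.2)
  rw [h, smul_zero]

theorem inv_two_smul_wedge_self_odd (hE : Module.finrank ℝ E = 5) {β : FormField I M 3}
    {ν : FormField I' M' 1} {ϖ : FormField I M 1} {ε : FormField I' M' 3}
    {F : FormField (I.prod I') (M × M') 4}
    (hF : ∀ x, asProd (F x) = box (show 3 + 1 = 4 from rfl) (β x.1) (ν x.2) +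
      box (show 1 + 3 = 4 from rfl) (ϖ x.1) (ε x.2)) (x : M × M') :
    asProd (((2⁻¹ : ℝ) • F.wedge F) x) =
      box (show 4 + 4 = 4 + 4 from rfl) (β.wedge ϖ x.1) (ε.wedge ν x.2) := by
  refine asProd_inv_two_smul_wedge_self (k := 4) (l := 4) rfl ?_
  rw [hF]
  have hE' : Module.finrank ℝ (TangentSpace I x.1) = 5 := hE
  exact (wedge_self_odd hE' (β x.1) (ν x.2) (ϖ x.1) (ε x.2)).trans
    (congrArg₂ HSMul.hSMul rfl rfl)

theorem isBackground_iff {h : BilinField (I.prod I') (M × M')}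
    {vol : FormField (I.prod I') (M × M') 11} {F : FormField (I.prod I') (M × M') 4}
    {R : FormField (I.prod I') (M × M') 8}
    (hR : ∀ x, asProd (((2⁻¹ : ℝ) • F.wedge F) x) = asProd (R x)) :
    IsBackground h vol F ↔ F.d = 0 ∧ (hodge h vol (show 4 + 7 = 11 from rfl) F).d = R ∧
      ∀ (x : M × M') (X Y : TangentSpace (I.prod I') x),
        ricci h x X Y = -(1 / 2) * formInner (h x) (interior X (F x)) (interior Y (F x))
          + (1 / 6) * h x X Y * formInner (h x) (F x) (F x) := by
  have e : (2⁻¹ : ℝ) • F.wedge F = R := funext hR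
  exact ⟨fun H => ⟨H.closed, H.maxwell.trans e, H.einstein⟩,
    fun H => ⟨H.1, H.2.1.trans e.symm, H.2.2⟩⟩

theorem asProd_add {k : ℕ} {x : M × M'} (a b : TangentSpace (I.prod I') x [⋀^Fin k]→L[ℝ] ℝ) :
    asProd (a + b) = asProd a + asProd b := rfl

theorem isBackground_odd_iff_components (hE : Module.finrank ℝ E = 5) {β : FormField I M 3}
    {ν : FormField I' M' 1} {ϖ : FormField I M 1} {ε : FormField I' M' 3}
    {h : BilinField (I.prod I') (M × M')}
    {vol : FormField (I.prod I') (M × M') 11} {F : FormField (I.prod I') (M × M') 4}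
    (hF : ∀ x, asProd (F x) = box (show 3 + 1 = 4 from rfl) (β x.1) (ν x.2) +
      box (show 1 + 3 = 4 from rfl) (ϖ x.1) (ε x.2)) :
    IsBackground h vol F ↔ F.d = 0 ∧ (∀ x, asProd ((hodge h vol (show 4 + 7 = 11 from rfl) F).d x) =
        box (show 4 + (3 + 1) = 7 + 1 from rfl) (β.wedge ϖ x.1) (ε.wedge ν x.2)) ∧
      ∀ (x : M × M') (X Y : TangentSpace (I.prod I') x),
        ricci h x X Y = -(1 / 2) * formInner (h x) (interior X (F x)) (interior Y (F x))
          + (1 / 6) * h x X Y * formInner (h x) (F x) (F x) := by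
  have e := inv_two_smul_wedge_self_odd hE hF
  rw [isBackground_iff fun x => rfl]
  refine and_congr_right fun _ => and_congr_left fun _ =>
    FormField.ext_asProd.trans (forall_congr' fun x => ?_)
  exact iff_of_eq (congrArg _ (e x))

theorem wedge_wedge_eq_box {k k' l l' : ℕ} (h : k + k' + (l + l') = k + k' + l + l')
    (a : FormField I M k) (c : FormField I M k') (b : FormField I' M' l) (d : FormField I' M' l')
    (x : M × M') :
    asProd ((((a.left.wedge c.left).wedge b.right).wedge d.right :
      FormField (I.prod I') (M × M') _) x) = box h (wedge (a x.1) (c x.1)) (wedge (b x.2) (d x.2)) := by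
  rw [← wedge_left_left_right_right _ _ _ _ rfl]
  simp only [FormField.wedge, FormField.left, FormField.right, FormField.pullback, mfderiv_fst,
    mfderiv_snd]
  rfl

end Fields

section Equations

variable {E : Type*} [NormedAddCommGroup E] [NormedSpace ℝ E] [FiniteDimensional ℝ E]
  {H : Type*} [TopologicalSpace H] {I : ModelWithCorners ℝ E H}
  {M : Type*} [TopologicalSpace M] [ChartedSpace H M]
  {E' : Type*} [NormedAddCommGroup E'] [NormedSpace ℝ E'] [FiniteDimensional ℝ E']
  {H' : Type*} [TopologicalSpace H'] {I' : ModelWithCorners ℝ E' H'}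
  {M' : Type*} [TopologicalSpace M'] [ChartedSpace H' M']
  [IsManifold I 1 M] [IsManifold I' 1 M'] [I.Boundaryless] [I'.Boundaryless]

theorem d_of_eq_box {k l n : ℕ} (h0 : k + l = n) {a : FormField I M k} {b : FormField I' M' l}
    {F : FormField (I.prod I') (M × M') n} (hF : ∀ x, asProd (F x) = box h0 (a x.1) (b x.2))
    (ha : a.IsDiff) (hb : b.IsDiff) (h1 : k + 1 + l = n + 1) (h2 : k + (l + 1) = n + 1) :
    F.IsDiff ∧ ∀ x, asProd (F.d x) =
      box h1 (a.d x.1) (b x.2) + (-1 : ℝ) ^ k • box h2 (a x.1) (b.d x.2) := by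
  subst h0
  obtain rfl : F = a.left.wedge b.right := funext fun x => (hF x).trans (asProd_box a b).symm
  exact ⟨ha.wedge hb, d_wedge ha hb h1 h2⟩

theorem d_of_eq_box_add_box {k l k' l' n : ℕ} (h : k + l = n) (h' : k' + l' = n)
    {a : FormField I M k} {b : FormField I' M' l} {c : FormField I M k'} {e : FormField I' M' l'}
    {F : FormField (I.prod I') (M × M') n}
    (hF : ∀ x, asProd (F x) = box h (a x.1) (b x.2) + box h' (c x.1) (e x.2))
    (ha : a.IsDiff) (hb : b.IsDiff) (hc : c.IsDiff) (he : e.IsDiff)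
    (h1 : k + 1 + l = n + 1) (h2 : k + (l + 1) = n + 1)
    (h1' : k' + 1 + l' = n + 1) (h2' : k' + (l' + 1) = n + 1) (x : M × M') :
    asProd (F.d x) = box h1 (a.d x.1) (b x.2) + (-1 : ℝ) ^ k • box h2 (a x.1) (b.d x.2) +
      (box h1' (c.d x.1) (e x.2) + (-1 : ℝ) ^ k' • box h2' (c x.1) (e.d x.2)) := by
  have k1 := d_of_eq_box h (F := fun x => box h (a x.1) (b x.2)) (fun _ => rfl) ha hb h1 h2
  have k2 := d_of_eq_box h' (F := fun x => box h' (c x.1) (e x.2)) (fun _ => rfl) hc he h1' h2'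
  rw [← k1.2, ← k2.2, ← asProd_add, ← FormField.d_add k1.1 k2.1]
  congr 2
  exact funext hF

theorem closed_iff_of_adjacent_degrees {k l n : ℕ} (h : k + 1 + l = n) (h' : k + (l + 1) = n)
    {a : FormField I M (k + 1)} {b : FormField I' M' l}
    {c : FormField I M k} {e : FormField I' M' (l + 1)} {F : FormField (I.prod I') (M × M') n}
    (hF : ∀ x, asProd (F x) = box h (a x.1) (b x.2) + box h' (c x.1) (e x.2))
    (ha : a.IsDiff) (hb : b.IsDiff) (hc : c.IsDiff) (he : e.IsDiff)
    (ha0 : a ≠ 0) (hb0 : b ≠ 0) (hc0 : c ≠ 0) (he0 : e ≠ 0) :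
    F.d = 0 ↔ a.d = 0 ∧ e.d = 0 ∧ ∃ κ : ℝ, b.d = κ • e ∧ c.d = ((-1) ^ k * κ) • a := by
  rw [← wedge_add_wedge_closed_iff (by omega : k + 1 + 1 + l = n + 1)
    (by omega : k + 1 + (l + 1) = n + 1) (by omega : k + (l + 1 + 1) = n + 1) ha0 hb0 hc0 he0,
    funext_iff]
  refine forall_congr' fun x => ?_
  rw [← d_of_eq_box_add_box h h' hF ha hb hc he _ _ _ _ x]
  rfl

theorem d_eq_box_iff {k l k' l' n : ℕ} (h : k + l = n) (h' : k' + l' = n) (hk1 : k ≠ k' + 1)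
    (hk2 : k ≠ k') (hk3 : k + 1 ≠ k')
    {a : FormField I M k} {b : FormField I' M' l} {c : FormField I M k'} {e : FormField I' M' l'}
    {F : FormField (I.prod I') (M × M') n}
    (hF : ∀ x, asProd (F x) = box h (a x.1) (b x.2) + box h' (c x.1) (e x.2))
    (ha : a.IsDiff) (hb : b.IsDiff) (hc : c.IsDiff) (he : e.IsDiff)
    (ha0 : a ≠ 0) (hb0 : b ≠ 0) (he0 : e ≠ 0)
    (h2' : k' + (l' + 1) = n + 1) (p : FormField I M k') (q : FormField I' M' (l' + 1)) :
    (∀ x, asProd (F.d x) = box h2' (p x.1) (q x.2)) ↔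
      a.d = 0 ∧ b.d = 0 ∧ c.d = 0 ∧
        ∀ x : M × M', (-1 : ℝ) ^ k' • box h2' (c x.1) (e.d x.2) = box h2' (p x.1) (q x.2) := by
  have hd := d_of_eq_box_add_box h h' hF ha hb hc he (by omega) (by omega) (by omega) h2'
  constructor
  · intro H
    have K := fun x : M × M' => box_sum_distinct (t := 1) (p' := p x.1) (q' := q x.2)
      (by omega) (by omega) (by omega) (by omega) (by omega) (by omega)
      (((hd x).symm.trans (H x)).trans (one_smul ℝ _).symm)
    refine ⟨FormField.eq_zero_left _ (fun x => (K x).1) hb0, FormField.eq_zero_right _ (fun x =>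
      (smul_eq_zero.1 (K x).2.1).resolve_left (by simp)) ha0,
      FormField.eq_zero_left _ (fun x => (K x).2.2.1) he0, fun x => ?_⟩
    rw [(K x).2.2.2, one_smul]
  · rintro ⟨h1, h2, h3, h4⟩ x
    rw [hd, h1, h2, h3, h4]
    simp only [Pi.zero_apply, box_zero_left, box_zero_right, smul_zero, add_zero, zero_add]

theorem closed_iff_of_separated_degrees {k l k' l' n : ℕ} (h : k + l = n) (h' : k' + l' = n)
    (hk1 : k ≠ k' + 1) (hk2 : k ≠ k') (hk3 : k + 1 ≠ k')
    {a : FormField I M k} {b : FormField I' M' l} {c : FormField I M k'} {e : FormField I' M' l'}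
    {F : FormField (I.prod I') (M × M') n}
    (hF : ∀ x, asProd (F x) = box h (a x.1) (b x.2) + box h' (c x.1) (e x.2))
    (ha : a.IsDiff) (hb : b.IsDiff) (hc : c.IsDiff) (he : e.IsDiff)
    (ha0 : a ≠ 0) (hb0 : b ≠ 0) (hc0 : c ≠ 0) (he0 : e ≠ 0) :
    F.d = 0 ↔ a.d = 0 ∧ b.d = 0 ∧ c.d = 0 ∧ e.d = 0 := by
  have H := d_eq_box_iff h h' hk1 hk2 hk3 hF ha hb hc he ha0 hb0 he0 (by omega) 0 0
  simp only [Pi.zero_apply, box_zero_left] at H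
  refine (FormField.ext_asProd.trans H).trans (and_congr_right fun _ => and_congr_right fun _ =>
    and_congr_right fun _ => ⟨fun K => FormField.eq_zero_right _ (fun x =>
      (smul_eq_zero.1 (K x)).resolve_left (by simp)) hc0, fun K x => ?_⟩)
  rw [K, Pi.zero_apply, box_zero_right, smul_zero]

end Equations

section Einstein

variable {E : Type*} [NormedAddCommGroup E] [NormedSpace ℝ E] [FiniteDimensional ℝ E]
  {H : Type*} [TopologicalSpace H] {I : ModelWithCorners ℝ E H}
  {N : Type*} [TopologicalSpace N] [ChartedSpace H N]
  {E' : Type*} [NormedAddCommGroup E'] [NormedSpace ℝ E'] [FiniteDimensional ℝ E']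
  {H' : Type*} [TopologicalSpace H'] {I' : ModelWithCorners ℝ E' H'}
  {M : Type*} [TopologicalSpace M] [ChartedSpace H' M]

theorem interior_eq_of_zero_form {V : Type*} [AddCommGroup V] [Module ℝ V] [TopologicalSpace V]
    (a : V [⋀^Fin 1]→L[ℝ] ℝ) (X : V) (v : Fin 0 → V) : interior X a v = a fun _ => X := by
  rw [interior_apply]
  congr 1
  funext i
  rw [Subsingleton.elim i 0]
  rfl

theorem formInner_ofFunction (g : BilinField I N) (f : N → ℝ) (x : N)
    (b : TangentSpace I x [⋀^Fin 0]→L[ℝ] ℝ) (v : Fin 0 → TangentSpace I x) :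
    formInner (g x) (ofFunction I f x) b = f x * b v :=
  formInner_zero_form (g x) _ b v

variable [IsManifold I 1 N] [IsManifold I' 1 M] [I.Boundaryless] [I'.Boundaryless]
  {gN : BilinField I N} {gM : BilinField I' M}

theorem einstein_even_iff (hN : ∀ x, IsNondeg (gN x)) (hM : ∀ x, IsNondeg (gM x))
    (hNs : gN.Smooth) (hMs : gM.Smooth) {α : FormField I N 4} {β : FormField I N 3} {φ : M → ℝ}
    {ν : FormField I' M 1} (hα : IsNull gN α) (hβ : IsNull gN β)
    {F : FormField (I.prod I') (N × M) 4}
    (hF : ∀ x, asProd (F x) = box (show 4 + 0 = 4 from rfl) (α x.1) (ofFunction I' φ x.2) +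
      box (show 3 + 1 = 4 from rfl) (β x.1) (ν x.2)) [Nonempty N] :
    (∀ (x : N × M) (X Y : TangentSpace (I.prod I') x), ricci (prodMetric gN gM) x X Y =
      -(1 / 2) * formInner (prodMetric gN gM x) (interior X (F x)) (interior Y (F x))
      + (1 / 6) * prodMetric gN gM x X Y * formInner (prodMetric gN gM x) (F x) (F x)) ↔
    IsRicciFlat gM ∧
    (∀ (p : N) (q : M) (X Y : TangentSpace I p), ricci gN p X Y =
      -(1 / 2) * formInner (gN p) (interior X (α p)) (interior Y (α p)) * φ q ^ 2
      - (1 / 2) * formInner (gN p) (interior X (β p)) (interior Y (β p)) *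
        formInner (gM q) (ν q) (ν q)) ∧
    ∀ (p : N) (q : M) (X : TangentSpace I p) (Y : TangentSpace I' q),
      formInner (gN p) (β p) (interior X (α p)) * (φ q * ν q fun _ => Y) = 0 := by
  have hR : ∀ (x : N × M) (X Y : TangentSpace I x.1 × TangentSpace I' x.2),
      -(1 / 2) * formInner (prodMetric gN gM x) (interior (V := TangentSpace (I.prod I') x) X (F x))
        (interior (V := TangentSpace (I.prod I') x) Y (F x))
      + (1 / 6) * prodMetric gN gM x X Y * formInner (prodMetric gN gM x) (F x) (F x) =
      -(1 / 2) * formInner (gN x.1) (interior X.1 (α x.1)) (interior Y.1 (α x.1)) * φ x.2 ^ 2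
      - (1 / 2) * formInner (gN x.1) (interior X.1 (β x.1)) (interior Y.1 (β x.1)) *
        formInner (gM x.2) (ν x.2) (ν x.2)
      + (1 / 2) * (formInner (gN x.1) (β x.1) (interior X.1 (α x.1)) *
        (φ x.2 * ν x.2 fun _ => Y.2))
      + (1 / 2) * (formInner (gN x.1) (β x.1) (interior Y.1 (α x.1)) *
        (φ x.2 * ν x.2 fun _ => X.2)) := fun x X Y => by
    have e1 := formInner_interior_even (hN x.1) (hM x.2) (asProd₂_prodMetric gN gM (x := x))
      (α x.1) (ofFunction I' φ x.2) (β x.1) (ν x.2) X Y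
    have e2 := formInner_even (hN x.1) (hM x.2) (asProd₂_prodMetric gN gM (x := x))
      (α x.1) (ofFunction I' φ x.2) (β x.1) (ν x.2)
    rw [← hF] at e1 e2
    have e1' : formInner (prodMetric gN gM x) (interior (V := TangentSpace (I.prod I') x) X (F x))
        (interior (V := TangentSpace (I.prod I') x) Y (F x)) = _ := e1
    have e2' : formInner (prodMetric gN gM x) (F x) (F x) = _ := e2
    rw [e1', e2', hα, hβ, formInner_comm (hM x.2) (interior X.2 (ν x.2)),
      formInner_ofFunction gM φ x.2 _ Fin.elim0, formInner_ofFunction gM φ x.2 _ Fin.elim0,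
      formInner_ofFunction gM φ x.2 _ Fin.elim0, interior_eq_of_zero_form,
      interior_eq_of_zero_form, formInner_comm (hN x.1) (interior X.1 (α x.1)) (β x.1),
      show ofFunction I' φ x.2 Fin.elim0 = φ x.2 from rfl]
    ring
  constructor
  · intro hE
    have hE' : ∀ (x : N × M) (X Y : TangentSpace I x.1 × TangentSpace I' x.2), _ := fun x X Y =>
      (ricci_prodMetric hN hM hNs hMs x X Y).symm.trans ((hE x X Y).trans (hR x X Y))
    have i0 : ∀ {x : N} {k : ℕ} (a : TangentSpace I x [⋀^Fin (k + 1)]→L[ℝ] ℝ),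
        interior 0 a = 0 := fun a => by ext v; exact a.map_coord_zero 0 rfl
    have n0 : ∀ q : M, (ν q fun _ => 0) = 0 := fun q => (ν q).map_coord_zero 0 rfl
    have f0 : ∀ {x : N} {k : ℕ} (a : TangentSpace I x [⋀^Fin k]→L[ℝ] ℝ),
        formInner (gN x) 0 a = 0 := fun a => by
      simpa using formInner_smul_left (gN _) 0 0 a
    have f0' : ∀ {x : N} {k : ℕ} (a : TangentSpace I x [⋀^Fin k]→L[ℝ] ℝ),
        formInner (gN x) a 0 = 0 := fun a => by
      rw [formInner_comm (hN _), f0]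
    refine ⟨fun q X Y => ?_, fun p q X Y => ?_, fun p q X Y => ?_⟩
    · obtain ⟨p⟩ := ‹Nonempty N›
      have := hE' (p, q) (0, X) (0, Y)
      simpa only [ricci_zero_left, i0, f0, f0', mul_zero, zero_mul, add_zero, zero_add,
        sub_zero] using this
    · have := hE' (p, q) (X, 0) (Y, 0)
      simpa only [ricci_zero_left, n0, mul_zero, zero_mul, add_zero] using this
    · have := hE' (p, q) (X, 0) (0, Y)
      simp only [ricci_zero_left, ricci_zero_right, i0, f0', n0, mul_zero, zero_mul, add_zero,
        zero_add, sub_zero] at this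
      linarith
  · rintro ⟨h1, h2, h3⟩ x X Y
    refine (ricci_prodMetric hN hM hNs hMs x X Y).trans (Eq.trans ?_ (hR x X Y).symm)
    rw [h1, h2 x.1 x.2, h3 x.1 x.2, h3 x.1 x.2]
    ring

theorem einstein_odd_iff (hN : ∀ x, IsNondeg (gN x)) (hM : ∀ x, IsNondeg (gM x))
    (hNs : gN.Smooth) (hMs : gM.Smooth) {β : FormField I N 3} {ϖ : FormField I N 1}
    {ν : FormField I' M 1} {ε : FormField I' M 3} (hβ : IsNull gN β) (hϖ : IsNull gN ϖ)
    {F : FormField (I.prod I') (N × M) 4}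
    (hF : ∀ x, asProd (F x) = box (show 3 + 1 = 4 from rfl) (β x.1) (ν x.2) +
      box (show 1 + 3 = 4 from rfl) (ϖ x.1) (ε x.2)) [Nonempty N] :
    (∀ (x : N × M) (X Y : TangentSpace (I.prod I') x), ricci (prodMetric gN gM) x X Y =
      -(1 / 2) * formInner (prodMetric gN gM x) (interior X (F x)) (interior Y (F x))
      + (1 / 6) * prodMetric gN gM x X Y * formInner (prodMetric gN gM x) (F x) (F x)) ↔
    IsRicciFlat gM ∧
    ∀ (p : N) (q : M) (X Y : TangentSpace I p), ricci gN p X Y =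
      -(1 / 2) * formInner (gN p) (interior X (β p)) (interior Y (β p)) *
        formInner (gM q) (ν q) (ν q)
      - (1 / 2) * ϖ p (fun _ => X) * ϖ p (fun _ => Y) * formInner (gM q) (ε q) (ε q) := by
  have hR : ∀ (x : N × M) (X Y : TangentSpace I x.1 × TangentSpace I' x.2),
      -(1 / 2) * formInner (prodMetric gN gM x) (interior (V := TangentSpace (I.prod I') x) X (F x))
        (interior (V := TangentSpace (I.prod I') x) Y (F x))
      + (1 / 6) * prodMetric gN gM x X Y * formInner (prodMetric gN gM x) (F x) (F x) =
      -(1 / 2) * formInner (gN x.1) (interior X.1 (β x.1)) (interior Y.1 (β x.1)) *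
        formInner (gM x.2) (ν x.2) (ν x.2)
      - (1 / 2) * ϖ x.1 (fun _ => X.1) * ϖ x.1 (fun _ => Y.1) *
        formInner (gM x.2) (ε x.2) (ε x.2) := fun x X Y => by
    have e1 := formInner_interior_odd (hN x.1) (hM x.2) (asProd₂_prodMetric gN gM (x := x))
      (β x.1) (ν x.2) (ϖ x.1) (ε x.2) X Y
    have e2 := formInner_odd (hN x.1) (hM x.2) (asProd₂_prodMetric gN gM (x := x))
      (β x.1) (ν x.2) (ϖ x.1) (ε x.2)
    rw [← hF] at e1 e2
    have e1' : formInner (prodMetric gN gM x) (interior (V := TangentSpace (I.prod I') x) X (F x))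
        (interior (V := TangentSpace (I.prod I') x) Y (F x)) = _ := e1
    have e2' : formInner (prodMetric gN gM x) (F x) (F x) = _ := e2
    rw [e1', e2', hβ, hϖ, formInner_zero_form (gN x.1) (interior X.1 (ϖ x.1)) _ Fin.elim0,
      interior_eq_of_zero_form, interior_eq_of_zero_form]
    ring
  constructor
  · intro hE
    have hE' : ∀ (x : N × M) (X Y : TangentSpace I x.1 × TangentSpace I' x.2), _ := fun x X Y =>
      (ricci_prodMetric hN hM hNs hMs x X Y).symm.trans ((hE x X Y).trans (hR x X Y))
    refine ⟨fun q X Y => ?_, fun p q X Y => ?_⟩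
    · obtain ⟨p⟩ := ‹Nonempty N›
      have := hE' (p, q) (0, X) (0, Y)
      have i0 : interior 0 (β p) = 0 := by ext v; exact (β p).map_coord_zero 0 rfl
      have f0 : formInner (gN p) 0 (interior 0 (β p)) = 0 := by
        simpa using formInner_smul_left (gN p) 0 0 (interior 0 (β p))
      have w0 : (ϖ p fun _ => 0) = 0 := (ϖ p).map_coord_zero 0 rfl
      simp only [ricci_zero_left, w0, mul_zero, zero_mul, zero_add, sub_zero] at this
      rw [this]
      nth_rw 1 [i0]
      rw [f0]
      ring
    · have := hE' (p, q) (X, 0) (Y, 0)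
      simpa only [ricci_zero_left, add_zero] using this
  · rintro ⟨h1, h2⟩ x X Y
    refine (ricci_prodMetric hN hM hNs hMs x X Y).trans (Eq.trans ?_ (hR x X Y).symm)
    rw [h1, h2 x.1 x.2, add_zero]

end Einstein

section Backgrounds

variable {N : Type*} [TopologicalSpace N] [ChartedSpace (EuclideanSpace ℝ (Fin 5)) N]
  [IsManifold (𝓡 5) 1 N]
  {M : Type*} [TopologicalSpace M] [ChartedSpace (EuclideanSpace ℝ (Fin 6)) M]
  [IsManifold (𝓡 6) 1 M]
  {gN : BilinField (𝓡 5) N} {gM : BilinField (𝓡 6) M}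
  {volN : FormField (𝓡 5) N 5} {volM : FormField (𝓡 6) M 6}

theorem isBackground_even_iff [Nonempty N] [PreconnectedSpace M] (hN : ∀ x, IsNondeg (gN x))
    (hM : ∀ x, IsNondeg (gM x)) (hNs : gN.Smooth) (hMs : gM.Smooth) (hvN : IsVolumeForm gN volN)
    (hvM : IsVolumeForm gM volM) {α : FormField (𝓡 5) N 4} {β : FormField (𝓡 5) N 3} {φ : M → ℝ}
    {ν : FormField (𝓡 6) M 1} (hα : α.IsDiff) (hβ : β.IsDiff)
    (hφ : MDifferentiable (𝓡 6) 𝓘(ℝ, ℝ) φ) (hν : ν.IsDiff)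
    (hα0 : α ≠ 0) (hβ0 : β ≠ 0) (hφ0 : φ ≠ 0) (hν0 : ν ≠ 0) (nα : IsNull gN α)
    (nβ : IsNull gN β) :
    IsBackground (prodMetric gN gM) (volN.left.wedge volM.right)
      ((fun p => φ p.2 • α.left p) + β.left.wedge ν.right) ↔
    IsRicciFlat gM ∧
    (∃ κ l : ℝ, α.d = 0 ∧ ν.d = 0 ∧ (ofFunction (𝓡 6) φ).d = κ • ν ∧ β.d = -κ • α ∧
      (hodge gN volN (show 3 + 2 = 5 from rfl) β).d = 0 ∧
      (hodge gN volN (show 4 + 1 = 5 from rfl) α).d =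
        -l • hodge gN volN (show 3 + 2 = 5 from rfl) β ∧
      (hodge gM volM (show 1 + 5 = 6 from rfl) ν).d =
        l • hodge gM volM (show 0 + 6 = 6 from rfl) (ofFunction (𝓡 6) φ)) ∧
    (∀ (p : N) (q : M) (X Y : TangentSpace (𝓡 5) p), ricci gN p X Y =
      -(1 / 2) * formInner (gN p) (interior X (α p)) (interior Y (α p)) * φ q ^ 2
      - (1 / 2) * formInner (gN p) (interior X (β p)) (interior Y (β p)) *
        formInner (gM q) (ν q) (ν q)) ∧
    ∀ (p : N) (X : TangentSpace (𝓡 5) p), formInner (gN p) (β p) (interior X (α p)) = 0 := by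
  set f := ofFunction (𝓡 6) φ with hf
  have hfd : f.IsDiff := ofFunction_isDiff hφ
  have hf0 : f ≠ 0 := FormField.ofFunction_ne_zero hφ0
  rw [smul_left_eq_wedge α φ, ← hf]
  set F : FormField ((𝓡 5).prod (𝓡 6)) (N × M) 4 := α.left.wedge f.right + β.left.wedge ν.right
    with hFdef
  have hF : ∀ x, asProd (F x) = box (show 4 + 0 = 4 from rfl) (α x.1) (f x.2) +
      box (show 3 + 1 = 4 from rfl) (β x.1) (ν x.2) := fun x =>
    congrArg₂ (· + ·) (asProd_box α f) (asProd_box β ν)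
  have n5 : Module.finrank ℝ (EuclideanSpace ℝ (Fin 5)) = 5 := finrank_euclideanSpace_fin
  have n6 : Module.finrank ℝ (EuclideanSpace ℝ (Fin 6)) = 6 := finrank_euclideanSpace_fin
  have dN := hvN.smooth.isDiff
  have dM := hvM.smooth.isDiff
  have c1 := closed_iff_of_adjacent_degrees (F := F) (show 3 + 1 + 0 = 4 from rfl)
    (show 3 + (0 + 1) = 4 from rfl) hF hα hfd hβ hν hα0 hf0 hβ0 hν0
  have hstar := hodge_of_eq_box_add_box hN hM (show 3 + 1 = 4 from rfl) (show 4 + 0 = 4 from rfl)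
    (show 1 + 1 + 5 = 7 from rfl) (show 1 + (5 + 1) = 7 from rfl) (show 5 + 6 = 11 from rfl)
    (show 4 + 7 = 11 from rfl) (show 3 + 2 = 5 from rfl) (show 1 + 5 = 6 from rfl)
    (show 4 + 1 = 5 from rfl) (show 0 + 6 = 6 from rfl) (by decide) (by decide)
    (fun _ => asProd_box volN volM) (fun x => (hF x).trans (add_comm _ _))
  have c2 := closed_iff_of_adjacent_degrees _ _ hstar
    (hodge_isDiff hN hNs _ dN hβ) (hodge_isDiff hM hMs _ dM hν)
    (hodge_isDiff hN hNs _ dN hα) (hodge_isDiff hM hMs _ dM hfd)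
    (hodge_ne_zero hN n5 hvN _ hβ0) (hodge_ne_zero hM n6 hvM _ hν0)
    (hodge_ne_zero hN n5 hvN _ hα0) (hodge_ne_zero hM n6 hvM _ hf0)
  have hFF := inv_two_smul_wedge_self_even n5 hF
  have c3 := einstein_even_iff hN hM hNs hMs nα nβ hF
  have hfs : (hodge gM volM (show 0 + 6 = 6 from rfl) f).d = 0 :=
    FormField.eq_zero_of_finrank_lt (by rw [n6]; decide) _
  rw [isBackground_iff hFF]
  constructor
  · rintro ⟨h1, h2, h3⟩
    obtain ⟨a1, a2, κ, a3, a4⟩ := c1.1 h1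
    obtain ⟨b1, b2, l, b3, b4⟩ := c2.1 h2
    obtain ⟨d1, d2, d3⟩ := c3.1 h3
    refine ⟨d1, ⟨κ, l, a1, a2, a3, ?_, b1, ?_, b3⟩, d2, fun p X => ?_⟩
    · rw [a4]; norm_num
    · rw [b4]; norm_num
    · obtain ⟨q, hq, hq'⟩ := exists_ne_zero_of_d_eq_smul hφ a3 hφ0 hν0
      obtain ⟨v, hv⟩ : ∃ v, ν q v ≠ 0 := by
        by_contra! h0
        exact hq' (ContinuousAlternatingMap.ext h0)
      have := d3 p q X (v 0)
      rw [show (fun _ => v 0) = v from funext fun i => by rw [Subsingleton.elim i 0]] at this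
      exact (mul_eq_zero.1 this).resolve_right (mul_ne_zero hq hv)
  · rintro ⟨d1, ⟨κ, l, a1, a2, a3, a4, b1, b2, b3⟩, d2, d3⟩
    refine ⟨c1.2 ⟨a1, a2, κ, a3, ?_⟩, ?_, c3.2 ⟨d1, d2, fun p q X Y => ?_⟩⟩
    · rw [a4]; norm_num
    · refine c2.2 ⟨b1, hfs, l, b3, ?_⟩
      rw [b2]; norm_num
    · rw [d3, zero_mul]

theorem isBackground_odd_iff [Nonempty N] (hN : ∀ x, IsNondeg (gN x))
    (hM : ∀ x, IsNondeg (gM x)) (hNs : gN.Smooth) (hMs : gM.Smooth) (hvN : IsVolumeForm gN volN)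
    (hvM : IsVolumeForm gM volM) {β : FormField (𝓡 5) N 3} {ϖ : FormField (𝓡 5) N 1}
    {ν : FormField (𝓡 6) M 1} {ε : FormField (𝓡 6) M 3} (hβ : β.IsDiff) (hϖ : ϖ.IsDiff)
    (hν : ν.IsDiff) (hε : ε.IsDiff) (hβ0 : β ≠ 0) (hϖ0 : ϖ ≠ 0) (hν0 : ν ≠ 0) (hε0 : ε ≠ 0)
    (nβ : IsNull gN β) (nϖ : IsNull gN ϖ) :
    IsBackground (prodMetric gN gM) (volN.left.wedge volM.right)
      (β.left.wedge ν.right + ϖ.left.wedge ε.right) ↔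
    IsRicciFlat gM ∧
    (β.d = 0 ∧ ν.d = 0 ∧ ϖ.d = 0 ∧ ε.d = 0 ∧
      (hodge gM volM (show 1 + 5 = 6 from rfl) ν).d = 0 ∧
      (hodge gN volN (show 3 + 2 = 5 from rfl) β).d = 0 ∧
      (hodge gN volN (show 1 + 4 = 5 from rfl) ϖ).d = 0 ∧
      (hodge gN volN (show 1 + 4 = 5 from rfl) ϖ).left.wedge
          (hodge gM volM (show 3 + 3 = 6 from rfl) ε).d.right =
        (((β.left.wedge ϖ.left).wedge ε.right).wedge ν.right :
          FormField ((𝓡 5).prod (𝓡 6)) (N × M) 8)) ∧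
    ∀ (p : N) (q : M) (X Y : TangentSpace (𝓡 5) p), ricci gN p X Y =
      -(1 / 2) * formInner (gN p) (interior X (β p)) (interior Y (β p)) *
        formInner (gM q) (ν q) (ν q)
      - (1 / 2) * ϖ p (fun _ => X) * ϖ p (fun _ => Y) * formInner (gM q) (ε q) (ε q) := by
  set F : FormField ((𝓡 5).prod (𝓡 6)) (N × M) 4 := β.left.wedge ν.right + ϖ.left.wedge ε.right
    with hFdef
  have hF : ∀ x, asProd (F x) = box (show 3 + 1 = 4 from rfl) (β x.1) (ν x.2) +
      box (show 1 + 3 = 4 from rfl) (ϖ x.1) (ε x.2) := fun x =>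
    congrArg₂ (· + ·) (asProd_box β ν) (asProd_box ϖ ε)
  have n5 : Module.finrank ℝ (EuclideanSpace ℝ (Fin 5)) = 5 := finrank_euclideanSpace_fin
  have n6 : Module.finrank ℝ (EuclideanSpace ℝ (Fin 6)) = 6 := finrank_euclideanSpace_fin
  have dN := hvN.smooth.isDiff
  have dM := hvM.smooth.isDiff
  have hc := closed_iff_of_separated_degrees _ _ (by decide) (by decide) (by decide) hF hβ hν hϖ hε
    hβ0 hν0 hϖ0 hε0
  have hstar := hodge_of_eq_box_add_box hN hM (show 3 + 1 = 4 from rfl) (show 1 + 3 = 4 from rfl)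
    (show 2 + 5 = 7 from rfl) (show 4 + 3 = 7 from rfl) (show 5 + 6 = 11 from rfl)
    (show 4 + 7 = 11 from rfl) (show 3 + 2 = 5 from rfl) (show 1 + 5 = 6 from rfl)
    (show 1 + 4 = 5 from rfl) (show 3 + 3 = 6 from rfl) (by decide) (by decide)
    (fun _ => asProd_box volN volM) hF
  have c2 := d_eq_box_iff _ _ (by decide) (by decide) (by decide) hstar
    (hodge_isDiff hN hNs _ dN hβ) (hodge_isDiff hM hMs _ dM hν)
    (hodge_isDiff hN hNs _ dN hϖ) (hodge_isDiff hM hMs _ dM hε)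
    (hodge_ne_zero hN n5 hvN _ hβ0) (hodge_ne_zero hM n6 hvM _ hν0)
    (hodge_ne_zero hM n6 hvM _ hε0) (show 4 + (3 + 1) = 7 + 1 from rfl)
    (β.wedge ϖ) (ε.wedge ν)
  have hbg := isBackground_odd_iff_components (h := prodMetric gN gM)
    (vol := volN.left.wedge volM.right) n5 hF
  have c3 := einstein_odd_iff hN hM hNs hMs nβ nϖ hF
  have hw : (hodge gN volN (show 1 + 4 = 5 from rfl) ϖ).left.wedge
          (hodge gM volM (show 3 + 3 = 6 from rfl) ε).d.right =
        (((β.left.wedge ϖ.left).wedge ε.right).wedge ν.right :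
          FormField ((𝓡 5).prod (𝓡 6)) (N × M) 8) ↔
        ∀ x : N × M, (-1 : ℝ) ^ 4 • box (show 4 + (3 + 1) = 7 + 1 from rfl)
          (hodge gN volN (show 1 + 4 = 5 from rfl) ϖ x.1)
          ((hodge gM volM (show 3 + 3 = 6 from rfl) ε).d x.2) =
          box (show 4 + (3 + 1) = 7 + 1 from rfl) (β.wedge ϖ x.1) (ε.wedge ν x.2) := by
    rw [show ((-1 : ℝ) ^ 4) = 1 by norm_num, FormField.ext_asProd]
    simp only [one_smul]
    refine forall_congr' fun x => ?_
    have e1 := asProd_box (hodge gN volN (show 1 + 4 = 5 from rfl) ϖ)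
      (hodge gM volM (show 3 + 3 = 6 from rfl) ε).d (x := x)
    have e2 := wedge_wedge_eq_box (show 3 + 1 + (3 + 1) = 3 + 1 + 3 + 1 from rfl) β ϖ ε ν x
    exact iff_of_eq (congrArg₂ Eq e1 e2)
  rw [hbg]
  constructor
  · rintro ⟨h1, h2, h3⟩
    obtain ⟨a1, a2, a3, a4⟩ := hc.1 h1
    obtain ⟨b1, b2, b3, b4⟩ := c2.1 h2
    exact ⟨(c3.1 h3).1, ⟨a1, a2, a3, a4, b2, b1, b3, hw.2 b4⟩, (c3.1 h3).2⟩
  · rintro ⟨d1, ⟨a1, a2, a3, a4, b2, b1, b3, b4⟩, d2⟩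
    exact ⟨hc.2 ⟨a1, a2, a3, a4⟩, c2.2 ⟨b1, b2, b3, hw.1 b4⟩, c3.2 ⟨d1, d2⟩⟩

end Backgrounds

end Sugra

end

theorem mainTheorem7
    {N : Type*} [TopologicalSpace N] [ChartedSpace (EuclideanSpace ℝ (Fin 5)) N]
    [IsManifold (𝓡 5) ∞ N] [ConnectedSpace N]
    {M : Type*} [TopologicalSpace M] [ChartedSpace (EuclideanSpace ℝ (Fin 6)) M]
    [IsManifold (𝓡 6) ∞ M] [ConnectedSpace M]
    (gN : Sugra.BilinField (𝓡 5) N) (hgN : Sugra.IsLorentzian gN)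
    (gM : Sugra.BilinField (𝓡 6) M) (hgM : Sugra.IsNegRiemannian gM)
    (volN : Sugra.FormField (𝓡 5) N 5) (hvolN : Sugra.IsVolumeForm gN volN)
    (volM : Sugra.FormField (𝓡 6) M 6) (hvolM : Sugra.IsVolumeForm gM volM) :
    (∀ (α : Sugra.FormField (𝓡 5) N 4) (β : Sugra.FormField (𝓡 5) N 3)
        (φ : M → ℝ) (ν : Sugra.FormField (𝓡 6) M 1),
      α.Smooth → β.Smooth → ContMDiff (𝓡 6) 𝓘(ℝ, ℝ) ∞ φ → ν.Smooth →
      α ≠ 0 → β ≠ 0 → φ ≠ 0 → ν ≠ 0 →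
      Sugra.IsNull gN α → Sugra.IsNull gN β →
      (Sugra.IsBackground (Sugra.prodMetric gN gM) (volN.left.wedge volM.right)
          ((fun p => φ p.2 • α.left p) + β.left.wedge ν.right) ↔
        Sugra.IsRicciFlat gM ∧
        (∃ κ l : ℝ,
          α.d = 0 ∧ ν.d = 0 ∧
          (Sugra.ofFunction (𝓡 6) φ).d = κ • ν ∧
          β.d = -κ • α ∧
          (Sugra.hodge gN volN (show 3 + 2 = 5 from rfl) β).d = 0 ∧
          (Sugra.hodge gN volN (show 4 + 1 = 5 from rfl) α).d =
            -l • Sugra.hodge gN volN (show 3 + 2 = 5 from rfl) β ∧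
          (Sugra.hodge gM volM (show 1 + 5 = 6 from rfl) ν).d =
            l • Sugra.hodge gM volM (show 0 + 6 = 6 from rfl) (Sugra.ofFunction (𝓡 6) φ)) ∧
        (∀ (p : N) (q : M) (X Y : TangentSpace (𝓡 5) p),
          Sugra.ricci gN p X Y =
            -(1 / 2) * Sugra.formInner (gN p) (Sugra.interior X (α p)) (Sugra.interior Y (α p))
                * φ q ^ 2
            - (1 / 2) * Sugra.formInner (gN p) (Sugra.interior X (β p)) (Sugra.interior Y (β p))
                * Sugra.formInner (gM q) (ν q) (ν q)) ∧
        (∀ (p : N) (X : TangentSpace (𝓡 5) p),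
          Sugra.formInner (gN p) (β p) (Sugra.interior X (α p)) = 0))) ∧
    (∀ (β : Sugra.FormField (𝓡 5) N 3) (ϖ : Sugra.FormField (𝓡 5) N 1)
        (ν : Sugra.FormField (𝓡 6) M 1) (ε : Sugra.FormField (𝓡 6) M 3),
      β.Smooth → ϖ.Smooth → ν.Smooth → ε.Smooth →
      β ≠ 0 → ϖ ≠ 0 → ν ≠ 0 → ε ≠ 0 →
      Sugra.IsNull gN β → Sugra.IsNull gN ϖ →
      (Sugra.IsBackground (Sugra.prodMetric gN gM) (volN.left.wedge volM.right)
          (β.left.wedge ν.right + ϖ.left.wedge ε.right) ↔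
        Sugra.IsRicciFlat gM ∧
        (β.d = 0 ∧ ν.d = 0 ∧ ϖ.d = 0 ∧ ε.d = 0 ∧
          (Sugra.hodge gM volM (show 1 + 5 = 6 from rfl) ν).d = 0 ∧
          (Sugra.hodge gN volN (show 3 + 2 = 5 from rfl) β).d = 0 ∧
          (Sugra.hodge gN volN (show 1 + 4 = 5 from rfl) ϖ).d = 0 ∧
          (Sugra.hodge gN volN (show 1 + 4 = 5 from rfl) ϖ).left.wedge
              (Sugra.hodge gM volM (show 3 + 3 = 6 from rfl) ε).d.right =
            (((β.left.wedge ϖ.left).wedge ε.right).wedge ν.right :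
              Sugra.FormField ((𝓡 5).prod (𝓡 6)) (N × M) 8)) ∧
        (∀ (p : N) (q : M) (X Y : TangentSpace (𝓡 5) p),
          Sugra.ricci gN p X Y =
            -(1 / 2) * Sugra.formInner (gN p) (Sugra.interior X (β p)) (Sugra.interior Y (β p))
                * Sugra.formInner (gM q) (ν q) (ν q)
            - (1 / 2) * ϖ p (fun _ => X) * ϖ p (fun _ => Y)
                * Sugra.formInner (gM q) (ε q) (ε q)))) := by
  have : IsManifold (𝓡 5) 1 N := IsManifold.of_le (n := ∞) (by simp)
  have : IsManifold (𝓡 6) 1 M := IsManifold.of_le (n := ∞) (by simp)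
  have hN := hgN.isNondeg
  have hM := hgM.isNondeg
  refine ⟨fun α β φ ν hα hβ hφ hν hα0 hβ0 hφ0 hν0 nα nβ => ?_,
    fun β ϖ ν ε hβ hϖ hν hε hβ0 hϖ0 hν0 hε0 nβ nϖ => ?_⟩
  · exact Sugra.isBackground_even_iff hN hM hgN.smooth hgM.smooth hvolN hvolM hα.isDiff hβ.isDiff
      (hφ.mdifferentiable (by simp)) hν.isDiff hα0 hβ0 hφ0 hν0 nα nβ
  · exact Sugra.isBackground_odd_iff hN hM hgN.smooth hgM.smooth hvolN hvolM hβ.isDiff hϖ.isDiff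
      hν.isDiff hε.isDiff hβ0 hϖ0 hν0 hε0 nβ nϖ
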